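/- **Setting.** A triangulation $T$ is a finite complex of ordered simplices (each simplex has distinct vertices, the set of all vertices is linearly ordered, several simplices may have the same vertices) that is a closed 4-dimensional oriented pseudomanifold: it is pure, and each tetrahedron lies in exactly two pentachora, which induce opposite orientations on it. In particular $T$ may be any triangulation of a closed oriented PL 4-manifold $M$. Let $\varepsilon_u=\pm1$ say whether the orientation of the pentachoron $u$ agrees with the order of its vertices. If $\sigma$ has vertices $v_0<\dots<v_n$, let $\sigma_i$ be its face opposite to $v_i$. Let $\omega$ be a $\mathbb C$-valued simplicial 2-cocycle with all $\omega_s\ne0$, let $q_s^2=\omega_s$, and $K_t=\prod_{s\subset t}q_s$ for each tetrahedron $t$. For 2-cocycles $x,y$ on $t$, with values $x_i,y_i,\omega_i$ on the faces $t_i$, the bilinear form $$T_t(x,y)=\tfrac12\Bigl(\sum_{i=0}^3(-1)^i\frac{x_iy_i}{\omega_i}+\frac1{K_t}\det\begin{pmatrix}\omega_1&x_1&y_1\\ \omega_2&x_2&y_2\\ \omega_3&x_3&y_3\end{pmatrix}\Bigr)$$ has rank one. Factor it as $T_t(x,y)=\beta_t(x)\gamma_t(y)$; the linear forms $\beta_t,\gamma_t$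 are unique up to $\beta_t\mapsto\mu\beta_t$, $\gamma_t\mapsto\mu^{-1}\gamma_t$, and any such factorization is fixed. Let $\vartheta_t$ be Grassmann variables over $\mathbb C$, one for each tetrahedron, and $\partial_t$ the left differentiations. A 2-cocycle $c$ on a pentachoron $u$ defines the operator $$d_c=\sum_{i=0}^4\bigl(\beta_{u_i}(c)\,\partial_{u_i}+\varepsilon_u(-1)^i\gamma_{u_i}(c)\,\vartheta_{u_i}\bigr).$$ Assume that $\omega$ is generic in the sense that for each $u$ the differential parts of the $d_c$ span all five $\partial_{u_i}$. Then there is a unique weight $\mathcal W_u=\exp(-\frac12\sum_{i,j}F^{(u)}_{ij}\vartheta_{u_i}\vartheta_{u_j})$, with $F^{(u)}$ skew-symmetric, annihilated by all $d_c$. Let arbitrary numbers $\eta_u\in\mathbb C$ be attached to the pentachora. Consider the complex $$0\to\mathbb C\xrightarrow{f_1}Z^2(T,\mathbb C)\xrightarrow{f_2}\mathbb C^{N_3}\xrightarrow{f_3}\mathbb C^{N_3}\xrightarrow{f_4}Z^2(T,\mathbb C)^*\xrightarrow{f_5}\mathbb C\to0,$$ where $N_3$ is the number of tetrahedra, $f_1(1)=\omega$,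 $f_2(c)=(\beta_t(c))_t$, $f_3$ is the skew-symmetric matrix with $\prod_u\mathcal W_u=\exp(\Theta^{\mathrm T}f_3\Theta)$ for the column $\Theta$ of all $\vartheta_t$, $f_4=f_2^{\mathrm T}$, $f_5=f_1^{\mathrm T}$. Assume that it is acyclic. The space $Z^2(T,\mathbb C)$ has a distinguished basis that consists of the coboundaries $\delta b$ of the edges $b\in\mathsf B$, where the complement of $\mathsf B$ is a maximal tree of the 1-skeleton, and of cocycles representing a chosen basis of $H^2$. Put $$\sqrt\tau=\frac{\operatorname{minor}f_1\cdot\operatorname{Pfaffian}(\text{submatrix of }f_3)}{\operatorname{minor}f_2},\qquad I=\prod_{\text{2-faces }s}q_s^{-1}\prod_{\text{pentachora }u}\eta_u\cdot\sqrt\tau,$$ where $\operatorname{minor}f_1$ is a nonzero entry of $f_1$, $\operatorname{minor}f_2$ is a nonzero minor of $f_2$ using all columns except the one with the number of that entry, and the submatrix of $f_3$ is nondegenerate, its rows and its columns corresponding to the tetrahedra not used as rows in $\operatorname{minor}f_2$. The quantity $I$ is considered up to a sign. **Theorem.** Let a triangulation contain the pentachora $12345$, $12346$, $12356$ and let the move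 3–3 $$12345,\ 12346,\ 12356\ \to\ 12456,\ 13456,\ 23456$$ replace them, the tetrahedra $1234,1235,1236$ and the 2-face $123$ by the pentachora on the right, the tetrahedra $1456,2456,3456$ and the 2-face $456$ (the numbers $1,\dots,6$ are names of six vertices; their order in the triangulation may be arbitrary). Let $\omega$, $q$, $\beta$, $\gamma$, $\eta$ and the orientations be given on both triangulations, with the same values on common simplices, so that both triangulations satisfy the assumptions above, and let distinguished bases be chosen that correspond to the same basis of $H^2$. Suppose that, up to a sign, $$\frac{\eta_{12345}\eta_{12346}\eta_{12356}}{q_{123}}\iiint\mathcal W_{12345}\mathcal W_{12346}\mathcal W_{12356}\,\mathrm d\vartheta_{1234}\,\mathrm d\vartheta_{1235}\,\mathrm d\vartheta_{1236} =\frac{\eta_{12456}\eta_{13456}\eta_{23456}}{q_{456}}\iiint\mathcal W_{12456}\mathcal W_{13456}\mathcal W_{23456}\,\mathrm d\vartheta_{1456}\,\mathrm d\vartheta_{2456}\,\mathrm d\vartheta_{3456},$$ where the integrals are Berezin integrals: $\int(f_0+f_1\vartheta)\,\mathrm d\vartheta=f_1$ if $f_0,f_1$ do not contain $\vartheta$,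 and multiple integrals are iterated, the leftmost differential first. Then the quantities $I$ for the initial and the final triangulation exist and are equal up to a sign, for all choices of the maximal trees, of the cocycles representing the basis of $H^2$, and of the minors. -/

import Mathlib

noncomputable section

namespace ExoticTorsion

universe u

/-! ### Triangulations

Triangulations are taken in the broad sense (several simplices may have the same vertices), with
ordered vertices: every simplex has distinct vertices, listed in increasing order. -/

/-- A semi-simplicial set with linearly ordered vertices; `face σ i` is the face of `σ` opposite to
its `i`-th vertex. The edge `e` goes from `face e 1` to `face e 0`, so the last field says that the
vertices of every simplex are listed in strictly increasing order. -/
structure DeltaComplex where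
  Cell : ℕ → Type u
  face : ∀ {n : ℕ}, Cell (n + 1) → Fin (n + 2) → Cell n
  face_face : ∀ {n : ℕ} (σ : Cell (n + 2)) (i j : Fin (n + 2)), i ≤ j →
    face (face σ j.succ) i = face (face σ i.castSucc) j
  vertexOrder : LinearOrder (Cell 0)
  edge_lt : ∀ e : Cell 1, vertexOrder.lt (face e 1) (face e 0)

variable {X : DeltaComplex.{u}}

/-- The simplicial coboundary of complex cochains. -/
def coboundary (X : DeltaComplex.{u}) (n : ℕ) :
    (X.Cell n → ℂ) →ₗ[ℂ] (X.Cell (n + 1) → ℂ) :=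
  LinearMap.pi fun σ => ∑ i : Fin (n + 2), (-1 : ℂ) ^ (i : ℕ) • LinearMap.proj (X.face σ i)

/-- A finite subcomplex. -/
structure Subcomplex (X : DeltaComplex.{u}) where
  cells : ∀ n : ℕ, Finset (X.Cell n)
  face_mem : ∀ {n : ℕ} (σ : X.Cell (n + 1)), σ ∈ cells (n + 1) → ∀ i, X.face σ i ∈ cells n

/-- `A` is a closed 4-dimensional pseudomanifold, consistently oriented by `o`. The sign `o u` is
`1` if the orientation of the pentachoron `u` is that given by the order of its vertices, and `-1`
otherwise. Every consistently oriented triangulation of a closed 4-manifold is of this kind. -/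
structure IsClosedOriented (A : Subcomplex X) (o : X.Cell 4 → ℤˣ) : Prop where
  dim_le : ∀ n, 4 < n → A.cells n = ∅
  pure : ∀ n, n < 4 → ∀ σ ∈ A.cells n, ∃ ρ ∈ A.cells (n + 1), ∃ i, X.face ρ i = σ
  two : ∀ t ∈ A.cells 3,
    {p : X.Cell 4 × Fin 5 | p.1 ∈ A.cells 4 ∧ X.face p.1 p.2 = t}.ncard = 2
  opposite : ∀ u ∈ A.cells 4, ∀ v ∈ A.cells 4, ∀ i j : Fin 5, (u, i) ≠ (v, j) →
    X.face u i = X.face v j →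
    (o u : ℤ) * (-1) ^ (i : ℕ) = -((o v : ℤ) * (-1) ^ (j : ℕ))

/-! ### Cocycles of a triangulation

A cochain of the subcomplex `A` is a cochain of the ambient complex which vanishes outside `A`. -/

open Classical in
/-- Restriction of cochains to `A`, extended by zero. -/
def restrict (A : Subcomplex X) (n : ℕ) : (X.Cell n → ℂ) →ₗ[ℂ] (X.Cell n → ℂ) :=
  LinearMap.pi fun σ => if σ ∈ A.cells n then LinearMap.proj σ else 0

/-- The space `Z²(A, ℂ)`. -/
def cocycles (A : Subcomplex X) : Submodule ℂ (X.Cell 2 → ℂ) where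
  carrier := {c | (∀ s, s ∉ A.cells 2 → c s = 0) ∧ ∀ t ∈ A.cells 3, coboundary X 2 c t = 0}
  zero_mem' := by simp
  add_mem' := by
    rintro a b ⟨ha, ha'⟩ ⟨hb, hb'⟩
    refine ⟨fun s hs => by simp [ha s hs, hb s hs], fun t ht => by simp [ha' t ht, hb' t ht]⟩
  smul_mem' := by
    rintro z a ⟨ha, ha'⟩
    refine ⟨fun s hs => by simp [ha s hs], fun t ht => by simp [ha' t ht]⟩

theorem restrict_mem_cocycles (A : Subcomplex X) (c : X.Cell 2 → ℂ)
    (hc : ∀ t ∈ A.cells 3, coboundary X 2 c t = 0) : restrict A 2 c ∈ cocycles A := by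
  refine ⟨fun s hs => by simp [restrict, hs], fun t ht => ?_⟩
  rw [← hc t ht]
  simp [coboundary, restrict, A.face_mem t ht]

/-- The space `B²(A, ℂ)`. -/
def coboundaries (A : Subcomplex X) : Submodule ℂ (X.Cell 2 → ℂ) :=
  (LinearMap.range (coboundary X 1)).map (restrict A 2)

open Classical in
/-- The coboundary, in `A`, of the 1-cochain equal to `1` on the edge `b` and to `0` on all other
edges. -/
def edgeCocycle (A : Subcomplex X) (b : X.Cell 1) : X.Cell 2 → ℂ :=
  restrict A 2 (coboundary X 1 (Pi.single b 1))

/-- The graph on the vertices of `A` whose edges are the edges of `A` that are not in `B`. -/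
def complementGraph (A : Subcomplex X) (B : Finset (X.Cell 1)) :
    SimpleGraph {v : X.Cell 0 // v ∈ A.cells 0} :=
  SimpleGraph.fromRel fun v w =>
    ∃ e ∈ A.cells 1, e ∉ B ∧ X.face e 1 = v.1 ∧ X.face e 0 = w.1

/-- `B` is a set of edges of `A` whose complement is a maximal tree in the 1-skeleton. -/
structure IsCotree (A : Subcomplex X) (B : Finset (X.Cell 1)) : Prop where
  subset : B ⊆ A.cells 1
  noParallel : ∀ e ∈ A.cells 1, ∀ e' ∈ A.cells 1, e ∉ B → e' ∉ B →
    X.face e 0 = X.face e' 0 → X.face e 1 = X.face e' 1 → e = e'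
  isTree : (complementGraph A B).IsTree

/-- A distinguished basis of `Z²(A, ℂ)`: the coboundaries of the edges in a set `B` whose
complement is a maximal tree, and `h` more cocycles (which then represent a basis of `H²`). -/
structure CocycleBasis (A : Subcomplex X) (h : ℕ) where
  B : Finset (X.Cell 1)
  isCotree : IsCotree A B
  basis : Module.Basis (B ⊕ Fin h) ℂ (cocycles A)
  basis_inl : ∀ b : B, (basis (Sum.inl b) : X.Cell 2 → ℂ) = edgeCocycle A b

/-- The cocycles in the distinguished basis that represent a basis of `H²`. -/
def CocycleBasis.rep {A : Subcomplex X} {h : ℕ} (b : CocycleBasis A h) (k : Fin h) :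
    X.Cell 2 → ℂ :=
  b.basis (Sum.inr k)

/-! ### Edge operators and pentachoron weights -/

/-- A function on the 2-faces of a tetrahedron (indexed by the opposite vertices) is a cocycle. -/
def IsTetCocycle (x : Fin 4 → ℂ) : Prop :=
  ∑ i : Fin 4, (-1 : ℂ) ^ (i : ℕ) * x i = 0

/-- For the values `w` of `ω` and `p` of `q` on the faces of a tetrahedron, the bilinear form in
two cocycles `x`, `y` on the tetrahedron
`½ (∑ᵢ (-1)ⁱ xᵢ yᵢ / wᵢ + det(w, x, y) / K)`, where `K` is the product of the four `pᵢ` and the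
determinant is taken in the coordinates `1, 2, 3` on the 3-dimensional space of cocycles. If `w` is
a cocycle with nonzero values and `pᵢ² = wᵢ`, this form has rank one. -/
def edgeForm (w p x y : Fin 4 → ℂ) : ℂ :=
  (1 / 2) * (∑ i : Fin 4, (-1 : ℂ) ^ (i : ℕ) * x i * y i / w i +
    Matrix.det !![w 1, x 1, y 1; w 2, x 2, y 2; w 3, x 3, y 3] / ∏ i, p i)

/-- The values of a 2-cochain on the four faces of a tetrahedron. -/
def onTet (t : X.Cell 3) : (X.Cell 2 → ℂ) →ₗ[ℂ] (Fin 4 → ℂ) :=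
  LinearMap.funLeft ℂ ℂ (X.face t)

theorem edgeForm_add (w p x x' y : Fin 4 → ℂ) :
    edgeForm w p (x + x') y = edgeForm w p x y + edgeForm w p x' y := by
  simp only [edgeForm, Fin.sum_univ_four, Matrix.det_fin_three, Matrix.of_apply, Matrix.cons_val,
    Pi.add_apply]
  ring

theorem edgeForm_smul (w p x y : Fin 4 → ℂ) (z : ℂ) :
    edgeForm w p (z • x) y = z * edgeForm w p x y := by
  simp only [edgeForm, Fin.sum_univ_four, Matrix.det_fin_three, Matrix.of_apply, Matrix.cons_val,
    Pi.smul_apply, smul_eq_mul]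
  ring

/-- The given data: the 2-cocycle `ω`, the square roots `q` of its values, the orientations `o` and
the multipliers `η` of the pentachora, and, for each tetrahedron, a cocycle `gauge` on it, which
only fixes the scale of the Grassmann variable of the tetrahedron. -/
structure WeightData (X : DeltaComplex.{u}) where
  ω : X.Cell 2 → ℂ
  q : X.Cell 2 → ℂ
  o : X.Cell 4 → ℤˣ
  η : X.Cell 4 → ℂ
  gauge : X.Cell 3 → Fin 4 → ℂ

namespace WeightData

variable (D : WeightData X)

/-- The `edgeForm` of the tetrahedron `t`; its number `K` is the product of `q` over the four faces
of `t`. -/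
def form (t : X.Cell 3) (x y : Fin 4 → ℂ) : ℂ :=
  edgeForm (onTet t D.ω) (onTet t D.q) x y

/-- The coefficient of `∂_t` in the operator of a cocycle. Together with `γ` it is characterized, up
to `β ↦ μ β`, `γ ↦ μ⁻¹ γ`, by `β t x * γ t y = form t x y` for cocycles `x`, `y`. All values of `μ`
are obtained by varying `gauge`. -/
def β (t : X.Cell 3) : (Fin 4 → ℂ) →ₗ[ℂ] ℂ where
  toFun x := D.form t x (D.gauge t)
  map_add' x x' := edgeForm_add _ _ x x' _
  map_smul' z x := edgeForm_smul _ _ x _ z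

/-- The coefficient of `θ_t` in the operator of a cocycle, for `t` oriented by the order of its
vertices. -/
def γ (t : X.Cell 3) (y : Fin 4 → ℂ) : ℂ :=
  D.form t (D.gauge t) y / D.form t (D.gauge t) (D.gauge t)

/-- For a cocycle `c` on a pentachoron `u` with the 3-faces `tᵢ`, the local operator is
`d_c = ∑ᵢ (β(c|tᵢ) ∂ᵢ + localγ u i c θᵢ)`, where the sign in `localγ` compares the orientation of
`tᵢ` induced from `u` with the one given by the order of vertices. The edge operators of `u` are the
`d_c` for `c` the coboundaries of edges. -/
def localγ (u : X.Cell 4) (i : Fin 5) (c : X.Cell 2 → ℂ) : ℂ :=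
  ((D.o u : ℤ) : ℂ) * (-1) ^ (i : ℕ) * D.γ (X.face u i) (onTet (X.face u i) c)

/-- `c` is a cocycle on the pentachoron `u`, and `β(c|tᵢ) = zᵢ` for its 3-faces `tᵢ`. -/
def IsLift (u : X.Cell 4) (z : Fin 5 → ℂ) (c : X.Cell 2 → ℂ) : Prop :=
  ∀ i, coboundary X 2 c (X.face u i) = 0 ∧ D.β (X.face u i) (onTet (X.face u i) c) = z i

/-- The conditions on the data over `A`. The last one says that the differential parts of the edge
operators of each pentachoron `u` span all linear combinations of the five differentiations; this is
the genericity of `ω` needed for the Gaussian weight of `u` to exist. -/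
structure IsAdmissible (A : Subcomplex X) : Prop where
  ω_closed : ∀ t ∈ A.cells 3, coboundary X 2 D.ω t = 0
  ω_ne_zero : ∀ s ∈ A.cells 2, D.ω s ≠ 0
  q_sq : ∀ s ∈ A.cells 2, D.q s ^ 2 = D.ω s
  gauge_closed : ∀ t ∈ A.cells 3, IsTetCocycle (D.gauge t)
  gauge_ne_zero : ∀ t ∈ A.cells 3, D.form t (D.gauge t) (D.gauge t) ≠ 0
  generic : ∀ u ∈ A.cells 4, ∀ z : Fin 5 → ℂ, ∃ c, D.IsLift u z c

open Classical in
/-- A cocycle on `u` whose operator has the form `d_c = ∂ᵢ + ∑ⱼ F i j θⱼ`. -/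
def dualCocycle (u : X.Cell 4) (i : Fin 5) : X.Cell 2 → ℂ :=
  if h : ∃ c, D.IsLift u (Pi.single i 1) c then h.choose else 0

/-- The matrix `F` of the pentachoron `u`. It is the skew-symmetric matrix for which the Gaussian
weight `exp (-½ θᵀ F θ)` is annihilated by all the operators `d_c`, in particular by
`∂ᵢ + ∑ⱼ F i j θⱼ`. -/
def F (u : X.Cell 4) : Matrix (Fin 5) (Fin 5) ℂ :=
  fun i j => D.localγ u j (D.dualCocycle u i)

end WeightData

/-! ### Grassmann algebra and Berezin integral -/

/-- The Grassmann algebra over `ℂ` with one generator for each tetrahedron. -/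
abbrev Grassmann (X : DeltaComplex.{u}) : Type u := ExteriorAlgebra ℂ (X.Cell 3 →₀ ℂ)

/-- The generator of the tetrahedron `t`. -/
def θ (t : X.Cell 3) : Grassmann X := ExteriorAlgebra.ι ℂ (Finsupp.single t 1)

/-- The Berezin integral over the generator of `t`: the linear functional sending `f₀ + f₁ θ` to
`f₁` whenever `f₀`, `f₁` do not contain the generator `θ` of `t`. It is the right contraction with
the coordinate function of `t`. -/
def berezin (t : X.Cell 3) (f : Grassmann X) : Grassmann X :=
  CliffordAlgebra.contractRight f (Finsupp.lapply t)

/-- The pentachoron weight `exp (-½ θᵀ F θ)`; the exponent is nilpotent. -/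
def WeightData.weight (D : WeightData X) (u : X.Cell 4) : Grassmann X :=
  IsNilpotent.exp (-(1 / 2 : ℂ) •
    ∑ i : Fin 5, ∑ j : Fin 5, D.F u i j • (θ (X.face u i) * θ (X.face u j)))

/-! ### The chain complex, its torsion, and the quantity `I` -/

section Torsion

variable (D : WeightData X) (A : Subcomplex X)

/-- The cocycle `ω` as an element of `Z²(A, ℂ)`. -/
def omegaCocycle (hD : D.IsAdmissible A) : cocycles A :=
  ⟨restrict A 2 D.ω, restrict_mem_cocycles A D.ω hD.ω_closed⟩

/-- `f₁ : ℂ → Z²` sends `1` to `ω`. -/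
def f₁ (hD : D.IsAdmissible A) : ℂ →ₗ[ℂ] cocycles A :=
  LinearMap.toSpanSingleton ℂ (cocycles A) (omegaCocycle D A hD)

/-- `f₂` sends a cocycle `c` to the coefficients of the global operator `D_c = ∑ β(c|t) ∂_t`. -/
def f₂ : cocycles A →ₗ[ℂ] (A.cells 3 → ℂ) :=
  LinearMap.pi fun t => D.β t.1 ∘ₗ onTet t.1 ∘ₗ (cocycles A).subtype

open Classical in
/-- The skew-symmetric matrix `f₃` for which `exp (Θᵀ f₃ Θ)` is the product of the weights of all
pentachora of `A`. -/
def f₃ : Matrix (A.cells 3) (A.cells 3) ℂ := fun t t' =>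
  -(1 / 2) * ∑ u ∈ A.cells 4, ∑ i : Fin 5, ∑ j : Fin 5,
    if X.face u i = t.1 ∧ X.face u j = t'.1 then D.F u i j else 0

/-- `f₄` is the transpose of `f₂`. -/
def f₄ : (A.cells 3 → ℂ) →ₗ[ℂ] Module.Dual ℂ (cocycles A) :=
  ∑ t : A.cells 3, (LinearMap.proj t : (A.cells 3 → ℂ) →ₗ[ℂ] ℂ).smulRight
    ((LinearMap.proj t : (A.cells 3 → ℂ) →ₗ[ℂ] ℂ) ∘ₗ f₂ D A)

/-- `f₅` is the transpose of `f₁`. -/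
def f₅ (hD : D.IsAdmissible A) : Module.Dual ℂ (cocycles A) →ₗ[ℂ] ℂ :=
  Module.Dual.eval ℂ (cocycles A) (omegaCocycle D A hD)

open Classical in
/-- The complex
`0 → ℂ → Z² → ℂ^{tetrahedra} → ℂ^{tetrahedra} → (Z²)* → ℂ → 0` is acyclic. -/
structure IsAcyclic (hD : D.IsAdmissible A) : Prop where
  injective : Function.Injective (f₁ D A hD)
  exact₁₂ : Function.Exact (f₁ D A hD) (f₂ D A)
  exact₂₃ : Function.Exact (f₂ D A) (Matrix.toLin' (f₃ D A))
  exact₃₄ : Function.Exact (Matrix.toLin' (f₃ D A)) (f₄ D A)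
  exact₄₅ : Function.Exact (f₄ D A) (f₅ D A hD)
  surjective : Function.Surjective (f₅ D A hD)

/-- The Pfaffian of a skew-symmetric matrix with rows and columns indexed by
`(0,0), (0,1), (1,0), (1,1), …`. -/
def pfaffian {n : ℕ} (A : Matrix (Fin n × Fin 2) (Fin n × Fin 2) ℂ) : ℂ :=
  ((2 : ℂ) ^ n * (n.factorial : ℂ))⁻¹ * ∑ σ : Equiv.Perm (Fin n × Fin 2),
    ((Equiv.Perm.sign σ : ℤ) : ℂ) * ∏ i : Fin n, A (σ (i, 0)) (σ (i, 1))

/-- A choice of rows and columns for the minors of `f₁`, `f₂`, `f₃`: the row `i₀` of `f₁`; the rows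
of `f₂`, its columns being all but `i₀`; and an enumeration of the remaining tetrahedra, which index
the rows and columns used in `f₃`. -/
structure MinorChoice {A : Subcomplex X} {h : ℕ} (b : CocycleBasis A h) where
  i₀ : b.B ⊕ Fin h
  rows : {i : b.B ⊕ Fin h // i ≠ i₀} ↪ A.cells 3
  n : ℕ
  rest : Fin n × Fin 2 ≃ {t : A.cells 3 // t ∉ Set.range rows}

variable {D A} {h : ℕ} {b : CocycleBasis A h} (m : MinorChoice b)

def MinorChoice.minor₁ (hD : D.IsAdmissible A) : ℂ :=
  b.basis.repr (f₁ D A hD 1) m.i₀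

open Classical in
def MinorChoice.minor₂ (D : WeightData X) : ℂ :=
  Matrix.det (Matrix.of fun i j : {i : b.B ⊕ Fin h // i ≠ m.i₀} =>
    f₂ D A (b.basis j.1) (m.rows i))

def MinorChoice.pf₃ (D : WeightData X) : ℂ :=
  pfaffian ((f₃ D A).submatrix (fun k => (m.rest k).1) (fun k => (m.rest k).1))

/-- `√τ`. -/
def MinorChoice.sqrtTorsion (hD : D.IsAdmissible A) : ℂ :=
  m.minor₁ hD * m.pf₃ D / m.minor₂ D

/-- `x` is a value of the quantity
`I = ∏_{2-faces} q⁻¹ · ∏_{pentachora} η · √τ`, for some choice of nonzero minors. -/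
def IsValueOfI (hD : D.IsAdmissible A) (b : CocycleBasis A h) (x : ℂ) : Prop :=
  ∃ m : MinorChoice b, m.minor₁ hD ≠ 0 ∧ m.minor₂ D ≠ 0 ∧ m.pf₃ D ≠ 0 ∧
    x = (∏ s ∈ A.cells 2, (D.q s)⁻¹) * (∏ u ∈ A.cells 4, D.η u) * m.sqrtTorsion hD

end Torsion

/-! ### The Pachner move 3–3 -/

/-- The place of the vertex `k` among the vertices of the 5-simplex that are not in `o`. -/
def place (o : Finset (Fin 6)) (k : Fin 6) : ℕ :=
  (Finset.univ.filter fun l => l < k ∧ l ∉ o).card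

open Classical in
/-- `b` is obtained from `a` by replacing its subset `old` with the new elements `new`. -/
def IsReplacement {C : Type*} (a b old new : Finset C) : Prop :=
  old ⊆ a ∧ Disjoint new a ∧ b = (a \ old) ∪ new

/-- The six pentachora forming the boundary of a 5-simplex in the complex: `pent i` is opposite to
the `i`-th vertex in increasing order. The vertices called `1, …, 6` in the description of the move
are, respectively, the vertices at the places `name 0, …, name 5` in this order (`name` is the
identity if `1, …, 6` are numbered increasingly). -/
structure Hexateron (X : DeltaComplex.{u}) where
  pent : Fin 6 → X.Cell 4
  pent_face : ∀ i j : Fin 5, i ≤ j →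
    X.face (pent j.succ) i = X.face (pent i.castSucc) j
  name : Equiv.Perm (Fin 6)

namespace Hexateron

variable (H : Hexateron X)

/-- The pentachoron opposite to the vertex called `a + 1`. -/
def opp₁ (a : Fin 6) : X.Cell 4 := H.pent (H.name a)

/-- The tetrahedron opposite to the edge with the vertices called `a + 1`, `b + 1`. -/
def opp₂ (a b : Fin 6) : X.Cell 3 :=
  X.face (H.opp₁ a) (Fin.ofNat 5 (place {H.name a} (H.name b)))

/-- The 2-face opposite to the 2-face with the vertices called `a + 1`, `b + 1`, `c + 1`. -/
def opp₃ (a b c : Fin 6) : X.Cell 2 :=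
  X.face (H.opp₂ a b) (Fin.ofNat 4 (place {H.name a, H.name b} (H.name c)))

def p12345 : X.Cell 4 := H.opp₁ 5
def p12346 : X.Cell 4 := H.opp₁ 4
def p12356 : X.Cell 4 := H.opp₁ 3
def p12456 : X.Cell 4 := H.opp₁ 2
def p13456 : X.Cell 4 := H.opp₁ 1
def p23456 : X.Cell 4 := H.opp₁ 0
def t1234 : X.Cell 3 := H.opp₂ 4 5
def t1235 : X.Cell 3 := H.opp₂ 3 5
def t1236 : X.Cell 3 := H.opp₂ 3 4
def t1456 : X.Cell 3 := H.opp₂ 1 2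
def t2456 : X.Cell 3 := H.opp₂ 0 2
def t3456 : X.Cell 3 := H.opp₂ 0 1
def s123 : X.Cell 2 := H.opp₃ 3 4 5
def s456 : X.Cell 2 := H.opp₃ 0 1 2

open Classical in
/-- The move `12345, 12346, 12356 → 12456, 13456, 23456` transforms the triangulation `A` into the
triangulation `A'`. -/
structure IsMove33 (A A' : Subcomplex X) : Prop where
  vertices : A'.cells 0 = A.cells 0
  edges : A'.cells 1 = A.cells 1
  faces : IsReplacement (A.cells 2) (A'.cells 2) {H.s123} {H.s456}
  tetrahedra : IsReplacement (A.cells 3) (A'.cells 3)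
    {H.t1234, H.t1235, H.t1236} {H.t1456, H.t2456, H.t3456}
  pentachora : IsReplacement (A.cells 4) (A'.cells 4)
    {H.p12345, H.p12346, H.p12356} {H.p12456, H.p13456, H.p23456}

/-- The left-hand side of the relation 3–3. -/
def lhs33 (D : WeightData X) : Grassmann X :=
  (D.η H.p12345 * D.η H.p12346 * D.η H.p12356 / D.q H.s123) •
    berezin H.t1236 (berezin H.t1235 (berezin H.t1234
      (D.weight H.p12345 * D.weight H.p12346 * D.weight H.p12356)))

/-- The right-hand side of the relation 3–3. -/
def rhs33 (D : WeightData X) : Grassmann X :=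
  (D.η H.p12456 * D.η H.p13456 * D.η H.p23456 / D.q H.s456) •
    berezin H.t3456 (berezin H.t2456 (berezin H.t1456
      (D.weight H.p12456 * D.weight H.p13456 * D.weight H.p23456)))

end Hexateron

/-- The distinguished bases of `Z²(A, ℂ)` and `Z²(A', ℂ)` represent the same basis of the second
cohomology: each pair of corresponding representatives comes, up to coboundaries, from one cochain
that is closed both on `A` and on `A'`. -/
def SameCohomologyBasis {A A' : Subcomplex X} {h : ℕ}
    (b : CocycleBasis A h) (b' : CocycleBasis A' h) : Prop :=
  ∀ k : Fin h, ∃ c : X.Cell 2 → ℂ,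
    (∀ t ∈ A.cells 3, coboundary X 2 c t = 0) ∧ (∀ t ∈ A'.cells 3, coboundary X 2 c t = 0) ∧
    b.rep k - restrict A 2 c ∈ coboundaries A ∧ b'.rep k - restrict A' 2 c ∈ coboundaries A'

end ExoticTorsion

end

noncomputable section

namespace ExoticTorsion

universe u

/-! ### Pfaffians -/

/-! Everything is compared after squaring, since `I` matters only up to sign.

One triangulation. Fix a linear form `φ` on the cocycles with `φ(ω) = 1`, which exists by
surjectivity of `f₅`. Adjoining `φ` as an extra row to the chosen rows of `f₂` gives a square matrix
`N` of full size, and Cramer's rule yields `det N · minor f₁ = minor f₂`. Hence `√τ = Pf / det N`,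
and the deleted column has disappeared (`MinorChoice.sqrtTorsion_eq`). Passing to other rows
replaces one complementary set of standard basis vectors by another. Modulo the image of `f₂` these
sets are related by a matrix `D`. Since `f₃` kills that image on both sides, its submatrix changes
by the congruence with `D`, so its Pfaffian is multiplied by `det D`. The determinant of `N` is
multiplied by the same factor up to sign (`pfaffian_mul_det_sq_eq`,
`MinorChoice.sqrtTorsion_sq_eq`). Exactness at the first `ℂ^{N₃}` makes the complementary submatrix
of `f₃` nondegenerate, and a symplectic basis shows that its Pfaffian is then nonzero. So `I` exists
and its square is independent of the minors.

Two triangulations. It remains to find one convenient choice of minors on each side. All rows of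
`f₂` can be taken from the tetrahedra common to both triangulations (`IsMove33.exists_rows`). The
reason is the anticommutation of the local operators: if the differential coefficients of a cocycle
vanish on all faces of a pentachoron, so do its multiplicative ones, and the cocycle is proportional
to `ω` on each of these faces. Applied to the pentachora around the removed cluster, this forces
proportionality to `ω`, with one common factor, on the whole boundary of the cluster. Closedness
then extends it to the removed tetrahedra (`IsMove33.β_eq_zero`). The cocycle spaces of the two
triangulations are identified through cochains closed on both. This identification preserves `ω` and
the common rows of `f₂`, and changes distinguished bases by a determinant `±1`, because edge
coboundaries are integral combinations of the basis ones in either direction. Thus `det N` is the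
same on both sides up to sign (`IsMove33.exists_transported_rows`).

Finally, up to a nonzero constant, the Pfaffian is the Berezin integral of the product of all
weights over the tetrahedra left out of the rows. These are the three removed tetrahedra,
respectively the three new ones, together with a list common to both sides. Integrating the three
first, the weights of the common pentachora factor out. The relation 3–3 therefore becomes an
equality of Pfaffians with the prefactors of `η` and `q` (`IsMove33.exists_pfaffian_sq_eq`), and the
remaining factors of `I` belong to common simplices. -/

/-- In the expansion of the determinant the term of `σ` survives only for `h = l ∘ σ`, so the sum
over all index functions collapses to the unnormalised Pfaffian. It serves both the congruence rule,
with `l = id`, and the Grassmann coefficients. -/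
theorem sum_prod_mul_det_eq {n : ℕ} {τ : Type*} [Fintype τ] [DecidableEq τ] (M : Matrix τ τ ℂ)
    (l : Fin n × Fin 2 → τ) :
    ∑ h : Fin n × Fin 2 → τ, (∏ i : Fin n, M (h (i, 0)) (h (i, 1))) *
      Matrix.det (Matrix.of fun x y => if h x = l y then (1 : ℂ) else 0) =
    ∑ σ : Equiv.Perm (Fin n × Fin 2), ((Equiv.Perm.sign σ : ℤ) : ℂ) *
      ∏ i : Fin n, M (l (σ (i, 0))) (l (σ (i, 1))) := by
  have hdet : ∀ h : Fin n × Fin 2 → τ,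
      Matrix.det (Matrix.of fun x y => if h x = l y then (1 : ℂ) else 0) =
      ∑ σ : Equiv.Perm (Fin n × Fin 2), ((Equiv.Perm.sign σ : ℤ) : ℂ) *
        if h = l ∘ σ then 1 else 0 := by
    intro h
    rw [← Matrix.det_transpose, Matrix.det_apply']
    refine Finset.sum_congr rfl fun σ _ => ?_
    congr 1
    simp only [Matrix.transpose_apply, Matrix.of_apply]
    rw [Finset.prod_ite_zero]
    simp [funext_iff]
  simp_rw [hdet, Finset.mul_sum]
  rw [Finset.sum_comm]
  refine Finset.sum_congr rfl fun σ _ => ?_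
  rw [Finset.sum_eq_single (l ∘ σ)]
  · simp [mul_comm]
  · intro h _ hne
    simp [hne]
  · simp

theorem prod_sum_sum_eq {n : ℕ} {τ : Type*} [Fintype τ] [DecidableEq τ]
    (g : Fin n → τ → τ → ℂ) :
    ∏ i, ∑ k, ∑ l, g i k l = ∑ h : Fin n × Fin 2 → τ, ∏ i, g i (h (i, 0)) (h (i, 1)) := by
  have h1 : ∀ i, ∑ k, ∑ l, g i k l = ∑ p : τ × τ, g i p.1 p.2 := fun i => by
    rw [Fintype.sum_prod_type]
  simp_rw [h1, Finset.prod_univ_sum, Fintype.piFinset_univ]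
  rw [← Equiv.sum_comp ((Equiv.curry (Fin n) (Fin 2) τ).trans
    (Equiv.arrowCongr (Equiv.refl _) (finTwoArrowEquiv τ)))]
  refine Finset.sum_congr rfl fun h _ => ?_
  simp [Function.curry]

/-- Expanding the product gives a sum over index functions `h` of a monomial in `A` times the
determinant of the rows of `P` selected by `h`. That determinant is `det P` times the determinant of
the 0/1 selection matrix, and `sum_prod_mul_det_eq` collects the rest. -/
theorem pfaffian_congr {n : ℕ} (A P : Matrix (Fin n × Fin 2) (Fin n × Fin 2) ℂ) :
    pfaffian (P.transpose * A * P) = P.det * pfaffian A := by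
  unfold pfaffian
  rw [mul_left_comm]
  congr 1
  have key := sum_prod_mul_det_eq A id
  simp only [id] at key
  rw [← key, Finset.mul_sum]
  have hexp : ∀ σ : Equiv.Perm (Fin n × Fin 2),
      ∏ i : Fin n, (P.transpose * A * P) (σ (i, 0)) (σ (i, 1)) =
      ∑ h : Fin n × Fin 2 → Fin n × Fin 2, (∏ i, A (h (i, 0)) (h (i, 1))) *
        ∏ x, P (h x) (σ x) := by
    intro σ
    have h2 : ∀ i, (P.transpose * A * P) (σ (i, 0)) (σ (i, 1)) =
        ∑ k, ∑ l, A k l * (P k (σ (i, 0)) * P l (σ (i, 1))) := by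
      intro i
      simp only [Matrix.mul_apply, Matrix.transpose_apply, Finset.sum_mul]
      rw [Finset.sum_comm]
      refine Finset.sum_congr rfl fun k _ => Finset.sum_congr rfl fun l _ => ?_
      ring
    simp_rw [h2, prod_sum_sum_eq fun i k l => A k l * (P k (σ (i, 0)) * P l (σ (i, 1)))]
    refine Finset.sum_congr rfl fun h _ => ?_
    rw [Finset.prod_mul_distrib, Fintype.prod_prod_type]
    simp
  simp_rw [hexp, Finset.mul_sum]
  rw [Finset.sum_comm]
  refine Finset.sum_congr rfl fun h _ => ?_
  have hd : (Matrix.of fun x y => if h x = y then (1 : ℂ) else 0) * P = P.submatrix h id := by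
    ext x y
    simp [Matrix.mul_apply]
  have hd' := congrArg Matrix.det hd
  rw [Matrix.det_mul, ← Matrix.det_transpose (P.submatrix h id),
    Matrix.det_apply' (P.submatrix h id).transpose] at hd'
  rw [mul_left_comm, mul_comm P.det, hd', Finset.mul_sum]
  refine Finset.sum_congr rfl fun σ _ => ?_
  simp only [Matrix.transpose_apply, Matrix.submatrix_apply, id]
  ring

/-- The matrix of the standard symplectic form. -/
def symplecticMatrix (n : ℕ) : Matrix (Fin n × Fin 2) (Fin n × Fin 2) ℂ :=
  fun x y => if x.1 = y.1 then !![0, 1; -1, 0] x.2 y.2 else 0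

/-- A nonzero term forces `σ` to carry pairs to pairs: it is a permutation `π` of the pairs composed
with a permutation `ε i` inside each. The sign of `π` occurs twice and cancels, and the entry for
the pair `i` equals the sign of `ε i`, so the term is a product of squares of signs. -/
theorem symplecticMatrix_term {n : ℕ} (σ : Equiv.Perm (Fin n × Fin 2)) :
    ((Equiv.Perm.sign σ : ℤ) : ℂ) * ∏ i : Fin n, symplecticMatrix n (σ (i, 0)) (σ (i, 1)) = 0 ∨
    ((Equiv.Perm.sign σ : ℤ) : ℂ) * ∏ i : Fin n, symplecticMatrix n (σ (i, 0)) (σ (i, 1)) = 1 := by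
  by_cases hz : ∏ i : Fin n, symplecticMatrix n (σ (i, 0)) (σ (i, 1)) = 0
  · left; simp [hz]
  right
  rw [Finset.prod_eq_zero_iff] at hz
  have hne : ∀ i, symplecticMatrix n (σ (i, 0)) (σ (i, 1)) ≠ 0 := fun i hi =>
    hz ⟨i, Finset.mem_univ _, hi⟩
  have h1 : ∀ i, (σ (i, 0)).1 = (σ (i, 1)).1 := fun i => by
    by_contra h
    exact hne i (by simp [symplecticMatrix, h])
  have h2 : ∀ i, (σ (i, 0)).2 ≠ (σ (i, 1)).2 := fun i h => by
    have := congrArg σ.symm (Prod.ext (h1 i) h)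
    simp at this
  let p : Fin n → Fin n := fun i => (σ (i, 0)).1
  have hpa : ∀ i a, (σ (i, a)).1 = p i := by
    intro i a
    fin_cases a
    · rfl
    · exact (h1 i).symm
  have hp : Function.Surjective p := by
    intro j
    obtain ⟨⟨i, a⟩, hx⟩ := σ.surjective (j, 0)
    exact ⟨i, by rw [← hpa i a, hx]⟩
  let π : Equiv.Perm (Fin n) := Equiv.ofBijective p (Finite.surjective_iff_bijective.1 hp)
  have hf : ∀ i, Function.Injective fun a => (σ (i, a)).2 := by
    intro i a b hab
    have := congrArg σ.symm (Prod.ext ((hpa i a).trans (hpa i b).symm) hab)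
    simpa using this
  let ε : Fin n → Equiv.Perm (Fin 2) := fun i =>
    Equiv.ofBijective _ (Finite.injective_iff_bijective.1 (hf i))
  have hσ : σ = (Equiv.prodCongrLeft fun _ : Fin 2 => π) * Equiv.prodCongrRight ε := by
    ext x : 1
    obtain ⟨i, a⟩ := x
    simp only [Equiv.Perm.mul_apply, Equiv.prodCongrRight_apply, Equiv.prodCongrLeft_apply]
    exact Prod.ext (hpa i a) rfl
  have hs : (Equiv.Perm.sign σ : ℤ) = ∏ i, (Equiv.Perm.sign (ε i) : ℤ) := by
    conv_lhs => rw [hσ]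
    rw [map_mul, Equiv.Perm.sign_prodCongrLeft, Equiv.Perm.sign_prodCongrRight, Fin.prod_univ_two,
      Int.units_mul_self, one_mul]
    simp
  have hterm : ∀ i, symplecticMatrix n (σ (i, 0)) (σ (i, 1)) =
      ((Equiv.Perm.sign (ε i) : ℤ) : ℂ) := by
    intro i
    have hε0 : (σ (i, 0)).2 = ε i 0 := rfl
    have hε1 : (σ (i, 1)).2 = ε i 1 := rfl
    simp only [symplecticMatrix, h1 i, if_true, hε0, hε1]
    generalize ε i = e
    have he : e = 1 ∨ e = Equiv.swap 0 1 := by revert e; decide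
    rcases he with rfl | rfl
    · simp
    · rw [Equiv.Perm.sign_swap (by decide)]
      simp
  rw [Finset.prod_congr rfl fun i _ => hterm i, hs]
  push_cast
  rw [← Finset.prod_mul_distrib]
  refine Finset.prod_eq_one fun i _ => ?_
  rcases Int.units_eq_one_or (Equiv.Perm.sign (ε i)) with h | h <;> simp [h]

theorem pfaffian_symplecticMatrix_ne_zero (n : ℕ) : pfaffian (symplecticMatrix n) ≠ 0 := by
  classical
  unfold pfaffian
  refine mul_ne_zero (inv_ne_zero (mul_ne_zero (by simp) (by exact_mod_cast n.factorial_ne_zero))) ?_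
  -- Counting the terms equal to 1 moves the sum to `ℕ`, where the identity permutation alone makes
  -- it positive.
  let k : Equiv.Perm (Fin n × Fin 2) → ℕ := fun σ =>
    if ((Equiv.Perm.sign σ : ℤ) : ℂ) * ∏ i : Fin n, symplecticMatrix n (σ (i, 0)) (σ (i, 1)) = 0
    then 0 else 1
  have hk : ∀ σ : Equiv.Perm (Fin n × Fin 2), ((Equiv.Perm.sign σ : ℤ) : ℂ) *
      ∏ i : Fin n, symplecticMatrix n (σ (i, 0)) (σ (i, 1)) = (k σ : ℂ) := by
    intro σ
    rcases symplecticMatrix_term σ with h | h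
    · rw [h]; simp only [k, if_pos h]; simp
    · have h0 : ((Equiv.Perm.sign σ : ℤ) : ℂ) *
          ∏ i : Fin n, symplecticMatrix n (σ (i, 0)) (σ (i, 1)) ≠ 0 := by rw [h]; exact one_ne_zero
      rw [h]; simp only [k, if_neg h0]; simp
  simp_rw [hk]
  rw [← Nat.cast_sum, Nat.cast_ne_zero]
  have h1 : k 1 = 1 := by
    have : ((Equiv.Perm.sign (1 : Equiv.Perm (Fin n × Fin 2)) : ℤ) : ℂ) * ∏ i : Fin n,
        symplecticMatrix n ((1 : Equiv.Perm (Fin n × Fin 2)) (i, 0))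
          ((1 : Equiv.Perm (Fin n × Fin 2)) (i, 1)) = 1 := by
      simp [symplecticMatrix]
    simp only [k]
    rw [this]
    simp
  have := Finset.single_le_sum (f := k) (fun _ _ => Nat.zero_le _)
    (Finset.mem_univ (1 : Equiv.Perm (Fin n × Fin 2)))
  omega

/-- A nondegenerate alternating form has a symplectic basis. -/
theorem exists_symplectic_basis (d : ℕ) : ∀ {V : Type u} [AddCommGroup V] [Module ℂ V]
    [FiniteDimensional ℂ V] (_ : Module.finrank ℂ V = d) (B : V →ₗ[ℂ] V →ₗ[ℂ] ℂ)
    (_ : ∀ x, B x x = 0) (_ : ∀ x, (∀ y, B x y = 0) → x = 0),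
    ∃ (n : ℕ) (b : Module.Basis (Fin n × Fin 2) ℂ V), ∀ x y, B (b x) (b y) =
      symplecticMatrix n x y := by
  induction d using Nat.strong_induction_on with
  | _ d ih =>
  intro V _ _ _ hd B halt hnd
  have hskew : ∀ x y, B x y = - B y x := by
    intro x y
    have := halt (x + y)
    simp only [map_add, LinearMap.add_apply, halt, zero_add, add_zero] at this
    linear_combination this
  by_cases h0 : d = 0
  · subst h0
    have := Module.finrank_zero_iff.1 hd
    exact ⟨0, Module.Basis.empty V, fun x => (x.1.elim0)⟩
  · have : Nontrivial V := Module.nontrivial_of_finrank_pos (R := ℂ) (by omega)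
    obtain ⟨e, he⟩ := exists_ne (0 : V)
    obtain ⟨f0, hf0⟩ : ∃ y, B e y ≠ 0 := by
      by_contra h
      push Not at h
      exact he (hnd e h)
    obtain ⟨f, hf⟩ : ∃ f, B e f = 1 := ⟨(B e f0)⁻¹ • f0, by simp [hf0]⟩
    have hfe : B f e = -1 := by rw [hskew, hf]
    -- `W` is the orthogonal complement of the hyperbolic plane spanned by `e` and `f`; the
    -- induction runs on it.
    let W : Submodule ℂ V := LinearMap.ker ((B e).prod (B f))
    have hW : ∀ w : W, B e w = 0 ∧ B f w = 0 := fun w => by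
      have := w.2
      simpa [W] using this
    have hdim : d ≤ Module.finrank ℂ W + 2 := by
      have h1 := LinearMap.finrank_range_add_finrank_ker ((B e).prod (B f))
      have h2 := Submodule.finrank_le (LinearMap.range ((B e).prod (B f)))
      simp only [Module.finrank_prod, Module.finrank_self] at h2
      change _ + Module.finrank ℂ W = _ at h1
      omega
    have hlt : Module.finrank ℂ W < d := by
      rw [← hd]
      refine Submodule.finrank_lt fun h => ?_
      have h1 : f ∈ W := by rw [h]; trivial
      have := (hW ⟨f, h1⟩).1
      simp [hf] at this
    obtain ⟨n, b, hb⟩ := ih _ hlt rfl (B.domRestrict₁₂ W W) (fun x => halt _) (by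
      intro x hx
      refine Subtype.ext (hnd x fun v => ?_)
      -- This is the projection of `v` to `W` along the plane. A vector of `W` pairs with it as with
      -- `v`, so nondegeneracy passes to `W`.
      have hv : v + B f v • e - B e v • f ∈ W := by
        simp [W, halt, hf, hfe]
      have := hx ⟨_, hv⟩
      have hxe : B x e = 0 := by rw [hskew, (hW x).1, neg_zero]
      have hxf : B x f = 0 := by rw [hskew, (hW x).2, neg_zero]
      rw [LinearMap.domRestrict₁₂_apply] at this
      simpa [hxe, hxf] using this)
    simp only [LinearMap.domRestrict₁₂_apply] at hb
    let v : Fin (n + 1) × Fin 2 → V := fun x =>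
      Fin.cases (![e, f] x.2) (fun i => (b (i, x.2) : V)) x.1
    have hv : ∀ x y, B (v x) (v y) = symplecticMatrix (n + 1) x y := by
      rintro ⟨i, a⟩ ⟨j, c⟩
      refine Fin.cases ?_ (fun i => ?_) i <;> refine Fin.cases ?_ (fun j => ?_) j
      · fin_cases a <;> fin_cases c <;> simp [v, symplecticMatrix, halt, hf, hfe]
      · have := hW (b (j, c))
        have h' : (0 : Fin (n + 1)) ≠ j.succ := (Fin.succ_ne_zero j).symm
        fin_cases a <;> simp [v, symplecticMatrix, this, h']
      · have := hW (b (i, a))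
        have h1 : B (b (i, a)) e = 0 := by rw [hskew, this.1, neg_zero]
        have h2 : B (b (i, a)) f = 0 := by rw [hskew, this.2, neg_zero]
        fin_cases c <;> simp [v, symplecticMatrix, h1, h2]
      · simp [v, symplecticMatrix, hb]
    have hli : LinearIndependent ℂ v := by
      rw [Fintype.linearIndependent_iff]
      intro g hg x
      have key : ∀ y, ∑ x, symplecticMatrix (n + 1) y x * g x = 0 := by
        intro y
        have := congrArg (B (v y)) hg
        simp only [map_sum, map_smul, hv, smul_eq_mul, map_zero] at this
        rw [← this]
        exact Finset.sum_congr rfl fun _ _ => mul_comm _ _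
      obtain ⟨i, a⟩ := x
      simp only [Fintype.sum_prod_type, Fin.sum_univ_two] at key
      have h0 := key (i, 0)
      have h1 := key (i, 1)
      simp [symplecticMatrix] at h0 h1
      fin_cases a
      · exact h1
      · exact h0
    have hcard : Fintype.card (Fin (n + 1) × Fin 2) = Module.finrank ℂ V := by
      have h1 := hli.fintype_card_le_finrank
      have h2 := Module.finrank_eq_card_basis b
      simp only [Fintype.card_prod, Fintype.card_fin] at h1 h2 ⊢
      omega
    refine ⟨n + 1, basisOfLinearIndependentOfCardEqFinrank' v hli hcard, fun x y => ?_⟩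
    simp [hv]

/-- In a symplectic basis the form becomes `Pᵀ M P`, the standard matrix, whose Pfaffian is nonzero
and is a multiple of that of `M` by `pfaffian_congr`. The same basis shows that the size is even. -/
theorem exists_pfaffian_ne_zero {ι : Type u} [Fintype ι] [DecidableEq ι] (M : Matrix ι ι ℂ)
    (hM : ∀ i j, M i j = -M j i) (hker : ∀ w, M.mulVec w = 0 → w = 0) :
    (∃ n, Nonempty (Fin n × Fin 2 ≃ ι)) ∧
      ∀ (n : ℕ) (r : Fin n × Fin 2 ≃ ι), pfaffian (M.submatrix r r) ≠ 0 := by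
  have hskew : ∀ x y, Matrix.toLinearMap₂' ℂ (S₁ := ℂ) (S₂ := ℂ) M x y = - Matrix.toLinearMap₂' ℂ (S₁ := ℂ) (S₂ := ℂ) M y x := by
    intro x y
    simp only [Matrix.toLinearMap₂'_apply, smul_eq_mul]
    rw [Finset.sum_comm, ← Finset.sum_neg_distrib]
    refine Finset.sum_congr rfl fun i _ => ?_
    rw [← Finset.sum_neg_distrib]
    refine Finset.sum_congr rfl fun j _ => ?_
    rw [hM]; ring
  obtain ⟨n, b, hb⟩ := exists_symplectic_basis _ rfl (Matrix.toLinearMap₂' ℂ (S₁ := ℂ) (S₂ := ℂ) M)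
    (fun x => by have := hskew x x; linear_combination (1 / 2 : ℂ) * this)
    (fun x hx => hker x (by
      ext i
      have := hx (Pi.single i 1)
      rw [hskew, Matrix.toLinearMap₂'_apply'] at this
      simpa using this))
  have hcard : Fintype.card (Fin n × Fin 2) = Fintype.card ι := by
    rw [← Module.finrank_eq_card_basis b, Module.finrank_fintype_fun_eq_card]
  refine ⟨⟨n, ⟨Fintype.equivOfCardEq hcard⟩⟩, fun n' r => ?_⟩
  have hn : n' = n := by
    have := Fintype.card_congr r
    rw [← hcard] at this
    simpa using this
  subst hn
  let P : Matrix (Fin n' × Fin 2) (Fin n' × Fin 2) ℂ := Matrix.of fun x y => b y (r x)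
  have hJ : symplecticMatrix n' = P.transpose * M.submatrix r r * P := by
    ext x y
    rw [← hb, Matrix.toLinearMap₂'_apply]
    simp only [Matrix.mul_apply, Matrix.transpose_apply, Matrix.submatrix_apply, P,
      Matrix.of_apply, Finset.sum_mul, smul_eq_mul]
    rw [Finset.sum_comm, ← Equiv.sum_comp r]
    refine Finset.sum_congr rfl fun i _ => ?_
    rw [← Equiv.sum_comp r]
    refine Finset.sum_congr rfl fun j _ => ?_
    ring
  have := pfaffian_symplecticMatrix_ne_zero n'
  rw [hJ, pfaffian_congr] at this
  exact right_ne_zero_of_mul this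

/-! ### Minors of an exact sequence -/

section Minors

variable {T I Z : Type*} [AddCommGroup Z] [Module ℂ Z]

open Classical in
/-- The values of `φ` (in the row `i₀`) and of the coordinates `R i` of `g` (in the other rows `i`)
on the vectors `e j`. -/
def borderedMatrix (g : Z →ₗ[ℂ] (T → ℂ)) (φ : Z →ₗ[ℂ] ℂ) (e : I → Z) (i₀ : I)
    (R : {i : I // i ≠ i₀} → T) : Matrix I I ℂ :=
  Matrix.of fun i j => if h : i = i₀ then φ (e j) else g (e j) (R ⟨i, h⟩)

variable [Fintype I] [DecidableEq I]

/-- The bordered matrix sends the coordinates of `ω` to the basis vector of `i₀`, because `φ ω = 1`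
and `g ω = 0`. Cramer's rule then identifies the product with the `(i₀, i₀)` cofactor. -/
theorem det_borderedMatrix (g : Z →ₗ[ℂ] (T → ℂ)) (φ : Z →ₗ[ℂ] ℂ) (e : Module.Basis I ℂ Z) (i₀ : I)
    (R : {i : I // i ≠ i₀} → T) (ω : Z) (hφ : φ ω = 1) (hg : g ω = 0) :
    (borderedMatrix g φ e i₀ R).det * e.repr ω i₀ =
      Matrix.det (Matrix.of fun i j : {i : I // i ≠ i₀} => g (e j) (R i)) := by
  set N := borderedMatrix g φ e i₀ R with hN
  have hsum : ∑ j, e.repr ω j • e j = ω := e.sum_repr ω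
  have h1 : N.mulVec (e.repr ω) = Pi.single i₀ 1 := by
    ext i
    by_cases hi : i = i₀
    · subst hi
      have := congrArg φ hsum
      simp only [map_sum, map_smul, smul_eq_mul, hφ] at this
      simp only [Pi.single_eq_same, ← this, Matrix.mulVec, dotProduct, hN, borderedMatrix,
        Matrix.of_apply, dif_pos]
      exact Finset.sum_congr rfl fun _ _ => mul_comm _ _
    · have := congrFun (congrArg g hsum) (R ⟨i, hi⟩)
      simp only [map_sum, map_smul, smul_eq_mul, hg, Finset.sum_apply, Pi.smul_apply,
        Pi.zero_apply] at this
      simp only [Pi.single_eq_of_ne hi, ← this, Matrix.mulVec, dotProduct, hN, borderedMatrix,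
        Matrix.of_apply, dif_neg hi]
      exact Finset.sum_congr rfl fun _ _ => mul_comm _ _
  have h2 : N.det * e.repr ω i₀ = N.adjugate i₀ i₀ := by
    have := congrFun (congrArg N.adjugate.mulVec h1) i₀
    rw [Matrix.mulVec_mulVec, Matrix.adjugate_mul, Matrix.smul_mulVec, Matrix.one_mulVec] at this
    simpa using this
  -- The adjugate entry is the determinant with row `i₀` replaced by a basis vector, which is block
  -- triangular with a `1 × 1` block equal to 1.
  rw [h2, Matrix.adjugate_apply, Matrix.twoBlockTriangular_det' _ (fun i => i = i₀)]
  · refine (congrArg₂ (· * ·) ?_ ?_).trans (one_mul _)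
    · have gen : ∀ (inst : Fintype {i : I // i = i₀}) (A : Matrix {i : I // i = i₀} _ ℂ),
          @Matrix.det _ _ inst _ _ A = A ⟨i₀, rfl⟩ ⟨i₀, rfl⟩ := by
        intro inst A
        obtain rfl : inst = Fintype.subtypeEq i₀ := Subsingleton.elim _ _
        exact Matrix.det_eq_elem_of_subsingleton _ _
      rw [gen]
      simp [Matrix.toSquareBlockProp]
    · refine congrArg Matrix.det ?_
      ext ⟨i, hi⟩ ⟨j, hj⟩
      simp [Matrix.toSquareBlockProp, hN, borderedMatrix, hi]
  · intro i hi j hj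
    subst hi
    simp [hj]

variable [Fintype T] [DecidableEq T] {n : ℕ}

/-- The rows used in a bordered matrix and the remaining elements of `T` give all of `Option T`. -/
def borderedEquiv (i₀ : I) (R : {i : I // i ≠ i₀} ↪ T)
    (S : Fin n × Fin 2 ≃ {t : T // t ∉ Set.range R}) : I ⊕ (Fin n × Fin 2) ≃ Option T :=
  Equiv.ofBijective
    (Sum.elim (fun i => if h : i = i₀ then none else some (R ⟨i, h⟩)) fun s => some (S s).1) <| by
  constructor
  · rintro (i | s) (j | s') h
    · simp only [Sum.elim_inl] at h
      split_ifs at h with h1 h2 h2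
      · rw [h1, h2]
      · simpa using R.injective (Option.some.inj h)
    · simp only [Sum.elim_inl, Sum.elim_inr] at h
      split_ifs at h with h1
      exact absurd ⟨_, Option.some.inj h⟩ (S s').2
    · simp only [Sum.elim_inl, Sum.elim_inr] at h
      split_ifs at h with h1
      exact absurd ⟨_, (Option.some.inj h).symm⟩ (S s).2
    · simp only [Sum.elim_inr, Option.some.injEq] at h
      rw [S.injective (Subtype.ext h)]
  · rintro (_ | t)
    · exact ⟨Sum.inl i₀, by simp⟩
    · by_cases ht : t ∈ Set.range R
      · obtain ⟨⟨i, hi⟩, rfl⟩ := ht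
        exact ⟨Sum.inl i, by simp [hi]⟩
      · exact ⟨Sum.inr (S.symm ⟨t, ht⟩), by simp⟩

/-- The columns `(φ, g) (e j)` together with the standard basis vectors of the elements `S s`. -/
def extendedMatrix (g : Z →ₗ[ℂ] (T → ℂ)) (φ : Z →ₗ[ℂ] ℂ) (e : I → Z) (S : Fin n × Fin 2 → T) :
    Matrix (Option T) (I ⊕ (Fin n × Fin 2)) ℂ :=
  Matrix.of fun o c => match o, c with
    | none, Sum.inl j => φ (e j)
    | some t, Sum.inl j => g (e j) t
    | none, Sum.inr _ => 0
    | some t, Sum.inr s => if t = S s then 1 else 0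

omit [Fintype T] in
-- With the rows ordered by `borderedEquiv` the matrix is block lower triangular, with an identity
-- block for the added basis vectors.
theorem det_extendedMatrix (g : Z →ₗ[ℂ] (T → ℂ)) (φ : Z →ₗ[ℂ] ℂ) (e : I → Z) (i₀ : I)
    (R : {i : I // i ≠ i₀} ↪ T) (S : Fin n × Fin 2 ≃ {t : T // t ∉ Set.range R}) :
    ((extendedMatrix g φ e fun s => (S s).1).submatrix (borderedEquiv i₀ R S) id).det =
      (borderedMatrix g φ e i₀ R).det := by
  have : (extendedMatrix g φ e fun s => (S s).1).submatrix (borderedEquiv i₀ R S) id =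
      Matrix.fromBlocks (borderedMatrix g φ e i₀ R) 0
        (Matrix.of fun s j => g (e j) (S s).1) 1 := by
    ext (i | s) (j | s')
    · by_cases h : i = i₀ <;> simp [borderedEquiv, extendedMatrix, borderedMatrix, h]
    · by_cases h : i = i₀
      · simp [borderedEquiv, extendedMatrix, h]
      · have : R ⟨i, h⟩ ≠ (S s').1 := fun h' => (S s').2 ⟨_, h'⟩
        simp [borderedEquiv, extendedMatrix, h, this]
    · simp [borderedEquiv, extendedMatrix]
    · simp [borderedEquiv, extendedMatrix, Matrix.one_apply, Subtype.ext_iff.symm]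
  rw [this, Matrix.det_fromBlocks_zero₁₂, Matrix.det_one, mul_one]

/-- The two extended matrices share the columns coming from `Z`, so they differ by a block
triangular factor with an identity block and a block `D`. Here `D` expresses the basis vectors of
`S₂` through those of `S₁` modulo the image of `g`. Since `M` vanishes on that image on both sides,
the submatrices of `M` are congruent by `D`, and `det D` appears in the Pfaffian and in the
determinant alike. Squaring removes the sign between the two row orders. -/
theorem pfaffian_mul_det_sq_eq (g : Z →ₗ[ℂ] (T → ℂ)) (φ : Z →ₗ[ℂ] ℂ) (e : I → Z)
    (M : Matrix T T ℂ) (hr : ∀ z, M.mulVec (g z) = 0) (hl : ∀ z, M.vecMul (g z) = 0)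
    (i₁ i₂ : I) (R₁ : {i : I // i ≠ i₁} ↪ T) (R₂ : {i : I // i ≠ i₂} ↪ T)
    (S₁ : Fin n × Fin 2 ≃ {t : T // t ∉ Set.range R₁})
    (S₂ : Fin n × Fin 2 ≃ {t : T // t ∉ Set.range R₂})
    (h₁ : (borderedMatrix g φ e i₁ R₁).det ≠ 0) :
    (pfaffian (M.submatrix (fun s => (S₂ s).1) fun s => (S₂ s).1) *
      (borderedMatrix g φ e i₁ R₁).det) ^ 2 =
    (pfaffian (M.submatrix (fun s => (S₁ s).1) fun s => (S₁ s).1) *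
      (borderedMatrix g φ e i₂ R₂).det) ^ 2 := by
  set ε₁ := borderedEquiv i₁ R₁ S₁
  set ε₂ := borderedEquiv i₂ R₂ S₂
  set Y₁ := (extendedMatrix g φ e fun s => (S₁ s).1).submatrix ε₁ id with hY₁
  -- Both matrices use the row order `ε₁`, so that they can be divided by each other; for `Y₂` this
  -- costs a sign.
  set Y₂ := (extendedMatrix g φ e fun s => (S₂ s).1).submatrix ε₁ id with hY₂
  have hd₁ : Y₁.det = (borderedMatrix g φ e i₁ R₁).det := det_extendedMatrix g φ e i₁ R₁ S₁
  have hd₂ : Y₂.det ^ 2 = (borderedMatrix g φ e i₂ R₂).det ^ 2 := by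
    rw [← det_extendedMatrix g φ e i₂ R₂ S₂]
    have : Y₂ = ((extendedMatrix g φ e fun s => (S₂ s).1).submatrix ε₂ id).submatrix
        (ε₁.trans ε₂.symm) id := by
      ext; simp [hY₂]
    rw [this, Matrix.det_permute, mul_pow]
    rcases Int.units_eq_one_or (Equiv.Perm.sign (ε₁.trans ε₂.symm)) with h | h <;> simp [h, ε₂]
  have hu : IsUnit Y₁.det := by rw [hd₁]; exact h₁.isUnit
  set U := Y₁⁻¹ * Y₂ with hU
  have hYU : Y₁ * U = Y₂ := by rw [hU, ← Matrix.mul_assoc, Matrix.mul_nonsing_inv _ hu, one_mul]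
  have hcol : ∀ x j, U x (Sum.inl j) =
      (1 : Matrix (I ⊕ (Fin n × Fin 2)) (I ⊕ (Fin n × Fin 2)) ℂ) x (Sum.inl j) := by
    intro x j
    rw [← Matrix.nonsing_inv_mul _ hu]
    simp only [hU, Matrix.mul_apply]
    refine Finset.sum_congr rfl fun y _ => ?_
    congr 1
    simp only [hY₁, hY₂, Matrix.submatrix_apply, id]
    rcases ε₁ y with _ | t <;> rfl
  set D := U.toBlocks₂₂ with hD
  have hUb : U = Matrix.fromBlocks 1 U.toBlocks₁₂ 0 D := by
    conv_lhs => rw [← Matrix.fromBlocks_toBlocks U]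
    congr 1
    · ext i j; simp [Matrix.toBlocks₁₁, hcol, Matrix.one_apply]
    · ext i j; simp [Matrix.toBlocks₂₁, hcol]
  have hdet : Y₂.det = Y₁.det * D.det := by
    rw [← hYU, Matrix.det_mul, hUb, Matrix.det_fromBlocks_zero₂₁, Matrix.det_one, one_mul]
  -- The rows `some t` of `Y₁ * U = Y₂`, read in the columns of `S₂`.
  have hvec : ∀ s, (Pi.single (S₂ s).1 1 : T → ℂ) = g (∑ j, U (Sum.inl j) (Sum.inr s) • e j) +
      ∑ s₁, D s₁ s • Pi.single (S₁ s₁).1 1 := by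
    intro s
    ext t
    have := congrFun (congrFun hYU (ε₁.symm (some t))) (Sum.inr s)
    simp only [Matrix.mul_apply, hY₁, hY₂, Matrix.submatrix_apply, id, Equiv.apply_symm_apply,
      Fintype.sum_sum_type, extendedMatrix, Matrix.of_apply] at this
    simp only [Pi.single_apply, Pi.add_apply, map_sum, map_smul, Finset.sum_apply, Pi.smul_apply,
      smul_eq_mul]
    rw [← this]
    congr 1
    · exact Finset.sum_congr rfl fun _ _ => mul_comm _ _
    · exact Finset.sum_congr rfl fun _ _ => mul_comm _ _
  have hM : M.submatrix (fun s => (S₂ s).1) (fun s => (S₂ s).1) =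
      D.transpose * M.submatrix (fun s => (S₁ s).1) (fun s => (S₁ s).1) * D := by
    set B := Matrix.toLinearMap₂' ℂ (S₁ := ℂ) (S₂ := ℂ) M with hB
    have hBl : ∀ z y, B (g z) y = 0 := fun z y => by
      rw [hB, Matrix.toLinearMap₂'_apply', Matrix.dotProduct_mulVec, hl, zero_dotProduct]
    have hBr : ∀ z y, B y (g z) = 0 := fun z y => by
      rw [hB, Matrix.toLinearMap₂'_apply', hr, dotProduct_zero]
    have hB1 : ∀ a b, B (Pi.single a 1) (Pi.single b 1) = M a b := fun a b => by
      rw [hB, Matrix.toLinearMap₂'_apply']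
      simp
    ext s s'
    have h1 : M.submatrix (fun s => (S₂ s).1) (fun s => (S₂ s).1) s s' =
        B (Pi.single (S₂ s).1 1) (Pi.single (S₂ s').1 1) := by
      rw [hB1]; rfl
    rw [h1, hvec s, hvec s']
    simp only [map_add, LinearMap.add_apply, hBl, hBr, zero_add, map_sum, map_smul,
      LinearMap.sum_apply, LinearMap.smul_apply, smul_zero, Finset.sum_const_zero, hB1]
    simp only [Matrix.mul_apply, Matrix.transpose_apply, Matrix.submatrix_apply, Finset.sum_mul,
      smul_eq_mul, Finset.mul_sum]
    refine Finset.sum_congr rfl fun a _ => Finset.sum_congr rfl fun b _ => ?_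
    ring
  rw [hM, pfaffian_congr, mul_pow, mul_pow, mul_pow, ← hd₂, hdet, hd₁]
  ring

omit [DecidableEq T] in
-- Full column rank makes the rows span, so some of them form a basis.
theorem exists_minor_ne_zero (A : Matrix T I ℂ) (hA : ∀ w, A.mulVec w = 0 → w = 0) :
    ∃ R : I ↪ T, (A.submatrix R id).det ≠ 0 := by
  have hrank : Module.finrank ℂ (Submodule.span ℂ (Set.range A.row)) = Fintype.card I := by
    rw [← Matrix.rank_eq_finrank_span_row, Matrix.rank,
      LinearMap.finrank_range_of_inj, Module.finrank_fintype_fun_eq_card]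
    rw [← LinearMap.ker_eq_bot, LinearMap.ker_eq_bot']
    exact hA
  have htop : Submodule.span ℂ (Set.range A.row) = ⊤ :=
    Submodule.eq_top_of_finrank_eq (by rw [hrank, Module.finrank_fintype_fun_eq_card])
  obtain ⟨κ, a, ha, hspan, hli⟩ := exists_linearIndependent' ℂ A.row
  rw [htop] at hspan
  let bas := Module.Basis.mk hli hspan.ge
  have : Finite κ := Finite.of_injective a ha
  have := Fintype.ofFinite κ
  have hc : Fintype.card I = Fintype.card κ := by
    rw [← Module.finrank_eq_card_basis bas, Module.finrank_fintype_fun_eq_card]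
  let σ : I ≃ κ := Fintype.equivOfCardEq hc
  refine ⟨⟨a ∘ σ, ha.comp σ.injective⟩, ?_⟩
  have h2 : LinearIndependent ℂ (A.submatrix (a ∘ σ) id).row := hli.comp σ σ.injective
  rw [Matrix.linearIndependent_rows_iff_isUnit, Matrix.isUnit_iff_isUnit_det] at h2
  exact h2.ne_zero

/-- Let `w'` be `w` extended by zero. Then `M w'` vanishes off the rows `R` by assumption, and on
them because it is orthogonal to the image of `g`, whose minor on `R` is nonzero. By exactness `w' =
g z`. As `w'` vanishes on `R`, the same minor forces `z` to be a multiple of `ω`. -/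
theorem mulVec_submatrix_injective (g : Z →ₗ[ℂ] (T → ℂ)) (e : Module.Basis I ℂ Z)
    (M : Matrix T T ℂ) (hl : ∀ z, M.vecMul (g z) = 0)
    (hker : ∀ w, M.mulVec w = 0 → ∃ z, g z = w) (ω : Z) (hω : g ω = 0) (i₀ : I)
    (hi₀ : e.repr ω i₀ ≠ 0) (R : {i : I // i ≠ i₀} ↪ T)
    (hdet : Matrix.det (Matrix.of fun i j : {i : I // i ≠ i₀} => g (e j) (R i)) ≠ 0)
    (w : {t : T // t ∉ Set.range R} → ℂ)
    (hw : (M.submatrix (fun t : {t : T // t ∉ Set.range R} => t.1) fun t => t.1).mulVec w = 0) : w = 0 := by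
  classical
  let w' : T → ℂ := fun t => if h : t ∉ Set.range R then w ⟨t, h⟩ else 0
  have hw' : ∀ t : {t : T // t ∉ Set.range R}, w' t = w t := fun t => by
    simp only [w', dif_pos t.2]
  have hw'0 : ∀ i, w' (R i) = 0 := fun i =>
    dif_neg (not_not.2 (Set.mem_range_self i))
  have hsplit : ∀ f : T → ℂ, ∑ t, f t = ∑ i, f (R i) + ∑ t : {t : T // t ∉ Set.range R}, f t := by
    intro f
    rw [← Fintype.sum_subtype_add_sum_subtype (fun t => t ∈ Set.range R) f]
    congr 1
    convert (Equiv.sum_comp (Equiv.ofInjective R R.injective) fun x => f x.1).symm using 1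
    · refine Finset.sum_congr ?_ fun _ _ => rfl
      ext
      simp
    · rfl
  have h1 : ∀ t : {t : T // t ∉ Set.range R}, M.mulVec w' t = 0 := by
    intro t
    have := congrFun hw t
    rw [Pi.zero_apply] at this
    rw [← this]
    simp only [Matrix.mulVec, dotProduct, Matrix.submatrix_apply]
    rw [hsplit]
    simp [hw', hw'0]
  have h2 : ∀ i, M.mulVec w' (R i) = 0 := by
    have h3 : Matrix.vecMul (fun i => M.mulVec w' (R i))
        (Matrix.of fun i j : {i : I // i ≠ i₀} => g (e j) (R i)) = 0 := by
      ext j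
      have := Matrix.dotProduct_mulVec (g (e j)) M w'
      rw [hl, zero_dotProduct, dotProduct, hsplit] at this
      simp only [h1, mul_zero, Finset.sum_const_zero, add_zero] at this
      rw [Pi.zero_apply, ← this]
      exact Finset.sum_congr rfl fun _ _ => mul_comm _ _
    exact congrFun (Matrix.eq_zero_of_vecMul_eq_zero hdet h3)
  have h3 : M.mulVec w' = 0 := by
    ext t
    by_cases ht : t ∈ Set.range R
    · obtain ⟨i, rfl⟩ := ht
      exact h2 i
    · exact h1 ⟨t, ht⟩
  obtain ⟨z, hz⟩ := hker w' h3
  -- Subtracting this multiple of `ω` removes the coordinate `i₀` without changing the image under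
  -- `g`.
  set z' := z - (e.repr z i₀ / e.repr ω i₀) • ω with hz'
  have hgz' : g z' = w' := by rw [hz', map_sub, map_smul, hω, smul_zero, sub_zero, hz]
  have hz'0 : e.repr z' i₀ = 0 := by
    rw [hz', map_sub, map_smul, Finsupp.sub_apply, Finsupp.smul_apply, smul_eq_mul,
      div_mul_cancel₀ _ hi₀, sub_self]
  have hz'sum : z' = ∑ j : {i : I // i ≠ i₀}, e.repr z' j • e j := by
    conv_lhs => rw [← e.sum_repr z']
    rw [Fintype.sum_eq_add_sum_subtype_ne _ i₀, hz'0, zero_smul, zero_add]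
  have h5 : (Matrix.of fun i j : {i : I // i ≠ i₀} => g (e j) (R i)).mulVec
      (fun j => e.repr z' j) = 0 := by
    ext i
    have := congrFun (congrArg g hz'sum) (R i)
    rw [hgz', hw'0] at this
    simp only [map_sum, map_smul, Finset.sum_apply, Pi.smul_apply, smul_eq_mul] at this
    rw [Pi.zero_apply, this]
    exact Finset.sum_congr rfl fun _ _ => mul_comm _ _
  have h6 := Matrix.eq_zero_of_mulVec_eq_zero hdet h5
  have h7 : z' = 0 := by
    rw [hz'sum]
    refine Finset.sum_eq_zero fun j _ => ?_
    rw [congrFun h6 j, Pi.zero_apply, zero_smul]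
  ext t
  rw [← hw', ← hgz', h7, map_zero]
  rfl

end Minors

/-! ### Coefficients in the Grassmann algebra -/

section Grassmann

variable {X : DeltaComplex.{u}}

/-- The Berezin integral as a linear map. -/
def berezinₗ (t : X.Cell 3) : Grassmann X →ₗ[ℂ] Grassmann X :=
  (CliffordAlgebra.contractRight (R := ℂ)).flip (Finsupp.lapply t)

theorem berezinₗ_apply (t : X.Cell 3) (f : Grassmann X) : berezinₗ t f = berezin t f := rfl

theorem berezin_mul_ι (t : X.Cell 3) (f : Grassmann X) (a : X.Cell 3 →₀ ℂ) :
    berezin t (f * ExteriorAlgebra.ι ℂ a) =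
      a t • f - berezin t f * ExteriorAlgebra.ι ℂ a :=
  CliffordAlgebra.contractRight_mul_ι _ _ _

theorem berezin_one (t : X.Cell 3) : berezin t (1 : Grassmann X) = 0 :=
  CliffordAlgebra.contractRight_one _ _

/-- The product of vectors in the Grassmann algebra. -/
def vectorProd {k : ℕ} (v : Fin k → (X.Cell 3 →₀ ℂ)) : Grassmann X :=
  (List.ofFn fun i => ExteriorAlgebra.ι ℂ (v i)).prod

theorem vectorProd_succ {k : ℕ} (v : Fin (k + 1) → (X.Cell 3 →₀ ℂ)) :
    vectorProd v = vectorProd (fun i => v i.castSucc) * ExteriorAlgebra.ι ℂ (v (Fin.last k)) := by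
  rw [vectorProd, List.ofFn_succ', List.concat_eq_append, List.prod_append]
  simp [vectorProd]

/-- The integral is a contraction from the right: factor `i` passes the `k - i` factors behind it,
whence the sign `(-1) ^ (k + i)`. -/
theorem berezin_vectorProd (t : X.Cell 3) (k : ℕ) (v : Fin (k + 1) → (X.Cell 3 →₀ ℂ)) :
    berezin t (vectorProd v) =
      ∑ i : Fin (k + 1), ((-1 : ℂ) ^ (k + (i : ℕ)) * v i t) • vectorProd (v ∘ i.succAbove) := by
  induction k with
  | zero =>
    rw [vectorProd_succ, berezin_mul_ι]
    simp [vectorProd, berezin_one]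
  | succ k ih =>
    rw [vectorProd_succ, berezin_mul_ι, ih, Fin.sum_univ_castSucc (n := k + 1), sub_eq_add_neg,
      add_comm, Finset.sum_mul, ← Finset.sum_neg_distrib]
    congr 1
    · refine Finset.sum_congr rfl fun i _ => ?_
      rw [vectorProd_succ (v ∘ _)]
      have h1 : (fun j : Fin k => (v ∘ i.castSucc.succAbove) j.castSucc) =
          (fun j : Fin (k + 1) => v j.castSucc) ∘ i.succAbove := by
        ext j : 1
        simp [Fin.castSucc_succAbove_castSucc]
      have h2 : (v ∘ i.castSucc.succAbove) (Fin.last k) = v (Fin.last (k + 1)) := by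
        simp
      rw [h1, h2, smul_mul_assoc, ← neg_smul]
      congr 1
      simp only [Fin.val_castSucc]
      ring
    · have : (v ∘ (Fin.last (k + 1)).succAbove) = fun i => v i.castSucc := by
        ext i : 1
        simp
      rw [this, Fin.val_last, ← two_mul, pow_mul]
      simp

/-- The iterated Berezin integral over the generators of `l 0`, `l 1`, …, followed by the
projection to scalars. -/
def coeff : ∀ {k : ℕ}, (Fin k → X.Cell 3) → Grassmann X →ₗ[ℂ] ℂ
  | 0, _ => (ExteriorAlgebra.algebraMapInv : Grassmann X →ₐ[ℂ] ℂ).toLinearMap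
  | _ + 1, l => coeff (Fin.tail l) ∘ₗ berezinₗ (l 0)

theorem coeff_cons {k : ℕ} (t : X.Cell 3) (l : Fin k → X.Cell 3) (f : Grassmann X) :
    coeff (Fin.cons t l : Fin (k + 1) → X.Cell 3) f = coeff l (berezin t f) := by
  simp only [coeff, LinearMap.comp_apply, Fin.tail_cons, Fin.cons_zero, berezinₗ_apply]

theorem coeff_vectorProd_of_ne {k m : ℕ} (h : m ≠ k) (l : Fin k → X.Cell 3)
    (v : Fin m → (X.Cell 3 →₀ ℂ)) : coeff l (vectorProd v) = 0 := by
  induction k generalizing m with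
  | zero =>
    obtain ⟨m, rfl⟩ := Nat.exists_eq_succ_of_ne_zero h
    rw [vectorProd_succ]
    simp [coeff, ExteriorAlgebra.algebraMapInv]
  | succ k ih =>
    rw [coeff, LinearMap.comp_apply, berezinₗ_apply]
    cases m with
    | zero => simp [vectorProd, berezin_one]
    | succ m =>
      rw [berezin_vectorProd, map_sum]
      refine Finset.sum_eq_zero fun i _ => ?_
      rw [map_smul, ih (by omega), smul_zero]

/-- Each integration is a Laplace expansion along the first column. The extra signs `(-1) ^ k`
accumulate to the sign of reversing the order, because the first integral acts from the right. -/
theorem coeff_vectorProd {k : ℕ} (l : Fin k → X.Cell 3) (v : Fin k → (X.Cell 3 →₀ ℂ)) :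
    coeff l (vectorProd v) =
      (-1) ^ k.choose 2 * Matrix.det (Matrix.of fun i j => v i (l j)) := by
  induction k with
  | zero => simp [coeff, vectorProd]
  | succ k ih =>
    rw [coeff, LinearMap.comp_apply, berezinₗ_apply, berezin_vectorProd, map_sum,
      Matrix.det_succ_column_zero, Finset.mul_sum]
    refine Finset.sum_congr rfl fun i _ => ?_
    rw [map_smul, ih, Nat.choose_succ_succ k 1, Nat.choose_one_right, smul_eq_mul]
    have : (Matrix.of fun i j => v i (l j)).submatrix i.succAbove Fin.succ =
        Matrix.of fun a b => (v ∘ i.succAbove) a (Fin.tail l b) := rfl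
    rw [this, Matrix.of_apply, pow_add, pow_add]
    ring

/-- The quadratic element of the Grassmann algebra with the matrix `M`. -/
def quadratic {τ : Type*} [Fintype τ] (g : τ → X.Cell 3) (M : Matrix τ τ ℂ) : Grassmann X :=
  ∑ a, ∑ b, M a b • (θ (g a) * θ (g b))

theorem quadratic_pow {τ : Type*} [Fintype τ] [DecidableEq τ] (g : τ → X.Cell 3)
    (M : Matrix τ τ ℂ) (n : ℕ) :
    quadratic g M ^ n = ∑ h : Fin n × Fin 2 → τ, (∏ i, M (h (i, 0)) (h (i, 1))) •
      vectorProd fun x : Fin (n * 2) =>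
        (Finsupp.single (g (h (finProdFinEquiv.symm x))) 1 : X.Cell 3 →₀ ℂ) := by
  have h1 : quadratic g M = ∑ p : τ × τ, M p.1 p.2 • (θ (g p.1) * θ (g p.2)) := by
    rw [quadratic, Fintype.sum_prod_type]
  have h2 : quadratic g M ^ n =
      MultilinearMap.mkPiAlgebraFin ℂ n (Grassmann X) fun _ => quadratic g M := by
    simp
  rw [h2, h1, MultilinearMap.map_sum]
  rw [← Equiv.sum_comp ((Equiv.curry (Fin n) (Fin 2) τ).trans
    (Equiv.arrowCongr (Equiv.refl _) (finTwoArrowEquiv τ)))]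
  refine Finset.sum_congr rfl fun h _ => ?_
  rw [MultilinearMap.map_smul_univ]
  congr 1
  rw [MultilinearMap.mkPiAlgebraFin_apply, vectorProd, List.ofFn_mul, List.prod_flatten,
    List.map_ofFn]
  congr 2
  ext i : 1
  -- The factor number `i` occupies the places `2i` and `2i + 1`, which is the order used by
  -- `finProdFinEquiv`.
  have h3 : ∀ j : Fin 2, ∀ hj, finProdFinEquiv.symm (⟨i * 2 + j, hj⟩ : Fin (n * 2)) = (i, j) := by
    intro j hj
    rw [Equiv.symm_apply_eq]
    ext
    simp [finProdFinEquiv]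
    ring
  simp only [Function.comp_apply, List.ofFn_succ, List.ofFn_zero, List.prod_cons, List.prod_nil,
    mul_one, h3]
  rfl

/-- Each monomial contributes the determinant of the 0/1 matrix comparing its indices with `l`, and
`sum_prod_mul_det_eq` sums these to the Pfaffian. Injectivity of `g` lets indices be compared
instead of generators. -/
theorem coeff_quadratic_pow {τ : Type*} [Fintype τ] [DecidableEq τ] {g : τ → X.Cell 3}
    (hg : Function.Injective g) (M : Matrix τ τ ℂ) (n : ℕ) (l : Fin (n * 2) → τ) :
    coeff (g ∘ l) (quadratic g M ^ n) = (-1) ^ (n * 2).choose 2 * (2 ^ n * n.factorial *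
      pfaffian (M.submatrix (l ∘ finProdFinEquiv) (l ∘ finProdFinEquiv))) := by
  have hne : (2 : ℂ) ^ n * n.factorial ≠ 0 :=
    mul_ne_zero (by simp) (by exact_mod_cast n.factorial_ne_zero)
  rw [pfaffian, mul_inv_cancel_left₀ hne, quadratic_pow, map_sum]
  have := sum_prod_mul_det_eq M (l ∘ finProdFinEquiv)
  simp only [Matrix.submatrix_apply, Function.comp_apply] at this ⊢
  rw [← this, Finset.mul_sum]
  refine Finset.sum_congr rfl fun h _ => ?_
  rw [map_smul, coeff_vectorProd, smul_eq_mul, mul_left_comm]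
  congr 2
  rw [← Matrix.det_submatrix_equiv_self finProdFinEquiv]
  congr 1
  ext x y
  simp only [Matrix.submatrix_apply, Matrix.of_apply, Equiv.symm_apply_apply, Function.comp_apply]
  by_cases hxy : h x = l (finProdFinEquiv y)
  · simp [hxy]
  · rw [if_neg hxy, Finsupp.single_eq_of_ne fun h' => hxy (hg h').symm]

theorem coeff_quadratic_pow_of_ne {τ : Type*} [Fintype τ] [DecidableEq τ] (g : τ → X.Cell 3)
    (M : Matrix τ τ ℂ) {n k : ℕ} (hk : n * 2 ≠ k) (l : Fin k → X.Cell 3) :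
    coeff l (quadratic g M ^ n) = 0 := by
  rw [quadratic_pow, map_sum]
  refine Finset.sum_eq_zero fun h _ => ?_
  rw [map_smul, coeff_vectorProd_of_ne hk, smul_zero]

theorem commute_θ_mul_θ (a b : X.Cell 3) (x : Grassmann X) : Commute (θ a * θ b) x := by
  induction x using ExteriorAlgebra.induction with
  | algebraMap r => exact (Algebra.commutes r _).symm
  | ι v =>
    have h1 := ExteriorAlgebra.ι_add_mul_swap (R := ℂ) (Finsupp.single a 1) v
    have h2 := ExteriorAlgebra.ι_add_mul_swap (R := ℂ) (Finsupp.single b 1) v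
    have e1 : θ a * ExteriorAlgebra.ι ℂ v = -(ExteriorAlgebra.ι ℂ v * θ a) :=
      eq_neg_of_add_eq_zero_left h1
    have e2 : θ b * ExteriorAlgebra.ι ℂ v = -(ExteriorAlgebra.ι ℂ v * θ b) :=
      eq_neg_of_add_eq_zero_left h2
    rw [commute_iff_eq, mul_assoc, e2, mul_neg, ← mul_assoc, e1, neg_mul, neg_neg, mul_assoc]
  | mul x y hx hy => exact hx.mul_right hy
  | add x y hx hy => exact hx.add_right hy

/-- The span of the products of two generators of tetrahedra in `s`. -/
def quadraticSpan (s : Set (X.Cell 3)) : Submodule ℂ (Grassmann X) :=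
  Submodule.span ℂ {x | ∃ a ∈ s, ∃ b ∈ s, x = θ a * θ b}

theorem quadraticSpan_mono {s s' : Set (X.Cell 3)} (h : s ⊆ s') :
    quadraticSpan s ≤ quadraticSpan s' :=
  Submodule.span_mono fun _ ⟨a, ha, b, hb, e⟩ => ⟨a, h ha, b, h hb, e⟩

theorem commute_of_mem_quadraticSpan {s : Set (X.Cell 3)} {x : Grassmann X}
    (hx : x ∈ quadraticSpan s) (y : Grassmann X) : Commute x y := by
  induction hx using Submodule.span_induction with
  | mem x h =>
    obtain ⟨a, _, b, _, rfl⟩ := h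
    exact commute_θ_mul_θ a b y
  | zero => exact Commute.zero_left y
  | add x z _ _ hx hz => exact hx.add_left hz
  | smul c x _ hx => exact hx.smul_left c

theorem isNilpotent_of_mem_quadraticSpan {s : Set (X.Cell 3)} {x : Grassmann X}
    (hx : x ∈ quadraticSpan s) : IsNilpotent x := by
  induction hx using Submodule.span_induction with
  | mem x h =>
    obtain ⟨a, _, b, _, rfl⟩ := h
    refine ⟨2, ?_⟩
    rw [pow_two, ← mul_assoc, (commute_θ_mul_θ a b (θ a)).eq, ← mul_assoc, θ,
      ExteriorAlgebra.ι_sq_zero, zero_mul, zero_mul]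
  | zero => exact IsNilpotent.zero
  | add x z hx' _ hx hz => exact (commute_of_mem_quadraticSpan hx' z).isNilpotent_add hx hz
  | smul c x _ hx => exact hx.smul c

/-- The elements that can be taken out of the Berezin integral over the generator of `t`. -/
def berezinConstants (t : X.Cell 3) : Subalgebra ℂ (Grassmann X) where
  carrier := {y | ∀ x, berezin t (x * y) = berezin t x * y}
  mul_mem' {a b} ha hb x := by
    rw [← mul_assoc, hb, ha, mul_assoc]
  add_mem' {a b} ha hb x := by
    rw [mul_add, mul_add, ← ha, ← hb]
    exact map_add (berezinₗ t) _ _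
  algebraMap_mem' r x := by
    rw [← Algebra.commutes, ← Algebra.commutes, ← Algebra.smul_def, ← Algebra.smul_def]
    exact map_smul (berezinₗ t) _ _

/-- Passing two generators other than that of `t` changes the sign twice. -/
theorem quadraticSpan_le_berezinConstants {s : Set (X.Cell 3)} {t : X.Cell 3} (ht : t ∉ s)
    {x : Grassmann X} (hx : x ∈ quadraticSpan s) : x ∈ berezinConstants t := by
  induction hx using Submodule.span_induction with
  | mem x h =>
    obtain ⟨a, ha, b, hb, rfl⟩ := h
    intro y
    have hat : a ≠ t := fun h => ht (h ▸ ha)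
    have hbt : b ≠ t := fun h => ht (h ▸ hb)
    rw [← mul_assoc, θ, θ, berezin_mul_ι, berezin_mul_ι]
    simp [hat, hbt, mul_assoc]
  | zero => exact zero_mem _
  | add x z _ _ hx hz => exact add_mem hx hz
  | smul c x _ hx => exact Subalgebra.smul_mem _ hx c

theorem exp_mem (S : Subalgebra ℂ (Grassmann X)) {x : Grassmann X} (hx : x ∈ S) :
    IsNilpotent.exp x ∈ S := by
  rw [IsNilpotent.exp]
  refine sum_mem fun i _ => ?_
  rw [← Rat.cast_smul_eq_qsmul ℂ]
  exact S.smul_mem (pow_mem hx i) _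

theorem coeff_exp_quadratic {τ : Type*} [Fintype τ] [DecidableEq τ] {g : τ → X.Cell 3}
    (hg : Function.Injective g) (M : Matrix τ τ ℂ) {n k : ℕ} (hk : k = n * 2) (l : Fin k → τ) :
    coeff (g ∘ l) (IsNilpotent.exp (quadratic g M)) = (-1) ^ k.choose 2 * (2 ^ n *
      pfaffian (M.submatrix (fun x => l (Fin.cast hk.symm (finProdFinEquiv x)))
        fun x => l (Fin.cast hk.symm (finProdFinEquiv x)))) := by
  subst hk
  have hQ : quadratic g M ∈ quadraticSpan (X := X) Set.univ :=
    sum_mem fun a _ => sum_mem fun b _ => Submodule.smul_mem _ _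
      (Submodule.subset_span ⟨g a, trivial, g b, trivial, rfl⟩)
  obtain ⟨N, hN⟩ := isNilpotent_of_mem_quadraticSpan hQ
  -- The truncation is taken beyond `n`, so that the term of degree `n`, the only one that counts,
  -- is certainly present.
  rw [IsNilpotent.exp_eq_sum (pow_eq_zero_of_le (le_max_left N (n + 1)) hN), map_sum,
    Finset.sum_eq_single n]
  · rw [← Rat.cast_smul_eq_qsmul ℂ, map_smul, coeff_quadratic_pow hg]
    have hn : (n.factorial : ℂ) ≠ 0 := by exact_mod_cast n.factorial_ne_zero
    have : ∀ s p : ℂ, (((n.factorial : ℚ)⁻¹ : ℚ) : ℂ) • (s * (2 ^ n * n.factorial * p)) =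
        s * (2 ^ n * p) := by
      intro s p
      push_cast
      rw [smul_eq_mul]
      field_simp
    rw [this]
    rfl
  · intro i _ hi
    rw [← Rat.cast_smul_eq_qsmul ℂ, map_smul, coeff_quadratic_pow_of_ne g M (by omega), smul_zero]
  · intro h
    exact absurd (Finset.mem_range.2 (lt_of_lt_of_le n.lt_succ_self (le_max_right _ _))) h

/-! ### Products of pentachoron weights -/

variable (D : WeightData X)

/-- The exponent of the weight of a pentachoron. -/
def WeightData.exponent (u : X.Cell 4) : Grassmann X :=
  -(1 / 2 : ℂ) • ∑ i : Fin 5, ∑ j : Fin 5, D.F u i j • (θ (X.face u i) * θ (X.face u j))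

theorem exponent_mem_quadraticSpan (u : X.Cell 4) :
    D.exponent u ∈ quadraticSpan (Set.range (X.face u)) :=
  Submodule.smul_mem _ _ <| sum_mem fun i _ => sum_mem fun j _ => Submodule.smul_mem _ _
    (Submodule.subset_span ⟨_, ⟨i, rfl⟩, _, ⟨j, rfl⟩, rfl⟩)

theorem sum_exponent_mem_quadraticSpan (P : Finset (X.Cell 4)) :
    ∑ u ∈ P, D.exponent u ∈ quadraticSpan {t | ∃ u ∈ P, ∃ i, X.face u i = t} :=
  sum_mem fun u hu => quadraticSpan_mono
    (by rintro _ ⟨i, rfl⟩; exact ⟨u, hu, i, rfl⟩) (exponent_mem_quadraticSpan D u)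

/-- This identifies the product of all weights with the Gaussian exponential of `f₃`. A pair of
faces of `u` selects exactly one pair of tetrahedra of `A`, so the indicator sums collapse. -/
theorem sum_exponent_eq_quadratic (A : Subcomplex X) :
    ∑ u ∈ A.cells 4, D.exponent u = quadratic Subtype.val (f₃ D A) := by
  classical
  have h0 : quadratic Subtype.val (f₃ D A) = -(1 / 2 : ℂ) • ∑ a : A.cells 3, ∑ b : A.cells 3,
      (∑ u ∈ A.cells 4, ∑ i : Fin 5, ∑ j : Fin 5,
        if X.face u i = a.1 ∧ X.face u j = b.1 then D.F u i j else 0) • (θ a.1 * θ b.1) := by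
    rw [quadratic, Finset.smul_sum]
    refine Finset.sum_congr rfl fun a _ => ?_
    rw [Finset.smul_sum]
    refine Finset.sum_congr rfl fun b _ => ?_
    rw [smul_smul]
    rfl
  rw [h0]
  unfold WeightData.exponent
  rw [← Finset.smul_sum]
  congr 1
  have h1 : ∀ a : A.cells 3, ∑ b : A.cells 3, ∑ u ∈ A.cells 4, ∑ i : Fin 5, ∑ j : Fin 5,
      (if X.face u i = a.1 ∧ X.face u j = b.1 then D.F u i j • (θ a.1 * θ b.1) else 0) =
      ∑ u ∈ A.cells 4, ∑ i : Fin 5, ∑ j : Fin 5, ∑ b : A.cells 3,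
        (if X.face u i = a.1 ∧ X.face u j = b.1 then D.F u i j • (θ a.1 * θ b.1) else 0) := by
    intro a
    rw [Finset.sum_comm]
    refine Finset.sum_congr rfl fun u _ => ?_
    rw [Finset.sum_comm]
    exact Finset.sum_congr rfl fun i _ => Finset.sum_comm
  simp_rw [Finset.sum_smul, ite_smul, zero_smul]
  symm
  rw [Finset.sum_congr rfl fun a _ => h1 a, Finset.sum_comm]
  refine Finset.sum_congr rfl fun u hu => ?_
  rw [Finset.sum_comm]
  refine Finset.sum_congr rfl fun i _ => ?_
  rw [Finset.sum_comm]
  refine Finset.sum_congr rfl fun j _ => ?_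
  rw [Finset.sum_eq_single ⟨X.face u i, A.face_mem u hu i⟩,
    Finset.sum_eq_single ⟨X.face u j, A.face_mem u hu j⟩]
  · simp
  · intro b _ hb
    rw [if_neg]
    rintro ⟨-, h⟩
    exact hb (Subtype.ext h.symm)
  · simp
  · intro a _ ha
    refine Finset.sum_eq_zero fun b _ => ?_
    rw [if_neg]
    rintro ⟨h, -⟩
    exact ha (Subtype.ext h.symm)
  · simp

theorem exp_sum_exponent_insert {P : Finset (X.Cell 4)} [DecidableEq (X.Cell 4)] {u : X.Cell 4}
    (hu : u ∉ P) :
    IsNilpotent.exp (∑ v ∈ insert u P, D.exponent v) =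
      D.weight u * IsNilpotent.exp (∑ v ∈ P, D.exponent v) := by
  rw [Finset.sum_insert hu, IsNilpotent.exp_add_of_commute
    (commute_of_mem_quadraticSpan (exponent_mem_quadraticSpan D u) _)
    (isNilpotent_of_mem_quadraticSpan (exponent_mem_quadraticSpan D u))
    (isNilpotent_of_mem_quadraticSpan (sum_exponent_mem_quadraticSpan D P))]
  rfl

/-- The weights of the pentachora in `P` do not contain the three generators, so they can be moved
under the integrals. The integrand becomes the exponential of the total exponent, and the three
integrals become the first three of the list `l'`. -/
theorem coeff_berezin_weights (A : Subcomplex X) {u₁ u₂ u₃ : X.Cell 4} {t₁ t₂ t₃ : A.cells 3}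
    {P : Finset (X.Cell 4)} [DecidableEq (X.Cell 4)]
    (hA : A.cells 4 = insert u₁ (insert u₂ (insert u₃ P)))
    (h₁ : u₁ ∉ insert u₂ (insert u₃ P)) (h₂ : u₂ ∉ insert u₃ P) (h₃ : u₃ ∉ P)
    (hP : ∀ u ∈ P, ∀ i, X.face u i ≠ t₁ ∧ X.face u i ≠ t₂ ∧ X.face u i ≠ t₃)
    {n k : ℕ} (l : Fin k → A.cells 3) (hk : k + 1 + 1 + 1 = n * 2) :
    let l' : Fin (k + 1 + 1 + 1) → A.cells 3 := Fin.cons t₁ (Fin.cons t₂ (Fin.cons t₃ l))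
    coeff (Subtype.val ∘ l) (berezin t₃.1 (berezin t₂.1 (berezin t₁.1
      (D.weight u₁ * D.weight u₂ * D.weight u₃))) * IsNilpotent.exp (∑ u ∈ P, D.exponent u)) =
    (-1) ^ (k + 1 + 1 + 1).choose 2 * (2 ^ n *
      pfaffian ((f₃ D A).submatrix (fun x => l' (Fin.cast hk.symm (finProdFinEquiv x)))
        fun x => l' (Fin.cast hk.symm (finProdFinEquiv x)))) := by
  classical
  intro l'
  have hmem : ∀ t : X.Cell 3, (∀ u ∈ P, ∀ i, X.face u i ≠ t) →
      IsNilpotent.exp (∑ u ∈ P, D.exponent u) ∈ berezinConstants t := by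
    intro t ht
    refine exp_mem _ (quadraticSpan_le_berezinConstants ?_ (sum_exponent_mem_quadraticSpan D P))
    rintro ⟨u, hu, i, h⟩
    exact ht u hu i h
  rw [← hmem t₃ (fun u hu i => (hP u hu i).2.2), ← hmem t₂ (fun u hu i => (hP u hu i).2.1),
    ← hmem t₁ (fun u hu i => (hP u hu i).1), ← coeff_cons, ← coeff_cons, ← coeff_cons,
    mul_assoc, mul_assoc, ← exp_sum_exponent_insert D h₃, ← exp_sum_exponent_insert D h₂,
    ← exp_sum_exponent_insert D h₁, ← hA, sum_exponent_eq_quadratic,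
    ← coeff_exp_quadratic Subtype.val_injective (f₃ D A) hk l']
  congr 2
  ext i : 1
  refine Fin.cases rfl (fun i => ?_) i
  refine Fin.cases rfl (fun i => ?_) i
  refine Fin.cases rfl (fun i => ?_) i
  rfl

end Grassmann

/-! ### Vertices of simplices -/

variable {X : DeltaComplex.{u}}

theorem coboundary_apply {n : ℕ} (c : X.Cell n → ℂ) (σ : X.Cell (n + 1)) :
    coboundary X n c σ = ∑ i : Fin (n + 2), (-1 : ℂ) ^ (i : ℕ) * c (X.face σ i) := by
  simp [coboundary]

theorem coboundary_coboundary {n : ℕ} (c : X.Cell n → ℂ) :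
    coboundary X (n + 1) (coboundary X n c) = 0 := by
  ext σ
  rw [coboundary_apply, Pi.zero_apply]
  simp_rw [coboundary_apply, Finset.mul_sum]
  rw [← Finset.sum_product', Finset.univ_product_univ]
  let S : Finset (Fin (n + 3) × Fin (n + 2)) := {ij | (ij.1 : ℕ) ≤ (ij.2 : ℕ)}
  rw [← Finset.sum_add_sum_compl S, ← eq_neg_iff_add_eq_zero, ← Finset.sum_neg_distrib]
  refine Finset.sum_bij (fun ij hij => (ij.2.succ,
    Fin.castLT ij.1 (lt_of_le_of_lt (Finset.mem_filter.mp hij).right (Fin.is_lt ij.2)))) ?_ ?_ ?_ ?_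
  · intro ij hij
    simp only [S, Finset.compl_filter, Finset.mem_filter_univ, Fin.val_succ, Fin.val_castLT] at hij ⊢
    lia
  · rintro ⟨i, j⟩ hij ⟨i', j'⟩ hij' h
    rw [Prod.mk.injEq] at h ⊢
    exact ⟨by simpa [Fin.ext_iff] using h.2, by simpa [Fin.ext_iff] using h.1⟩
  · rintro ⟨i', j'⟩ hij'
    simp only [S, Finset.compl_filter, Finset.mem_filter_univ, not_le] at hij'
    have h0 : i' ≠ 0 := by
      rintro rfl
      simp at hij'
    refine ⟨(Fin.castSucc j', i'.pred h0), ?_, ?_⟩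
    · simp only [S, Finset.mem_filter_univ, Fin.val_castSucc, Fin.val_pred]
      lia
    · simp
  · rintro ⟨i, j⟩ hij
    simp only [S, Finset.mem_filter_univ] at hij
    have := X.face_face σ (Fin.castLT i (lt_of_le_of_lt hij j.is_lt)) j
      (by rw [Fin.le_def]; simpa using hij)
    simp only [this, Fin.castSucc_castLT, Fin.val_succ, Fin.val_castLT, pow_succ]
    ring

namespace DeltaComplex

/-- The `k`-th vertex of a simplex. -/
def vertex (X : DeltaComplex.{u}) : ∀ {n : ℕ}, X.Cell n → Fin (n + 1) → X.Cell 0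
  | 0, σ, _ => σ
  | n + 1, σ, k => Fin.lastCases (motive := fun _ => X.Cell 0)
      (X.vertex (X.face σ 0) (Fin.last n)) (fun k => X.vertex (X.face σ (Fin.last (n + 1))) k) k

/-- A family of simplices that fit together as the faces of a simplex. -/
def IsBoundary (X : DeltaComplex.{u}) {n : ℕ} (p : Fin (n + 3) → X.Cell (n + 1)) : Prop :=
  ∀ i j : Fin (n + 2), i ≤ j → X.face (p j.succ) i = X.face (p i.castSucc) j

/-- The vertices of the simplex bounded by a family of simplices. -/
def boundaryVertex (X : DeltaComplex.{u}) {n : ℕ} (p : Fin (n + 3) → X.Cell (n + 1))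
    (k : Fin (n + 3)) : X.Cell 0 :=
  Fin.lastCases (motive := fun _ => X.Cell 0)
    (X.vertex (p 0) (Fin.last (n + 1))) (fun k => X.vertex (p (Fin.last (n + 2))) k) k

theorem isBoundary_face {n : ℕ} (σ : X.Cell (n + 2)) : X.IsBoundary (X.face σ) :=
  X.face_face σ

theorem vertex_eq_boundaryVertex {n : ℕ} (σ : X.Cell (n + 2)) :
    X.vertex σ = X.boundaryVertex (X.face σ) := by
  ext k
  rw [vertex, boundaryVertex]

/-- Stated for a family that fits together like the faces of a simplex, since a `Hexateron` only
provides the boundary of a 5-simplex, with no 5-simplex filling it. Here `ih` is `vertex_face` one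
dimension lower. -/
theorem vertex_of_isBoundary {n : ℕ} (ih : ∀ (σ : X.Cell (n + 1)) (i : Fin (n + 2))
    (k : Fin (n + 1)), X.vertex (X.face σ i) k = X.vertex σ (i.succAbove k))
    {p : Fin (n + 3) → X.Cell (n + 1)} (hp : X.IsBoundary p) (i : Fin (n + 3)) (k : Fin (n + 2)) :
    X.vertex (p i) k = X.boundaryVertex p (i.succAbove k) := by
  rcases Fin.eq_castSucc_or_eq_last i with ⟨i, rfl⟩ | rfl
  · rcases Fin.eq_castSucc_or_eq_last k with ⟨k, rfl⟩ | rfl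
    · rw [Fin.castSucc_succAbove_castSucc, boundaryVertex, Fin.lastCases_castSucc, ← ih,
        ← Fin.succ_last, hp i _ (Fin.le_last i), ih, Fin.succAbove_last]
    · rcases Fin.eq_zero_or_eq_succ i with rfl | ⟨j, rfl⟩
      · simp [boundaryVertex]
      · have h := hp 0 j.castSucc (Fin.zero_le _)
        rw [Fin.castSucc_zero, Fin.succ_castSucc] at h
        have h1 : (j.succ.castSucc : Fin (n + 3)).succAbove (Fin.last (n + 1)) = Fin.last _ := by
          simp
        rw [h1, boundaryVertex, Fin.lastCases_last]
        have h2 := ih (p j.succ.castSucc) 0 (Fin.last n)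
        have h3 := ih (p 0) j.castSucc (Fin.last n)
        rw [h, h3] at h2
        simpa using h2.symm
  · rw [Fin.succAbove_last, boundaryVertex, Fin.lastCases_castSucc]

theorem vertex_face {n : ℕ} : ∀ (σ : X.Cell (n + 1)) (i : Fin (n + 2)) (k : Fin (n + 1)),
    X.vertex (X.face σ i) k = X.vertex σ (i.succAbove k) := by
  induction n with
  | zero =>
    intro σ i k
    fin_cases i <;> fin_cases k
    · exact (Fin.lastCases_last (motive := fun _ => X.Cell 0)).symm
    · exact (Fin.lastCases_castSucc (motive := fun _ => X.Cell 0) (i := (0 : Fin 1))).symm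
  | succ n ih =>
    intro σ i k
    rw [vertex_of_isBoundary ih (isBoundary_face σ), vertex_eq_boundaryVertex]

/-- At least three vertices are present, so any two of them lie in a common face, where `ih`
applies. -/
theorem boundaryVertex_lt {n : ℕ} (ih : ∀ (σ : X.Cell (n + 1)) (j k : Fin (n + 2)), j < k →
    X.vertexOrder.lt (X.vertex σ j) (X.vertex σ k))
    {p : Fin (n + 3) → X.Cell (n + 1)} (hp : X.IsBoundary p) (j k : Fin (n + 3)) (hjk : j < k) :
    X.vertexOrder.lt (X.boundaryVertex p j) (X.boundaryVertex p k) := by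
  obtain ⟨i, hi⟩ : ∃ i, i ∉ ({j, k} : Finset (Fin (n + 3))) := by
    by_contra h
    push Not at h
    have h1 := Finset.card_le_card (fun i _ => h i : (Finset.univ : Finset (Fin (n + 3))) ⊆ _)
    have h2 := Finset.card_le_two (a := j) (b := k)
    simp only [Finset.card_univ, Fintype.card_fin] at h1
    omega
  simp only [Finset.mem_insert, Finset.mem_singleton, not_or] at hi
  obtain ⟨j', rfl⟩ := Fin.exists_succAbove_eq (Ne.symm hi.1)
  obtain ⟨k', rfl⟩ := Fin.exists_succAbove_eq (Ne.symm hi.2)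
  rw [← vertex_of_isBoundary vertex_face hp, ← vertex_of_isBoundary vertex_face hp]
  exact ih _ _ _ ((Fin.strictMono_succAbove i).lt_iff_lt.1 hjk)

theorem vertex_lt {n : ℕ} : ∀ (σ : X.Cell (n + 1)) (j k : Fin (n + 2)), j < k →
    X.vertexOrder.lt (X.vertex σ j) (X.vertex σ k) := by
  induction n with
  | zero =>
    intro σ j k hjk
    obtain ⟨rfl, rfl⟩ : j = 0 ∧ k = 1 := by
      fin_cases j <;> fin_cases k <;> simp at hjk ⊢
    have e0 := vertex_face σ 1 0
    have e1 := vertex_face σ 0 0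
    have := X.edge_lt σ
    rw [show (1 : Fin 2).succAbove 0 = 0 from rfl] at e0
    rw [show (0 : Fin 2).succAbove 0 = 1 from rfl] at e1
    rw [← e0, ← e1]
    exact this
  | succ n ih =>
    intro σ
    rw [vertex_eq_boundaryVertex]
    exact boundaryVertex_lt ih (isBoundary_face σ)

theorem boundaryVertex_injective {n : ℕ} {p : Fin (n + 3) → X.Cell (n + 1)} (hp : X.IsBoundary p) :
    Function.Injective (X.boundaryVertex p) := by
  let _ := X.vertexOrder
  exact StrictMono.injective fun j k => boundaryVertex_lt vertex_lt hp j k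

theorem vertex_injective {n : ℕ} (σ : X.Cell (n + 1)) : Function.Injective (X.vertex σ) := by
  let _ := X.vertexOrder
  exact StrictMono.injective fun j k => vertex_lt σ j k

/-- The face opposite to a vertex is the only one that misses it. -/
theorem face_injective {n : ℕ} (σ : X.Cell (n + 1)) : Function.Injective (X.face σ) := by
  intro i j h
  by_contra hij
  obtain ⟨k, rfl⟩ := Fin.exists_succAbove_eq hij
  have := vertex_face σ j k
  rw [← h, vertex_face] at this
  exact Fin.succAbove_ne _ _ (vertex_injective σ this)

/-- The symmetric form of the simplicial identity: the face of `p a` missing `b` is the face of `p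
b` missing `a`, whichever of the two comes first. This is what allows the vertices of the move to be
named in any order. -/
theorem IsBoundary.face_eq {n : ℕ} {p : Fin (n + 3) → X.Cell (n + 1)} (hp : X.IsBoundary p)
    {a b : Fin (n + 3)} {i j : Fin (n + 2)} (hi : a.succAbove i = b) (hj : b.succAbove j = a) :
    X.face (p a) i = X.face (p b) j := by
  have key : ∀ (a b : Fin (n + 3)) (i j : Fin (n + 2)), a < b → a.succAbove i = b →
      b.succAbove j = a → X.face (p a) i = X.face (p b) j := by
    intro a b i j hab hi hj
    obtain ⟨a', rfl⟩ : ∃ a' : Fin (n + 2), a'.castSucc = a :=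
      ⟨⟨a, by omega⟩, rfl⟩
    obtain ⟨b', rfl⟩ := Fin.exists_succ_eq.2 (show b ≠ 0 from fun h => by simp [h] at hab)
    have h1 : i = b' := Fin.succAbove_right_injective
      (hi.trans (Fin.succAbove_of_lt_succ _ _ hab).symm)
    have h2 : j = a' := Fin.succAbove_right_injective
      (hj.trans (Fin.succAbove_of_castSucc_lt _ _ hab).symm)
    subst h1 h2
    exact (hp _ _ (by rw [Fin.lt_def] at hab; rw [Fin.le_def]; simp at hab; omega)).symm
  rcases lt_trichotomy a b with h | h | h
  · exact key a b i j h hi hj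
  · subst h
    exact absurd hi (Fin.succAbove_ne _ _)
  · exact (key b a j i h hj hi).symm

end DeltaComplex

open DeltaComplex

/-! ### The boundary of a 5-simplex -/

theorem succAbove_place : ∀ a b : Fin 6, a ≠ b →
    a.succAbove (Fin.ofNat 5 (place {a} b)) = b := by
  decide

theorem succAbove_succAbove_place : ∀ a b c : Fin 6, a ≠ b → c ≠ a → c ≠ b →
    a.succAbove ((Fin.ofNat 5 (place {a} b)).succAbove (Fin.ofNat 4 (place {a, b} c))) = c := by
  decide

namespace Hexateron

variable (H : Hexateron X)

/-- The vertex called `a + 1`. -/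
def vert (a : Fin 6) : X.Cell 0 := X.boundaryVertex H.pent (H.name a)

theorem isBoundary : X.IsBoundary H.pent := H.pent_face

theorem vert_injective : Function.Injective H.vert :=
  (boundaryVertex_injective H.isBoundary).comp H.name.injective

/-- The place of the vertex called `b + 1` in the pentachoron opposite to the vertex `a + 1`. -/
def idx₁ (a b : Fin 6) : Fin 5 := Fin.ofNat 5 (place {H.name a} (H.name b))

/-- The place of the vertex called `c + 1` in the tetrahedron opposite to the edge with the
vertices `a + 1`, `b + 1`. -/
def idx₂ (a b c : Fin 6) : Fin 4 := Fin.ofNat 4 (place {H.name a, H.name b} (H.name c))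

theorem opp₂_eq (a b : Fin 6) : H.opp₂ a b = X.face (H.opp₁ a) (H.idx₁ a b) := rfl

theorem opp₃_eq (a b c : Fin 6) : H.opp₃ a b c = X.face (H.opp₂ a b) (H.idx₂ a b c) := rfl

theorem succAbove_idx₁ {a b : Fin 6} (hab : a ≠ b) :
    (H.name a).succAbove (H.idx₁ a b) = H.name b :=
  succAbove_place _ _ (H.name.injective.ne hab)

theorem succAbove_idx₂ {a b c : Fin 6} (hab : a ≠ b) (hca : c ≠ a) (hcb : c ≠ b) :
    (H.idx₁ a b).succAbove (H.idx₂ a b c) = H.idx₁ a c := by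
  apply Fin.succAbove_right_injective (p := H.name a)
  rw [H.succAbove_idx₁ hca.symm]
  exact succAbove_succAbove_place _ _ _ (H.name.injective.ne hab) (H.name.injective.ne hca)
    (H.name.injective.ne hcb)

theorem exists_idx₁ (a : Fin 6) (i : Fin 5) : ∃ b, a ≠ b ∧ H.idx₁ a b = i := by
  have hne : H.name a ≠ (H.name a).succAbove i := (Fin.succAbove_ne _ _).symm
  refine ⟨H.name.symm ((H.name a).succAbove i), fun h => hne (by simpa using congrArg H.name h), ?_⟩
  apply Fin.succAbove_right_injective (p := H.name a)
  rw [succAbove_idx₁, Equiv.apply_symm_apply]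
  exact fun h => hne (by simpa using congrArg H.name h)

theorem exists_idx₂ {a b : Fin 6} (hab : a ≠ b) (j : Fin 4) :
    ∃ c, c ≠ a ∧ c ≠ b ∧ H.idx₂ a b c = j := by
  obtain ⟨c, hac, hc⟩ := H.exists_idx₁ a ((H.idx₁ a b).succAbove j)
  have hcb : c ≠ b := by
    rintro rfl
    exact Fin.succAbove_ne _ _ hc.symm
  refine ⟨c, hac.symm, hcb, ?_⟩
  apply Fin.succAbove_right_injective (p := H.idx₁ a b)
  rw [H.succAbove_idx₂ hab hac.symm hcb, hc]

theorem vertex_opp₁ (a : Fin 6) {b : Fin 6} (hab : a ≠ b) :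
    X.vertex (H.opp₁ a) (H.idx₁ a b) = H.vert b := by
  rw [opp₁, vertex_of_isBoundary vertex_face H.isBoundary, H.succAbove_idx₁ hab, vert]

theorem vertex_opp₂ {a b c : Fin 6} (hab : a ≠ b) (hca : c ≠ a) (hcb : c ≠ b) :
    X.vertex (H.opp₂ a b) (H.idx₂ a b c) = H.vert c := by
  rw [opp₂_eq, vertex_face, H.succAbove_idx₂ hab hca hcb, H.vertex_opp₁ a hca.symm]

theorem opp₁_injective : Function.Injective H.opp₁ := by
  intro a b h
  by_contra hab
  have h1 := H.vertex_opp₁ b (Ne.symm hab)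
  obtain ⟨c, hc, hc'⟩ := H.exists_idx₁ a (H.idx₁ b a)
  rw [← h, ← hc', H.vertex_opp₁ a hc] at h1
  exact hc (H.vert_injective h1).symm

/-- A tetrahedron determines its vertices, hence the two vertices missing from it. -/
theorem eq_or_eq_of_opp₂_eq {a b a' b' : Fin 6} (hab : a ≠ b) (hab' : a' ≠ b')
    (h : H.opp₂ a b = H.opp₂ a' b') : a = a' ∨ a = b' := by
  by_contra hne
  push Not at hne
  have h1 := H.vertex_opp₂ hab' hne.1 hne.2
  obtain ⟨c, hc, hcb, hc'⟩ := H.exists_idx₂ hab (H.idx₂ a' b' a)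
  rw [← h, ← hc', H.vertex_opp₂ hab hc hcb] at h1
  exact hc (H.vert_injective h1)

theorem opp₂_comm {a b : Fin 6} (hab : a ≠ b) : H.opp₂ a b = H.opp₂ b a :=
  H.isBoundary.face_eq (H.succAbove_idx₁ hab) (H.succAbove_idx₁ hab.symm)

theorem opp₃_comm_left {a b : Fin 6} (hab : a ≠ b) (c : Fin 6) :
    H.opp₃ a b c = H.opp₃ b a c := by
  rw [opp₃_eq, opp₃_eq, H.opp₂_comm hab, idx₂, idx₂, Finset.pair_comm]

theorem opp₃_comm_right {a b c : Fin 6} (hab : a ≠ b) (hca : c ≠ a) (hcb : c ≠ b) :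
    H.opp₃ a b c = H.opp₃ a c b :=
  (isBoundary_face (H.opp₁ a)).face_eq (H.succAbove_idx₂ hab hca hcb)
    (H.succAbove_idx₂ hca.symm hab.symm hcb.symm)

/-- The same boundary of a 5-simplex, with the names of the vertices in the opposite order. -/
def flip : Hexateron X where
  pent := H.pent
  pent_face := H.pent_face
  name := Fin.revPerm.trans H.name

theorem flip_opp₃ (a b c : Fin 6) : H.flip.opp₃ a b c = H.opp₃ a.rev b.rev c.rev := rfl

theorem flip_s123 : H.flip.s123 = H.s456 := by
  rw [s123, s456, flip_opp₃]
  change H.opp₃ 2 1 0 = H.opp₃ 0 1 2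
  rw [H.opp₃_comm_left (by decide), H.opp₃_comm_right (by decide) (by decide) (by decide),
    H.opp₃_comm_left (by decide)]

theorem flip_s456 : H.flip.s456 = H.s123 := by
  rw [s123, s456, flip_opp₃]
  change H.opp₃ 5 4 3 = H.opp₃ 3 4 5
  rw [H.opp₃_comm_left (by decide), H.opp₃_comm_right (by decide) (by decide) (by decide),
    H.opp₃_comm_left (by decide)]

end Hexateron

/-! ### Replacement of simplices and incidences in the move -/

theorem IsReplacement.symm {C : Type*} {a b old new : Finset C} (h : IsReplacement a b old new) :
    IsReplacement b a new old := by
  classical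
  obtain ⟨h1, h2, h3⟩ := h
  rw [Finset.disjoint_left] at h2
  refine ⟨?_, ?_, ?_⟩
  · rw [h3]
    intro x hx
    simp [hx]
  · rw [h3, Finset.disjoint_left]
    intro x hx hx'
    simp only [Finset.mem_union, Finset.mem_sdiff] at hx'
    rcases hx' with hx' | hx'
    · exact hx'.2 hx
    · exact h2 hx' (h1 hx)
  · rw [h3]
    ext x
    have := @h1 x
    have := @h2 x
    simp only [Finset.mem_union, Finset.mem_sdiff]
    tauto

theorem IsReplacement.mem_iff {C : Type*} {a b old new : Finset C} (h : IsReplacement a b old new)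
    (x : C) : x ∈ b ↔ (x ∈ a ∧ x ∉ old) ∨ x ∈ new := by
  classical
  rw [h.2.2]
  simp

namespace Hexateron

variable {H : Hexateron X} {A A' : Subcomplex X}

theorem IsMove33.flip (h : H.IsMove33 A A') : H.flip.IsMove33 A' A where
  vertices := h.vertices.symm
  edges := h.edges.symm
  faces := by
    rw [flip_s123, flip_s456]
    exact h.faces.symm
  tetrahedra := by
    classical
    have := h.tetrahedra.symm
    have e1 : ({H.flip.t1234, H.flip.t1235, H.flip.t1236} : Finset (X.Cell 3)) =
        {H.t1456, H.t2456, H.t3456} := by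
      have h1 : H.flip.t1234 = H.t3456 := H.opp₂_comm (a := 1) (b := 0) (by decide)
      have h2 : H.flip.t1235 = H.t2456 := H.opp₂_comm (a := 2) (b := 0) (by decide)
      have h3 : H.flip.t1236 = H.t1456 := H.opp₂_comm (a := 2) (b := 1) (by decide)
      rw [h1, h2, h3]
      ext; simp; tauto
    have e2 : ({H.flip.t1456, H.flip.t2456, H.flip.t3456} : Finset (X.Cell 3)) =
        {H.t1234, H.t1235, H.t1236} := by
      have h1 : H.flip.t1456 = H.t1236 := H.opp₂_comm (a := 4) (b := 3) (by decide)
      have h2 : H.flip.t2456 = H.t1235 := H.opp₂_comm (a := 5) (b := 3) (by decide)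
      have h3 : H.flip.t3456 = H.t1234 := H.opp₂_comm (a := 5) (b := 4) (by decide)
      rw [h1, h2, h3]
      ext; simp; tauto
    convert this using 1
  pentachora := by
    classical
    have := h.pentachora.symm
    have e1 : ({H.flip.p12345, H.flip.p12346, H.flip.p12356} : Finset (X.Cell 4)) =
        {H.p12456, H.p13456, H.p23456} := by
      change ({H.p23456, H.p13456, H.p12456} : Finset (X.Cell 4)) = _
      ext; simp; tauto
    have e2 : ({H.flip.p12456, H.flip.p13456, H.flip.p23456} : Finset (X.Cell 4)) =
        {H.p12345, H.p12346, H.p12356} := by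
      change ({H.p12356, H.p12346, H.p12345} : Finset (X.Cell 4)) = _
      ext; simp; tauto
    convert this using 1

/-- The vertex called `a + 1` is one of `4`, `5`, `6`; the pentachora opposite to these vertices are
those removed by the move. -/
def IsUpper (a : Fin 6) : Prop := 3 ≤ a

theorem isUpper_iff (a : Fin 6) : IsUpper a ↔ a = 3 ∨ a = 4 ∨ a = 5 := by
  unfold IsUpper; revert a; decide

theorem IsMove33.mem_old_pent {a : Fin 6} (ha : IsUpper a) [DecidableEq (X.Cell 4)] :
    H.opp₁ a ∈ ({H.p12345, H.p12346, H.p12356} : Finset (X.Cell 4)) := by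
  rcases (isUpper_iff a).1 ha with rfl | rfl | rfl <;> simp [p12345, p12346, p12356]

theorem exists_of_mem_old_tet [DecidableEq (X.Cell 3)] {t : X.Cell 3}
    (ht : t ∈ ({H.t1234, H.t1235, H.t1236} : Finset (X.Cell 3))) :
    ∃ a b, IsUpper a ∧ IsUpper b ∧ a ≠ b ∧ H.opp₂ a b = t := by
  simp only [Finset.mem_insert, Finset.mem_singleton] at ht
  rcases ht with rfl | rfl | rfl
  · exact ⟨4, 5, by simp [isUpper_iff], by simp [isUpper_iff], by decide, rfl⟩
  · exact ⟨3, 5, by simp [isUpper_iff], by simp [isUpper_iff], by decide, rfl⟩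
  · exact ⟨3, 4, by simp [isUpper_iff], by simp [isUpper_iff], by decide, rfl⟩

theorem IsMove33.opp₁_mem (h : H.IsMove33 A A') {a : Fin 6} (ha : IsUpper a) :
    H.opp₁ a ∈ A.cells 4 := by
  classical
  exact h.pentachora.1 (by convert mem_old_pent (H := H) ha)

theorem IsMove33.opp₂_mem (h : H.IsMove33 A A') {a : Fin 6} (ha : IsUpper a) (b : Fin 6) :
    H.opp₂ a b ∈ A.cells 3 :=
  A.face_mem _ (h.opp₁_mem ha) _

theorem IsMove33.opp₃_mem (h : H.IsMove33 A A') {a : Fin 6} (ha : IsUpper a) (b c : Fin 6) :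
    H.opp₃ a b c ∈ A.cells 2 :=
  A.face_mem _ (h.opp₂_mem ha b) _

/-- The two incidences within the removed cluster already exhaust the two allowed by closedness, so
the inner tetrahedra lie in no other pentachoron. -/
theorem IsMove33.incidences (h : H.IsMove33 A A') {o : X.Cell 4 → ℤˣ} (hA : IsClosedOriented A o)
    {a b : Fin 6} (ha : IsUpper a) (hb : IsUpper b) (hab : a ≠ b) {u : X.Cell 4}
    (hu : u ∈ A.cells 4) {i : Fin 5} (hi : X.face u i = H.opp₂ a b) :
    u = H.opp₁ a ∨ u = H.opp₁ b := by
  have h2 := hA.two _ (h.opp₂_mem ha b)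
  set I := {p : X.Cell 4 × Fin 5 | p.1 ∈ A.cells 4 ∧ X.face p.1 p.2 = H.opp₂ a b}
  have hne : (H.opp₁ a, H.idx₁ a b) ≠ (H.opp₁ b, H.idx₁ b a) := fun he =>
    hab (H.opp₁_injective (Prod.ext_iff.1 he).1)
  have hfin : I.Finite := Set.finite_of_ncard_ne_zero (by omega)
  have hsub : ({(H.opp₁ a, H.idx₁ a b), (H.opp₁ b, H.idx₁ b a)} : Set _) ⊆ I := by
    rintro p (rfl | rfl)
    · exact ⟨h.opp₁_mem ha, rfl⟩
    · exact ⟨h.opp₁_mem hb, (H.opp₂_comm hab).symm⟩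
  have heq := Set.eq_of_subset_of_ncard_le hsub (by rw [h2, Set.ncard_pair hne]) hfin
  have hmem : (u, i) ∈ I := ⟨hu, hi⟩
  rw [← heq] at hmem
  rcases hmem with he | he
  · exact Or.inl (Prod.ext_iff.1 he).1
  · exact Or.inr (Prod.ext_iff.1 he).1

/-- A tetrahedron in the boundary of the three removed pentachora is a face of another
pentachoron. -/
theorem IsMove33.exists_outer (h : H.IsMove33 A A') {o : X.Cell 4 → ℤˣ}
    (hA : IsClosedOriented A o) {a b : Fin 6} (ha : IsUpper a) (hb : ¬IsUpper b) :
    ∃ u ∈ A.cells 4, (∀ c, IsUpper c → u ≠ H.opp₁ c) ∧ ∃ i, X.face u i = H.opp₂ a b := by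
  have hab : a ≠ b := fun he => hb (he ▸ ha)
  have h2 := hA.two _ (h.opp₂_mem ha b)
  set I := {p : X.Cell 4 × Fin 5 | p.1 ∈ A.cells 4 ∧ X.face p.1 p.2 = H.opp₂ a b}
  -- The second of the two incidences. It cannot involve a removed pentachoron, because among these
  -- only `H.opp₁ a` contains this tetrahedron, and contains it once.
  obtain ⟨⟨u, i⟩, hmem, hne⟩ := Set.exists_ne_of_one_lt_ncard
    (show 1 < I.ncard by omega) (H.opp₁ a, H.idx₁ a b)
  refine ⟨u, hmem.1, ?_, i, hmem.2⟩
  rintro c hc rfl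
  obtain ⟨d, hcd, rfl⟩ := H.exists_idx₁ c i
  have := H.eq_or_eq_of_opp₂_eq hcd hab hmem.2
  rcases this with rfl | rfl
  · exact hne (Prod.ext rfl (face_injective _ hmem.2))
  · exact hb hc

end Hexateron

/-! ### Cocycles under the move -/

open Classical in
theorem restrict_apply (A : Subcomplex X) {n : ℕ} (c : X.Cell n → ℂ) (σ : X.Cell n) :
    restrict A n c σ = if σ ∈ A.cells n then c σ else 0 := by
  by_cases h : σ ∈ A.cells n <;> simp [restrict, h]

theorem restrict_of_mem {A : Subcomplex X} {n : ℕ} (c : X.Cell n → ℂ) {σ : X.Cell n}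
    (h : σ ∈ A.cells n) : restrict A n c σ = c σ := by
  rw [restrict_apply, if_pos h]

/-- The cochains that are closed on two subcomplexes. -/
def jointlyClosed (A A' : Subcomplex X) : Submodule ℂ (X.Cell 2 → ℂ) where
  carrier := {c | (∀ t ∈ A.cells 3, coboundary X 2 c t = 0) ∧
    ∀ t ∈ A'.cells 3, coboundary X 2 c t = 0}
  zero_mem' := by simp
  add_mem' := by
    rintro a b ⟨ha, ha'⟩ ⟨hb, hb'⟩
    exact ⟨fun t ht => by simp [ha t ht, hb t ht], fun t ht => by simp [ha' t ht, hb' t ht]⟩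
  smul_mem' := by
    rintro z a ⟨ha, ha'⟩
    exact ⟨fun t ht => by simp [ha t ht], fun t ht => by simp [ha' t ht]⟩

theorem coboundary_mem_jointlyClosed (A A' : Subcomplex X) (f : X.Cell 1 → ℂ) :
    coboundary X 1 f ∈ jointlyClosed A A' :=
  ⟨fun t _ => congrFun (coboundary_coboundary f) t, fun t _ => congrFun (coboundary_coboundary f) t⟩

/-- The restriction of jointly closed cochains to the first subcomplex. -/
def restrictJoint (A A' : Subcomplex X) : jointlyClosed A A' →ₗ[ℂ] cocycles A :=
  ((restrict A 2).domRestrict (jointlyClosed A A')).codRestrict (cocycles A) fun c =>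
    restrict_mem_cocycles A c.1 c.2.1

/-- The restriction of jointly closed cochains to the second subcomplex. -/
def restrictJoint' (A A' : Subcomplex X) : jointlyClosed A A' →ₗ[ℂ] cocycles A' :=
  ((restrict A' 2).domRestrict (jointlyClosed A A')).codRestrict (cocycles A') fun c =>
    restrict_mem_cocycles A' c.1 c.2.2

theorem restrictJoint_apply (A A' : Subcomplex X) (c : jointlyClosed A A') :
    (restrictJoint A A' c : X.Cell 2 → ℂ) = restrict A 2 c.1 := rfl

theorem restrictJoint'_apply (A A' : Subcomplex X) (c : jointlyClosed A A') :
    (restrictJoint' A A' c : X.Cell 2 → ℂ) = restrict A' 2 c.1 := rfl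

namespace Hexateron

variable {H : Hexateron X} {A A' : Subcomplex X}

/-- As `δδ = 0` on a pentachoron, a cochain closed on four of its tetrahedra is closed on the fifth.
-/
theorem coboundary_opp₂_eq_zero (c : X.Cell 2 → ℂ) {a b : Fin 6}
    (h : ∀ d, d ≠ a → d ≠ b → coboundary X 2 c (H.opp₂ a d) = 0) :
    coboundary X 2 c (H.opp₂ a b) = 0 := by
  have h1 := congrFun (coboundary_coboundary c) (H.opp₁ a)
  rw [coboundary_apply, Finset.sum_eq_single (H.idx₁ a b)] at h1
  · simpa [opp₂_eq] using h1
  · intro i _ hi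
    obtain ⟨d, hd, rfl⟩ := H.exists_idx₁ a i
    rw [← opp₂_eq, h d hd.symm (fun he => hi (by rw [he])), mul_zero]
  · simp

theorem IsMove33.s456_notMem (h : H.IsMove33 A A') : H.s456 ∉ A.cells 2 :=
  Finset.disjoint_singleton_left.1 h.faces.2.1

theorem s456_eq : H.s456 = X.face (H.opp₂ 1 2) (H.idx₂ 1 2 0) := by
  rw [← opp₃_eq, s456, H.opp₃_comm_left (by decide),
    H.opp₃_comm_right (by decide) (by decide) (by decide)]

theorem IsMove33.mem_tet (h : H.IsMove33 A A') {t : X.Cell 3} (ht : t ∈ A'.cells 3) :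
    t ∈ A.cells 3 ∨ t = H.opp₂ 1 2 ∨ t = H.opp₂ 2 0 ∨ t = H.opp₂ 1 0 := by
  classical
  rcases (h.tetrahedra.mem_iff t).1 ht with ht | ht
  · exact Or.inl ht.1
  · right
    simp only [Finset.mem_insert, Finset.mem_singleton] at ht
    rcases ht with rfl | rfl | rfl
    · exact Or.inl rfl
    · exact Or.inr (Or.inl (H.opp₂_comm (by decide)))
    · exact Or.inr (Or.inr (H.opp₂_comm (by decide)))

theorem IsMove33.mem_face (h : H.IsMove33 A A') {s : X.Cell 2} (hs : s ∈ A'.cells 2) :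
    s ∈ A.cells 2 ∨ s = H.s456 := by
  rcases (h.faces.mem_iff s).1 hs with hs | hs
  · exact Or.inl hs.1
  · exact Or.inr (Finset.mem_singleton.1 hs)

theorem IsMove33.opp₂_one_two_mem (h : H.IsMove33 A A') : H.opp₂ 1 2 ∈ A'.cells 3 := by
  classical
  refine (h.tetrahedra.mem_iff _).2 (Or.inr ?_)
  simp [t1456]

theorem IsMove33.coboundary_opp₂_one_two (h : H.IsMove33 A A') {c : X.Cell 2 → ℂ}
    (hc : ∀ s ∈ A.cells 2, c s = 0) :
    coboundary X 2 c (H.opp₂ 1 2) = (-1) ^ (H.idx₂ 1 2 0 : ℕ) * c H.s456 := by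
  rw [coboundary_apply, Finset.sum_eq_single (H.idx₂ 1 2 0), ← s456_eq]
  · intro j _ hj
    rcases h.mem_face (A'.face_mem _ h.opp₂_one_two_mem j) with hs | hs
    · rw [hc _ hs, mul_zero]
    · rw [s456_eq] at hs
      exact absurd (face_injective _ hs) hj
  · simp

/-- The only freedom in extending a cocycle is its value on the new face 456. Closedness on 1456
determines this value, and closedness on the other two new tetrahedra follows from `δδ = 0` on new
pentachora. -/
theorem IsMove33.restrictJoint_surjective (h : H.IsMove33 A A') :
    Function.Surjective (restrictJoint A A') := by
  classical
  rintro ⟨z, hz, hz'⟩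
  set s := H.s456 with hs
  set e : X.Cell 2 → ℂ := Pi.single s 1 with he
  have he0 : ∀ s' ∈ A.cells 2, e s' = 0 := fun s' hs' =>
    Pi.single_eq_of_ne (fun h' => h.s456_notMem (by rw [← hs, ← h']; exact hs')) _
  -- The correction on 456 that cancels the coboundary on 1456; the incidence sign is its own
  -- inverse.
  set x : ℂ := -((-1) ^ (H.idx₂ 1 2 0 : ℕ) * coboundary X 2 z (H.opp₂ 1 2)) with hx
  set c := z + x • e with hc
  have hcA : ∀ t ∈ A.cells 3, coboundary X 2 c t = 0 := by
    intro t ht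
    have : coboundary X 2 e t = 0 := by
      rw [coboundary_apply]
      exact Finset.sum_eq_zero fun i _ => by rw [he0 _ (A.face_mem t ht i), mul_zero]
    rw [hc, map_add, map_smul, Pi.add_apply, Pi.smul_apply, this, hz' t ht, smul_zero, add_zero]
  have h12 : coboundary X 2 c (H.opp₂ 1 2) = 0 := by
    rw [hc, map_add, map_smul, Pi.add_apply, Pi.smul_apply, h.coboundary_opp₂_one_two he0, ← hs]
    have h1 : e s = 1 := Pi.single_eq_same _ _
    have h2 : ((-1 : ℂ) ^ (H.idx₂ 1 2 0 : ℕ)) * (-1) ^ (H.idx₂ 1 2 0 : ℕ) = 1 := by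
      rw [← mul_pow]; simp
    rw [h1, hx, smul_eq_mul]
    linear_combination (-coboundary X 2 z (H.opp₂ 1 2)) * h2
  have hup : ∀ a d : Fin 6, ¬IsUpper a → IsUpper d → coboundary X 2 c (H.opp₂ a d) = 0 := by
    intro a d ha hd
    rw [H.opp₂_comm (a := a) (b := d) (by rintro rfl; exact ha hd)]
    exact hcA _ (h.opp₂_mem hd a)
  have hlow : ∀ d : Fin 6, ¬IsUpper d → d = 0 ∨ d = 1 ∨ d = 2 := by
    unfold IsUpper; decide
  have h20 : coboundary X 2 c (H.opp₂ 2 0) = 0 := by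
    refine coboundary_opp₂_eq_zero c fun d h1 h2 => ?_
    by_cases hd : IsUpper d
    · exact hup _ _ (by unfold IsUpper; decide) hd
    · rcases hlow d hd with rfl | rfl | rfl
      · exact absurd rfl h2
      · rw [H.opp₂_comm (by decide)]; exact h12
      · exact absurd rfl h1
  have h10 : coboundary X 2 c (H.opp₂ 1 0) = 0 := by
    refine coboundary_opp₂_eq_zero c fun d h1 h2 => ?_
    by_cases hd : IsUpper d
    · exact hup _ _ (by unfold IsUpper; decide) hd
    · rcases hlow d hd with rfl | rfl | rfl
      · exact absurd rfl h2
      · exact absurd rfl h1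
      · exact h12
  refine ⟨⟨c, hcA, fun t ht => ?_⟩, ?_⟩
  · rcases h.mem_tet ht with ht | rfl | rfl | rfl
    · exact hcA t ht
    · exact h12
    · exact h20
    · exact h10
  · refine Subtype.ext (funext fun s' => ?_)
    rw [restrictJoint_apply, restrict_apply]
    split_ifs with hs'
    · simp [hc, he0 s' hs']
    · exact (hz s' hs').symm

/-- Closedness on 1456 forces the value on 456 to vanish once the values on `A` do. -/
theorem IsMove33.restrict_eq_zero (h : H.IsMove33 A A') {c : X.Cell 2 → ℂ}
    (hc : c ∈ jointlyClosed A A') (h0 : restrict A 2 c = 0) : restrict A' 2 c = 0 := by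
  have hA : ∀ s ∈ A.cells 2, c s = 0 := fun s hs => by rw [← restrict_of_mem c hs, h0]; rfl
  have h1 := hc.2 _ h.opp₂_one_two_mem
  rw [h.coboundary_opp₂_one_two hA] at h1
  have h2 : c H.s456 = 0 := (mul_eq_zero.1 h1).resolve_left (pow_ne_zero _ (by norm_num))
  ext s
  rw [restrict_apply]
  split_ifs with hs
  · rcases h.mem_face hs with hs | rfl
    · exact hA s hs
    · exact h2
  · rfl

theorem IsMove33.restrictJoint'_surjective (h : H.IsMove33 A A') :
    Function.Surjective (restrictJoint' A A') := by
  intro z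
  obtain ⟨⟨c, hc⟩, hcz⟩ := h.flip.restrictJoint_surjective z
  exact ⟨⟨c, hc.2, hc.1⟩, hcz⟩

theorem IsMove33.ker_restrictJoint (h : H.IsMove33 A A') :
    LinearMap.ker (restrictJoint A A') = LinearMap.ker (restrictJoint' A A') := by
  ext ⟨c, hc⟩
  simp only [LinearMap.mem_ker, ← Subtype.coe_inj, restrictJoint_apply, restrictJoint'_apply,
    Submodule.coe_zero]
  exact ⟨h.restrict_eq_zero hc, h.flip.restrict_eq_zero ⟨hc.2, hc.1⟩⟩

/-- The isomorphism of the spaces of cocycles before and after the move. -/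
def IsMove33.cocycleEquiv (h : H.IsMove33 A A') : cocycles A ≃ₗ[ℂ] cocycles A' :=
  ((restrictJoint A A').quotKerEquivOfSurjective h.restrictJoint_surjective).symm ≪≫ₗ
    Submodule.quotEquivOfEq _ _ h.ker_restrictJoint ≪≫ₗ
    (restrictJoint' A A').quotKerEquivOfSurjective h.restrictJoint'_surjective

theorem IsMove33.cocycleEquiv_restrictJoint (h : H.IsMove33 A A') (c : jointlyClosed A A') :
    h.cocycleEquiv (restrictJoint A A' c) = restrictJoint' A A' c := by
  have h1 : ((restrictJoint A A').quotKerEquivOfSurjective h.restrictJoint_surjective).symm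
      (restrictJoint A A' c) = Submodule.Quotient.mk c := by
    rw [LinearEquiv.symm_apply_eq]
    rfl
  simp only [cocycleEquiv, LinearEquiv.trans_apply, h1]
  rfl

theorem IsMove33.cocycleEquiv_apply (h : H.IsMove33 A A') (z : cocycles A) {s : X.Cell 2}
    (hs : s ∈ A.cells 2) (hs' : s ∈ A'.cells 2) :
    (h.cocycleEquiv z : X.Cell 2 → ℂ) s = (z : X.Cell 2 → ℂ) s := by
  obtain ⟨c, rfl⟩ := h.restrictJoint_surjective z
  rw [h.cocycleEquiv_restrictJoint, restrictJoint_apply, restrictJoint'_apply,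
    restrict_of_mem _ hs, restrict_of_mem _ hs']

end Hexateron

/-! ### Distinguished bases -/

theorem restrict_coboundary (A : Subcomplex X) (f : X.Cell 1 → ℂ) :
    restrict A 2 (coboundary X 1 f) = ∑ e ∈ A.cells 1, f e • edgeCocycle A e := by
  classical
  ext s
  rw [Finset.sum_apply, restrict_apply]
  split_ifs with hs
  · simp only [Pi.smul_apply, edgeCocycle, restrict_of_mem _ hs, coboundary_apply, smul_eq_mul,
      Finset.mul_sum]
    rw [Finset.sum_comm]
    refine Finset.sum_congr rfl fun i _ => ?_
    rw [Finset.sum_eq_single (X.face s i)]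
    · simp [mul_comm]
    · intro e _ he
      rw [Pi.single_eq_of_ne he.symm]
      ring
    · exact fun h => absurd (A.face_mem s hs i) h
  · refine (Finset.sum_eq_zero fun e _ => ?_).symm
    rw [Pi.smul_apply, edgeCocycle, restrict_apply, if_neg hs, smul_zero]

/-- For a tree edge `e`, let `g` be the indicator of the part of the tree, cut at `e`, that contains
the tail of `e`. Its coboundary is `-1` on `e` and zero on the other tree edges, so `δδg = 0`
expresses the cocycle of `e` through those of `B`. The coefficients are integers, which later makes
the transition determinant `±1`. -/
theorem IsCotree.edgeCocycle_mem_span {A : Subcomplex X} {B : Finset (X.Cell 1)}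
    (hB : IsCotree A B) {e : X.Cell 1} (he : e ∈ A.cells 1) :
    edgeCocycle A e ∈ Submodule.span ℤ (Set.range fun b : B => edgeCocycle A b) := by
  classical
  by_cases heB : e ∈ B
  · exact Submodule.subset_span ⟨⟨e, heB⟩, rfl⟩
  let _ := X.vertexOrder
  set G := complementGraph A B with hG
  let V := {v : X.Cell 0 // v ∈ A.cells 0}
  let tail : ∀ e ∈ A.cells 1, V := fun e he => ⟨X.face e 1, A.face_mem e he 1⟩
  let head : ∀ e ∈ A.cells 1, V := fun e he => ⟨X.face e 0, A.face_mem e he 0⟩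
  have hadj : ∀ (e') (he' : e' ∈ A.cells 1), e' ∉ B → G.Adj (tail e' he') (head e' he') := by
    intro e' he' hB'
    rw [hG, complementGraph, SimpleGraph.fromRel_adj]
    refine ⟨fun h => ?_, Or.inl ⟨e', he', hB', rfl, rfl⟩⟩
    have h1 : X.face e' 1 = X.face e' 0 := congrArg Subtype.val h
    have h2 := X.edge_lt e'
    rw [h1] at h2
    exact lt_irrefl _ h2
  set G' := G.deleteEdges {s(tail e he, head e he)} with hG'
  have hbridge : ¬G'.Reachable (tail e he) (head e he) :=
    SimpleGraph.isBridge_iff.1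
      (SimpleGraph.isAcyclic_iff_forall_adj_isBridge.1 hB.isTree.isAcyclic (hadj e he heB))
  let g : X.Cell 0 → ℤ := fun v =>
    if ∃ hv : v ∈ A.cells 0, G'.Reachable (tail e he) ⟨v, hv⟩ then 1 else 0
  have hg : ∀ v : V, g v.1 = if G'.Reachable (tail e he) v then 1 else 0 := fun v => by
    simp [g, v.2]
  have hδ : ∀ e', coboundary X 0 (fun v => (g v : ℂ)) e' =
      ((g (X.face e' 0) - g (X.face e' 1) : ℤ) : ℂ) := by
    intro e'
    rw [coboundary_apply, Fin.sum_univ_two]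
    push_cast
    simp
    ring
  have hδe : coboundary X 0 (fun v => (g v : ℂ)) e = -1 := by
    rw [hδ]
    have h0 : g (X.face e 0) = 0 := (hg (head e he)).trans (if_neg hbridge)
    have h1 : g (X.face e 1) = 1 :=
      (hg (tail e he)).trans (if_pos (SimpleGraph.Reachable.refl _))
    rw [h0, h1]
    norm_num
  have hδ0 : ∀ e' ∈ A.cells 1, e' ∉ B → e' ≠ e →
      coboundary X 0 (fun v => (g v : ℂ)) e' = 0 := by
    intro e' he' hB' hne
    have hadj' : G'.Adj (tail e' he') (head e' he') := by
      rw [hG', SimpleGraph.deleteEdges_adj]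
      refine ⟨hadj e' he' hB', fun h => ?_⟩
      -- Another tree edge with the same ends is excluded: by `noParallel` if it has the same
      -- direction, by the order of the vertices if it has the opposite one.
      rw [Set.mem_singleton_iff, Sym2.eq_iff] at h
      rcases h with ⟨h1, h2⟩ | ⟨h1, h2⟩
      · exact hne (hB.noParallel e' he' e he hB' heB (congrArg Subtype.val h2)
          (congrArg Subtype.val h1))
      · have h1' : X.face e' 1 = X.face e 0 := congrArg Subtype.val h1
        have h2' : X.face e' 0 = X.face e 1 := congrArg Subtype.val h2
        have h3 := X.edge_lt e
        have h4 := X.edge_lt e'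
        rw [h1', h2'] at h4
        exact lt_asymm h3 h4
    have hiff : G'.Reachable (tail e he) (tail e' he') ↔ G'.Reachable (tail e he) (head e' he') :=
      ⟨fun h => h.trans hadj'.reachable, fun h => h.trans hadj'.reachable.symm⟩
    have h0 := hg (head e' he')
    have h1 := hg (tail e' he')
    rw [hδ]
    change g (X.face e' 0) = _ at h0
    change g (X.face e' 1) = _ at h1
    rw [h0, h1]
    simp [hiff]
  have hsum := restrict_coboundary A (coboundary X 0 fun v => (g v : ℂ))
  rw [coboundary_coboundary, map_zero, ← Finset.sum_sdiff hB.subset,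
    Finset.sum_eq_single_of_mem e (Finset.mem_sdiff.2 ⟨he, heB⟩)] at hsum
  · rw [hδe, neg_one_smul] at hsum
    have : edgeCocycle A e = ∑ b ∈ B, (g (X.face b 0) - g (X.face b 1)) • edgeCocycle A b := by
      rw [eq_comm, neg_add_eq_zero] at hsum
      rw [hsum]
      refine Finset.sum_congr rfl fun b _ => ?_
      rw [hδ, Int.cast_smul_eq_zsmul]
    rw [this]
    exact Submodule.sum_mem _ fun b hb => Submodule.smul_mem _ _
      (Submodule.subset_span ⟨⟨b, hb⟩, rfl⟩)
  · intro e' he' hne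
    rw [Finset.mem_sdiff] at he'
    rw [hδ0 e' he'.1 he'.2 hne, zero_smul]

/-! ### Unimodularity of the change of distinguished basis -/

section Unimodular

variable {Z β κ : Type*} [AddCommGroup Z] [Module ℂ Z] [Fintype β] [Fintype κ] [DecidableEq β]
  [DecidableEq κ]

/-- The transition matrix is block triangular, with an integer block for the edges and an identity
block for the cohomology representatives; the complex block between them does not affect the
determinant. -/
theorem exists_int_det_toMatrix (e e' : Module.Basis (β ⊕ κ) ℂ Z)
    (h₁ : ∀ b, e' (Sum.inl b) ∈ Submodule.span ℤ (Set.range fun b => e (Sum.inl b)))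
    (h₂ : ∀ k, e' (Sum.inr k) - e (Sum.inr k) ∈
      Submodule.span ℂ (Set.range fun b => e (Sum.inl b))) :
    ∃ m : ℤ, (e.toMatrix e').det = m := by
  have hint : ∀ x ∈ Submodule.span ℤ (Set.range fun b => e (Sum.inl b)),
      (∀ b, ∃ m : ℤ, e.repr x (Sum.inl b) = m) ∧ ∀ k, e.repr x (Sum.inr k) = 0 := by
    intro x hx
    induction hx using Submodule.span_induction with
    | mem x h =>
      obtain ⟨b, rfl⟩ := h
      refine ⟨fun b' => ⟨if b = b' then 1 else 0, ?_⟩, fun k => ?_⟩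
      · simp [Finsupp.single_apply]
      · simp
    | zero => exact ⟨fun b => ⟨0, by simp⟩, fun k => by simp⟩
    | add x y _ _ hx hy =>
      refine ⟨fun b => ?_, fun k => by simp [hx.2 k, hy.2 k]⟩
      obtain ⟨m, hm⟩ := hx.1 b
      obtain ⟨m', hm'⟩ := hy.1 b
      exact ⟨m + m', by simp [hm, hm']⟩
    | smul a x _ hx =>
      rw [← Int.cast_smul_eq_zsmul ℂ]
      refine ⟨fun b => ?_, fun k => by simp [hx.2 k]⟩
      obtain ⟨m, hm⟩ := hx.1 b
      exact ⟨a * m, by simp [hm]⟩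
  have hcomplex : ∀ x ∈ Submodule.span ℂ (Set.range fun b => e (Sum.inl b)),
      ∀ k, e.repr x (Sum.inr k) = 0 := by
    intro x hx
    induction hx using Submodule.span_induction with
    | mem x h =>
      obtain ⟨b, rfl⟩ := h
      simp
    | zero => simp
    | add x y _ _ hx hy => intro k; simp [hx k, hy k]
    | smul a x _ hx => intro k; simp [hx k]
  choose P hP using fun b' => (hint _ (h₁ b')).1
  have hblock : e.toMatrix e' = Matrix.fromBlocks ((Matrix.of fun b b' => P b' b).map
      (Int.cast : ℤ → ℂ)) (e.toMatrix e').toBlocks₁₂ 0 1 := by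
    conv_lhs => rw [← Matrix.fromBlocks_toBlocks (e.toMatrix e')]
    congr 1
    · ext b b'
      simp [Matrix.toBlocks₁₁, Module.Basis.toMatrix_apply, hP]
    · ext k b
      simp [Matrix.toBlocks₂₁, Module.Basis.toMatrix_apply, (hint _ (h₁ b)).2]
    · ext k k'
      have := hcomplex _ (h₂ k') k
      rw [map_sub, Finsupp.sub_apply, sub_eq_zero, e.repr_self] at this
      simp only [Matrix.toBlocks₂₂, Matrix.of_apply, Module.Basis.toMatrix_apply, this,
        Matrix.one_apply, Finsupp.single_apply, Sum.inr.injEq, eq_comm]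
  refine ⟨(Matrix.of fun b b' => P b' b).det, ?_⟩
  rw [hblock, Matrix.det_fromBlocks_zero₂₁, Matrix.det_one, mul_one]
  exact ((Int.castRingHom ℂ).map_det _).symm

/-- The determinants of the transition and of its inverse are both integers, with product 1. -/
theorem det_toMatrix_sq_eq_one (e e' : Module.Basis (β ⊕ κ) ℂ Z)
    (h₁ : ∀ b, e' (Sum.inl b) ∈ Submodule.span ℤ (Set.range fun b => e (Sum.inl b)))
    (h₁' : ∀ b, e (Sum.inl b) ∈ Submodule.span ℤ (Set.range fun b => e' (Sum.inl b)))
    (h₂ : ∀ k, e' (Sum.inr k) - e (Sum.inr k) ∈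
      Submodule.span ℂ (Set.range fun b => e (Sum.inl b))) :
    (e.toMatrix e').det ^ 2 = 1 := by
  have h₂' : ∀ k, e (Sum.inr k) - e' (Sum.inr k) ∈
      Submodule.span ℂ (Set.range fun b => e' (Sum.inl b)) := by
    intro k
    rw [← neg_sub]
    refine Submodule.neg_mem _ (Submodule.span_le.2 ?_ (h₂ k))
    rintro _ ⟨b, rfl⟩
    exact Submodule.span_subset_span ℤ ℂ _ (h₁' b)
  obtain ⟨m, hm⟩ := exists_int_det_toMatrix e e' h₁ h₂
  obtain ⟨m', hm'⟩ := exists_int_det_toMatrix e' e h₁' h₂'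
  have h := congrArg Matrix.det (e.toMatrix_mul_toMatrix_flip e')
  rw [Matrix.det_mul, Matrix.det_one, hm, hm'] at h
  have h' : m * m' = 1 := by exact_mod_cast h
  rw [hm]
  rcases Int.eq_one_or_neg_one_of_mul_eq_one h' with rfl | rfl <;> norm_num

end Unimodular

theorem edgeCocycle_mem (A : Subcomplex X) (e : X.Cell 1) : edgeCocycle A e ∈ cocycles A :=
  restrict_mem_cocycles A _ fun t _ => congrFun (coboundary_coboundary _) t

theorem CocycleBasis.basis_inl' {A : Subcomplex X} {h : ℕ} (b : CocycleBasis A h) (e : b.B) :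
    b.basis (Sum.inl e) = ⟨edgeCocycle A e, edgeCocycle_mem A e⟩ :=
  Subtype.ext (b.basis_inl e)

theorem CocycleBasis.edgeCocycle_mem_span {A : Subcomplex X} {h : ℕ} (b : CocycleBasis A h)
    {e : X.Cell 1} (he : e ∈ A.cells 1) :
    (⟨edgeCocycle A e, edgeCocycle_mem A e⟩ : cocycles A) ∈
      Submodule.span ℤ (Set.range fun e' : b.B => b.basis (Sum.inl e')) := by
  have h1 := b.isCotree.edgeCocycle_mem_span he
  have h2 : (Submodule.span ℤ (Set.range fun e' : b.B => b.basis (Sum.inl e'))).map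
      ((cocycles A).subtype.restrictScalars ℤ) =
      Submodule.span ℤ (Set.range fun e' : b.B => edgeCocycle A e') := by
    rw [Submodule.map_span, ← Set.range_comp]
    congr 2
    ext e' : 1
    simp [b.basis_inl]
  rw [← h2] at h1
  obtain ⟨y, hy, hye⟩ := h1
  have h3 : y = ⟨edgeCocycle A e, edgeCocycle_mem A e⟩ := Subtype.ext hye
  rw [← h3]
  exact hy

theorem CocycleBasis.coboundaries_le {A : Subcomplex X} {h : ℕ} (b : CocycleBasis A h)
    {z : cocycles A} (hz : (z : X.Cell 2 → ℂ) ∈ coboundaries A) :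
    z ∈ Submodule.span ℂ (Set.range fun e' : b.B => b.basis (Sum.inl e')) := by
  obtain ⟨_, ⟨f, rfl⟩, hf⟩ := hz
  rw [restrict_coboundary] at hf
  have : z = ∑ e ∈ A.cells 1, f e • (⟨edgeCocycle A e, edgeCocycle_mem A e⟩ : cocycles A) := by
    apply Subtype.ext
    rw [← hf]
    simp
  rw [this]
  exact Submodule.sum_mem _ fun e he => Submodule.smul_mem _ _
    (Submodule.span_subset_span ℤ ℂ _ (b.edgeCocycle_mem_span he))

namespace Hexateron

variable {H : Hexateron X} {A A' : Subcomplex X}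

theorem IsMove33.cocycleEquiv_edgeCocycle (hm : H.IsMove33 A A') (e : X.Cell 1) :
    hm.cocycleEquiv ⟨edgeCocycle A e, edgeCocycle_mem A e⟩ =
      ⟨edgeCocycle A' e, edgeCocycle_mem A' e⟩ := by
  classical
  exact hm.cocycleEquiv_restrictJoint ⟨_, coboundary_mem_jointlyClosed A A' (Pi.single e 1)⟩

theorem IsMove33.cocycleEquiv_coboundaries (hm : H.IsMove33 A A') {z : cocycles A}
    (hz : (hm.cocycleEquiv z : X.Cell 2 → ℂ) ∈ coboundaries A') :
    (z : X.Cell 2 → ℂ) ∈ coboundaries A := by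
  obtain ⟨_, ⟨f, rfl⟩, hf⟩ := hz
  refine ⟨_, ⟨f, rfl⟩, ?_⟩
  have h1 := hm.cocycleEquiv_restrictJoint ⟨_, coboundary_mem_jointlyClosed A A' f⟩
  have h2 : hm.cocycleEquiv z = restrictJoint' A A' ⟨_, coboundary_mem_jointlyClosed A A' f⟩ :=
    Subtype.ext hf.symm
  rw [← h1] at h2
  have h3 := hm.cocycleEquiv.injective h2
  rw [h3]
  rfl

/-- The determinant of the transition between distinguished bases is `1` or `-1`. -/
theorem IsMove33.det_toMatrix_sq (hm : H.IsMove33 A A') {h : ℕ} (b : CocycleBasis A h)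
    (b' : CocycleBasis A' h) (hb : SameCohomologyBasis b b') [DecidableEq (b.B ⊕ Fin h)]
    (σ : b'.B ≃ b.B) :
    (b.basis.toMatrix ((b'.basis.map hm.cocycleEquiv.symm).reindex
      (σ.sumCongr (Equiv.refl (Fin h))))).det ^ 2 = 1 := by
  classical
  set e' := (b'.basis.map hm.cocycleEquiv.symm).reindex (σ.sumCongr (Equiv.refl (Fin h))) with he'
  have hinl : ∀ x, e' (Sum.inl x) = ⟨edgeCocycle A (σ.symm x), edgeCocycle_mem A _⟩ := by
    intro x
    simp only [he', Module.Basis.reindex_apply, Equiv.sumCongr_symm, Equiv.sumCongr_apply,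
      Sum.map_inl, Module.Basis.map_apply, CocycleBasis.basis_inl', LinearEquiv.symm_apply_eq]
    exact (hm.cocycleEquiv_edgeCocycle _).symm
  have hinr : ∀ k, e' (Sum.inr k) = hm.cocycleEquiv.symm (b'.basis (Sum.inr k)) := by
    intro k
    simp [he']
  convert det_toMatrix_sq_eq_one b.basis e' ?_ ?_ ?_
  · intro x
    rw [hinl]
    refine b.edgeCocycle_mem_span ?_
    rw [← hm.edges]
    exact b'.isCotree.subset (σ.symm x).2
  · intro x
    rw [CocycleBasis.basis_inl']
    have h1 : (x : X.Cell 1) ∈ A'.cells 1 := by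
      rw [hm.edges]
      exact b.isCotree.subset x.2
    have h2 := Submodule.mem_map_of_mem (f := hm.cocycleEquiv.symm.toLinearMap.restrictScalars ℤ)
      (b'.edgeCocycle_mem_span h1)
    rw [Submodule.map_span, ← Set.range_comp] at h2
    have h3 : (Set.range fun x => e' (Sum.inl x)) =
        Set.range ((hm.cocycleEquiv.symm.toLinearMap.restrictScalars ℤ) ∘
          fun x => b'.basis (Sum.inl x)) := by
      rw [← σ.surjective.range_comp]
      congr 1
      ext x : 1
      simp [he']
    rw [h3]
    have h4 : (⟨edgeCocycle A x, edgeCocycle_mem A x⟩ : cocycles A) =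
        hm.cocycleEquiv.symm ⟨edgeCocycle A' x, edgeCocycle_mem A' x⟩ := by
      rw [LinearEquiv.eq_symm_apply]
      exact hm.cocycleEquiv_edgeCocycle _
    rw [h4]
    exact h2
  · intro k
    rw [hinr]
    obtain ⟨c, hc, hc', h1, h2⟩ := hb k
    have e1 := hm.cocycleEquiv_restrictJoint ⟨c, hc, hc'⟩
    -- Both representatives are compared with the same jointly closed cochain `c`, so their
    -- difference is a coboundary.
    have h3 : ((hm.cocycleEquiv.symm (b'.basis (Sum.inr k)) - restrictJoint A A' ⟨c, hc, hc'⟩ :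
        cocycles A) : X.Cell 2 → ℂ) ∈ coboundaries A := by
      apply hm.cocycleEquiv_coboundaries
      rw [map_sub, LinearEquiv.apply_symm_apply, e1]
      exact h2
    have h4 : ((b.basis (Sum.inr k) - restrictJoint A A' ⟨c, hc, hc'⟩ : cocycles A) :
        X.Cell 2 → ℂ) ∈ coboundaries A := h1
    have h5 := Submodule.sub_mem _ (b.coboundaries_le h3) (b.coboundaries_le h4)
    simpa using h5

end Hexateron

/-! ### The bilinear form of a tetrahedron -/

/-- With `S` the diagonal part of the form and `Δ` its determinant, the rank-one identity splits by
powers of `1/K`. This is the part linear in `1/K`; `edgeForm_aux₂` is the even part, where `K²` has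
been replaced by the product of the `wᵢ`. -/
theorem edgeForm_aux₁ {w₀ w₁ w₂ w₃ x₀ x₁ x₂ x₃ y₀ y₁ y₂ y₃ g₀ g₁ g₂ g₃ : ℂ}
    (h₀ : w₀ ≠ 0) (h₁ : w₁ ≠ 0) (h₂ : w₂ ≠ 0) (h₃ : w₃ ≠ 0)
    (hw : w₀ = w₁ - w₂ + w₃) (hx : x₀ = x₁ - x₂ + x₃) (hy : y₀ = y₁ - y₂ + y₃)
    (hg : g₀ = g₁ - g₂ + g₃) :
    (x₀ * g₀ / w₀ - x₁ * g₁ / w₁ + x₂ * g₂ / w₂ - x₃ * g₃ / w₃) *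
      (w₁ * (g₂ * y₃ - y₂ * g₃) - g₁ * (w₂ * y₃ - y₂ * w₃) + y₁ * (w₂ * g₃ - g₂ * w₃)) +
    (g₀ * y₀ / w₀ - g₁ * y₁ / w₁ + g₂ * y₂ / w₂ - g₃ * y₃ / w₃) *
      (w₁ * (x₂ * g₃ - g₂ * x₃) - x₁ * (w₂ * g₃ - g₂ * w₃) + g₁ * (w₂ * x₃ - x₂ * w₃)) =
    (g₀ * g₀ / w₀ - g₁ * g₁ / w₁ + g₂ * g₂ / w₂ - g₃ * g₃ / w₃) *
      (w₁ * (x₂ * y₃ - y₂ * x₃) - x₁ * (w₂ * y₃ - y₂ * w₃) + y₁ * (w₂ * x₃ - x₂ * w₃)) := by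
  subst hw hx hy hg
  field_simp
  ring

theorem edgeForm_aux₂ {w₀ w₁ w₂ w₃ x₀ x₁ x₂ x₃ y₀ y₁ y₂ y₃ g₀ g₁ g₂ g₃ : ℂ}
    (h₀ : w₀ ≠ 0) (h₁ : w₁ ≠ 0) (h₂ : w₂ ≠ 0) (h₃ : w₃ ≠ 0)
    (hw : w₀ = w₁ - w₂ + w₃) (hx : x₀ = x₁ - x₂ + x₃) (hy : y₀ = y₁ - y₂ + y₃)
    (hg : g₀ = g₁ - g₂ + g₃) :
    (x₀ * g₀ / w₀ - x₁ * g₁ / w₁ + x₂ * g₂ / w₂ - x₃ * g₃ / w₃) *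
      (g₀ * y₀ / w₀ - g₁ * y₁ / w₁ + g₂ * y₂ / w₂ - g₃ * y₃ / w₃) +
      (w₁ * (x₂ * g₃ - g₂ * x₃) - x₁ * (w₂ * g₃ - g₂ * w₃) + g₁ * (w₂ * x₃ - x₂ * w₃)) *
      (w₁ * (g₂ * y₃ - y₂ * g₃) - g₁ * (w₂ * y₃ - y₂ * w₃) + y₁ * (w₂ * g₃ - g₂ * w₃)) /
        (w₀ * w₁ * w₂ * w₃) =
    (x₀ * y₀ / w₀ - x₁ * y₁ / w₁ + x₂ * y₂ / w₂ - x₃ * y₃ / w₃) *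
      (g₀ * g₀ / w₀ - g₁ * g₁ / w₁ + g₂ * g₂ / w₂ - g₃ * g₃ / w₃) := by
  subst hw hx hy hg
  field_simp
  ring

theorem IsTetCocycle.eq {x : Fin 4 → ℂ} (hx : IsTetCocycle x) : x 0 = x 1 - x 2 + x 3 := by
  simp only [IsTetCocycle, Fin.sum_univ_four] at hx
  norm_num at hx
  linear_combination hx

/-- The rank-one property in the form of vanishing `2 × 2` minors with pivot `g`. With `g` the gauge
cocycle it gives the factorisation into `β` and `γ`. -/
theorem edgeForm_mul_edgeForm {w p x y g : Fin 4 → ℂ} (hw : IsTetCocycle w) (hw0 : ∀ i, w i ≠ 0)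
    (hp : ∀ i, p i ^ 2 = w i) (hx : IsTetCocycle x) (hy : IsTetCocycle y) (hg : IsTetCocycle g) :
    edgeForm w p x g * edgeForm w p g y = edgeForm w p x y * edgeForm w p g g := by
  have e₁ := edgeForm_aux₁ (hw0 0) (hw0 1) (hw0 2) (hw0 3) hw.eq hx.eq hy.eq hg.eq
  have e₂ := edgeForm_aux₂ (hw0 0) (hw0 1) (hw0 2) (hw0 3) hw.eq hx.eq hy.eq hg.eq
  have hK : (∏ i, p i) ^ 2 = w 0 * w 1 * w 2 * w 3 := by
    rw [← Finset.prod_pow, Fin.prod_univ_four, hp, hp, hp, hp]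
  have hK0 : ∏ i, p i ≠ 0 := by
    intro h
    rw [h] at hK
    have := mul_ne_zero (mul_ne_zero (mul_ne_zero (hw0 0) (hw0 1)) (hw0 2)) (hw0 3)
    exact this (by rw [← hK]; ring)
  rw [← hK] at e₂
  have hform : ∀ x y : Fin 4 → ℂ, edgeForm w p x y = 1 / 2 *
      ((x 0 * y 0 / w 0 - x 1 * y 1 / w 1 + x 2 * y 2 / w 2 - x 3 * y 3 / w 3) +
        (w 1 * (x 2 * y 3 - y 2 * x 3) - x 1 * (w 2 * y 3 - y 2 * w 3) +
          y 1 * (w 2 * x 3 - x 2 * w 3)) / ∏ i, p i) := by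
    intro x y
    simp only [edgeForm, Fin.sum_univ_four, Matrix.det_fin_three, Matrix.of_apply, Matrix.cons_val]
    norm_num
    ring
  have hgg : (w 1 * (g 2 * g 3 - g 2 * g 3) - g 1 * (w 2 * g 3 - g 2 * w 3) +
      g 1 * (w 2 * g 3 - g 2 * w 3)) = 0 := by ring
  rw [hform, hform, hform, hform, hgg]
  linear_combination (exp := 1) (1 / 4) * e₂ + (1 / 4) * (∏ i, p i)⁻¹ * e₁

theorem edgeForm_add_edgeForm_swap (w p x y : Fin 4 → ℂ) :
    edgeForm w p x y + edgeForm w p y x = ∑ i : Fin 4, (-1 : ℂ) ^ (i : ℕ) * (x i * y i / w i) := by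
  simp only [edgeForm, Fin.sum_univ_four, Matrix.det_fin_three, Matrix.of_apply, Matrix.cons_val]
  ring

theorem edgeForm_self_left {w p x : Fin 4 → ℂ} (hw0 : ∀ i, w i ≠ 0) (hx : IsTetCocycle x) :
    edgeForm w p w x = 0 := by
  have h1 : ∀ i : Fin 4, (-1 : ℂ) ^ (i : ℕ) * w i * x i / w i = (-1 : ℂ) ^ (i : ℕ) * x i := fun i => by
    have := hw0 i
    field_simp
  rw [edgeForm, Finset.sum_congr rfl fun i _ => h1 i, show ∑ i : Fin 4, (-1 : ℂ) ^ (i : ℕ) * x i = 0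
    from hx, Matrix.det_fin_three]
  simp only [Matrix.of_apply, Matrix.cons_val]
  ring

/-- A cocycle on a tetrahedron that is annihilated by both factors of the form is a multiple
of `w`. -/
theorem exists_eq_smul_of_edgeForm_eq_zero {w p x g : Fin 4 → ℂ} (hw : IsTetCocycle w)
    (hw0 : ∀ i, w i ≠ 0) (hp : ∀ i, p i ^ 2 = w i) (hx : IsTetCocycle x) (hg : IsTetCocycle g)
    (hgg : edgeForm w p g g ≠ 0) (h₁ : edgeForm w p x g = 0) (h₂ : edgeForm w p g x = 0) :
    ∃ z : ℂ, ∀ i, x i = z * w i := by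
  -- By rank one the form of `x` with every cocycle `y` vanishes in either order, hence so does its
  -- symmetrisation, which no longer contains the determinant.
  have key : ∀ y, IsTetCocycle y → ∑ i : Fin 4, (-1 : ℂ) ^ (i : ℕ) * (x i * y i / w i) = 0 := by
    intro y hy
    have e₁ := edgeForm_mul_edgeForm hw hw0 hp hx hy hg
    have e₂ := edgeForm_mul_edgeForm hw hw0 hp hy hx hg
    rw [h₁, zero_mul, eq_comm, mul_eq_zero] at e₁
    rw [h₂, mul_zero, eq_comm, mul_eq_zero] at e₂
    rw [← edgeForm_add_edgeForm_swap w p, e₁.resolve_right hgg, e₂.resolve_right hgg, add_zero]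
  -- These three test cocycles show that the ratios `x i / w i` coincide.
  have k₁ := key ![1, 1, 0, 0] (by simp [IsTetCocycle, Fin.sum_univ_four])
  have k₂ := key ![0, 1, 1, 0] (by simp [IsTetCocycle, Fin.sum_univ_four])
  have k₃ := key ![0, 0, 1, 1] (by simp [IsTetCocycle, Fin.sum_univ_four]; norm_num)
  simp [Fin.sum_univ_four] at k₁ k₂ k₃
  norm_num at k₃
  have q₁ : x 1 / w 1 = x 0 / w 0 := by linear_combination -k₁
  have q₂ : x 2 / w 2 = x 0 / w 0 := by linear_combination -k₁ + k₂
  have q₃ : x 3 / w 3 = x 0 / w 0 := by linear_combination -k₁ + k₂ - k₃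
  refine ⟨x 0 / w 0, fun i => ?_⟩
  fin_cases i
  · exact (div_mul_cancel₀ _ (hw0 0)).symm
  · exact (by rw [← q₁]; exact (div_mul_cancel₀ _ (hw0 1)).symm)
  · exact (by rw [← q₂]; exact (div_mul_cancel₀ _ (hw0 2)).symm)
  · exact (by rw [← q₃]; exact (div_mul_cancel₀ _ (hw0 3)).symm)

theorem isTetCocycle_onTet {c : X.Cell 2 → ℂ} {t : X.Cell 3} (h : coboundary X 2 c t = 0) :
    IsTetCocycle (onTet t c) := by
  rw [coboundary_apply] at h
  exact h

/-! ### Anticommutation of the local operators -/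

namespace WeightData.IsAdmissible

variable {D : WeightData X} {A : Subcomplex X}

theorem isTetCocycle_ω (hD : D.IsAdmissible A) {t : X.Cell 3} (ht : t ∈ A.cells 3) :
    IsTetCocycle (onTet t D.ω) :=
  isTetCocycle_onTet (hD.ω_closed t ht)

theorem onTet_ω_ne_zero (hD : D.IsAdmissible A) {t : X.Cell 3} (ht : t ∈ A.cells 3) (i : Fin 4) :
    onTet t D.ω i ≠ 0 :=
  hD.ω_ne_zero _ (A.face_mem t ht i)

theorem onTet_q_sq (hD : D.IsAdmissible A) {t : X.Cell 3} (ht : t ∈ A.cells 3) (i : Fin 4) :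
    onTet t D.q i ^ 2 = onTet t D.ω i :=
  hD.q_sq _ (A.face_mem t ht i)

theorem β_mul_γ (hD : D.IsAdmissible A) {t : X.Cell 3} (ht : t ∈ A.cells 3) {x y : Fin 4 → ℂ}
    (hx : IsTetCocycle x) (hy : IsTetCocycle y) : D.β t x * D.γ t y = D.form t x y := by
  have hne := hD.gauge_ne_zero t ht
  rw [WeightData.γ, mul_div_assoc', div_eq_iff hne]
  exact edgeForm_mul_edgeForm (hD.isTetCocycle_ω ht) (hD.onTet_ω_ne_zero ht) (hD.onTet_q_sq ht)
    hx hy (hD.gauge_closed t ht)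

theorem β_ω (hD : D.IsAdmissible A) {t : X.Cell 3} (ht : t ∈ A.cells 3) :
    D.β t (onTet t D.ω) = 0 :=
  edgeForm_self_left (hD.onTet_ω_ne_zero ht) (hD.gauge_closed t ht)

theorem exists_eq_smul (hD : D.IsAdmissible A) {t : X.Cell 3} (ht : t ∈ A.cells 3)
    {x : Fin 4 → ℂ} (hx : IsTetCocycle x) (hβ : D.β t x = 0) (hγ : D.γ t x = 0) :
    ∃ z : ℂ, ∀ i, x i = z * onTet t D.ω i := by
  have hne := hD.gauge_ne_zero t ht
  rw [WeightData.γ, div_eq_zero_iff, or_iff_left hne] at hγ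
  exact exists_eq_smul_of_edgeForm_eq_zero (hD.isTetCocycle_ω ht) (hD.onTet_ω_ne_zero ht)
    (hD.onTet_q_sq ht) hx (hD.gauge_closed t ht) hne hβ hγ

/-- On each tetrahedron the symmetrised form of `c` and `c'` is the coboundary of the 2-cochain `c
c' / ω`, so `δδ = 0` makes the signed sum over the pentachoron vanish. In other words, the operators
of any two cocycles anticommute. -/
theorem sum_localγ_mul_β (hD : D.IsAdmissible A) {u : X.Cell 4} (hu : u ∈ A.cells 4)
    {c c' : X.Cell 2 → ℂ} (hc : ∀ i, coboundary X 2 c (X.face u i) = 0)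
    (hc' : ∀ i, coboundary X 2 c' (X.face u i) = 0) :
    ∑ i, (D.localγ u i c * D.β (X.face u i) (onTet (X.face u i) c') +
      D.localγ u i c' * D.β (X.face u i) (onTet (X.face u i) c)) = 0 := by
  have h1 := congrFun (coboundary_coboundary fun s => c s * c' s / D.ω s) u
  rw [Pi.zero_apply, coboundary_apply] at h1
  rw [← mul_zero (((D.o u : ℤ) : ℂ)), ← h1, Finset.mul_sum]
  refine Finset.sum_congr rfl fun i _ => ?_
  have ht := A.face_mem u hu i
  have e₁ := hD.β_mul_γ ht (isTetCocycle_onTet (hc i)) (isTetCocycle_onTet (hc' i))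
  have e₂ := hD.β_mul_γ ht (isTetCocycle_onTet (hc' i)) (isTetCocycle_onTet (hc i))
  have e₃ := edgeForm_add_edgeForm_swap (onTet (X.face u i) D.ω) (onTet (X.face u i) D.q)
    (onTet (X.face u i) c) (onTet (X.face u i) c')
  have e₄ : coboundary X 2 (fun s => c s * c' s / D.ω s) (X.face u i) =
      D.form (X.face u i) (onTet (X.face u i) c) (onTet (X.face u i) c') +
      D.form (X.face u i) (onTet (X.face u i) c') (onTet (X.face u i) c) := by
    rw [coboundary_apply]
    exact e₃.symm
  rw [e₄, ← e₁, ← e₂, WeightData.localγ, WeightData.localγ]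
  ring

open Classical in
theorem isLift_dualCocycle (hD : D.IsAdmissible A) {u : X.Cell 4} (hu : u ∈ A.cells 4)
    (i : Fin 5) : D.IsLift u (Pi.single i 1) (D.dualCocycle u i) := by
  have h := hD.generic u hu (Pi.single i 1)
  have e : D.dualCocycle u i = h.choose := by
    unfold WeightData.dualCocycle
    exact dif_pos h
  rw [e]
  exact h.choose_spec

theorem sum_localγ_mul_dual (hD : D.IsAdmissible A) {u : X.Cell 4} (hu : u ∈ A.cells 4)
    (c : X.Cell 2 → ℂ) (j : Fin 5) :
    ∑ i, D.localγ u i c * D.β (X.face u i) (onTet (X.face u i) (D.dualCocycle u j)) =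
      D.localγ u j c := by
  classical
  rw [Finset.sum_eq_single j]
  · rw [(hD.isLift_dualCocycle hu j j).2, Pi.single_eq_same, mul_one]
  · intro i _ hi
    rw [(hD.isLift_dualCocycle hu j i).2, Pi.single_eq_of_ne hi, mul_zero]
  · simp

/-- Anticommutation of the two operators with differential parts `∂ᵢ` and `∂ⱼ`. -/
theorem F_skew (hD : D.IsAdmissible A) {u : X.Cell 4} (hu : u ∈ A.cells 4) (i j : Fin 5) :
    D.F u i j = -D.F u j i := by
  have h := hD.sum_localγ_mul_β hu (fun k => (hD.isLift_dualCocycle hu i k).1)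
    (fun k => (hD.isLift_dualCocycle hu j k).1)
  rw [Finset.sum_add_distrib, hD.sum_localγ_mul_dual hu, hD.sum_localγ_mul_dual hu] at h
  exact eq_neg_of_add_eq_zero_left h

/-- An operator without differential part anticommutes with an operator whose differential part is
`∂ⱼ`; the anticommutator is its coefficient at `θⱼ`. -/
theorem localγ_eq_zero (hD : D.IsAdmissible A) {u : X.Cell 4} (hu : u ∈ A.cells 4)
    {c : X.Cell 2 → ℂ} (hc : ∀ i, coboundary X 2 c (X.face u i) = 0)
    (hβ : ∀ i, D.β (X.face u i) (onTet (X.face u i) c) = 0) (j : Fin 5) :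
    D.γ (X.face u j) (onTet (X.face u j) c) = 0 := by
  have h := hD.sum_localγ_mul_β hu hc (fun k => (hD.isLift_dualCocycle hu j k).1)
  simp only [hβ, mul_zero, add_zero] at h
  rw [hD.sum_localγ_mul_dual hu, WeightData.localγ, mul_eq_zero, mul_eq_zero] at h
  refine h.resolve_left (not_or.2 ⟨?_, pow_ne_zero _ (by norm_num)⟩)
  exact_mod_cast (D.o u).ne_zero

theorem f₃_skew (hD : D.IsAdmissible A) (t t' : A.cells 3) : f₃ D A t t' = -f₃ D A t' t := by
  classical
  unfold f₃
  rw [← mul_neg, ← Finset.sum_neg_distrib]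
  congr 1
  refine Finset.sum_congr rfl fun u hu => ?_
  rw [Finset.sum_comm, ← Finset.sum_neg_distrib]
  refine Finset.sum_congr rfl fun i _ => ?_
  rw [← Finset.sum_neg_distrib]
  refine Finset.sum_congr rfl fun j _ => ?_
  rw [hD.F_skew hu j i]
  by_cases h1 : X.face u i = t'.1 <;> by_cases h2 : X.face u j = t.1 <;> simp [h1, h2]

end WeightData.IsAdmissible

/-! ### Cocycles with vanishing coefficients on the common tetrahedra -/

namespace Hexateron

variable {H : Hexateron X} {A A' : Subcomplex X} {D : WeightData X}

theorem IsMove33.mem_pent (hm : H.IsMove33 A A') {u : X.Cell 4} (hu : u ∈ A.cells 4)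
    (h : ∀ c, IsUpper c → u ≠ H.opp₁ c) : u ∈ A'.cells 4 := by
  classical
  refine (hm.pentachora.mem_iff u).2 (Or.inl ⟨hu, ?_⟩)
  simp only [Finset.mem_insert, Finset.mem_singleton, not_or]
  exact ⟨h 5 (by simp [isUpper_iff]), h 4 (by simp [isUpper_iff]), h 3 (by simp [isUpper_iff])⟩

/-- If the coefficients of a cocycle vanish on all tetrahedra not affected by the move, they
vanish on all tetrahedra. -/
theorem IsMove33.β_eq_zero (hm : H.IsMove33 A A') (hA : IsClosedOriented A D.o)
    (hD : D.IsAdmissible A) {c : X.Cell 2 → ℂ} (hc : ∀ t ∈ A.cells 3, coboundary X 2 c t = 0)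
    (hβ : ∀ t ∈ A.cells 3, t ∈ A'.cells 3 → D.β t (onTet t c) = 0) :
    ∀ t ∈ A.cells 3, D.β t (onTet t c) = 0 := by
  classical
  -- Each boundary tetrahedron of the cluster lies in a surviving pentachoron, all of whose faces
  -- are common to `A` and `A'`. There the `γ` coefficients vanish together with the `β` ones, so
  -- `c` is a multiple of `ω` on the tetrahedron.
  have houter : ∀ a b : Fin 6, IsUpper a → ¬IsUpper b →
      ∃ z : ℂ, ∀ d, d ≠ a → d ≠ b → c (H.opp₃ a b d) = z * D.ω (H.opp₃ a b d) := by
    intro a b ha hb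
    obtain ⟨u, hu, hne, i, hi⟩ := hm.exists_outer hA ha hb
    have hu' := hm.mem_pent hu hne
    have hγ := hD.localγ_eq_zero hu (fun j => hc _ (A.face_mem u hu j))
      (fun j => hβ _ (A.face_mem u hu j) (A'.face_mem u hu' j)) i
    have hβi := hβ _ (A.face_mem u hu i) (A'.face_mem u hu' i)
    have ht := A.face_mem u hu i
    rw [hi] at hγ hβi ht
    obtain ⟨z, hz⟩ := hD.exists_eq_smul ht (isTetCocycle_onTet (hc _ ht)) hβi hγ
    exact ⟨z, fun d _ _ => hz (H.idx₂ a b d)⟩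
  choose! z hz using houter
  -- Two boundary tetrahedra with a common 2-face have the same factor, since `ω` is nonzero on that
  -- face; `hz₂` treats the other kind of neighbours.
  have hz₁ : ∀ a b b', IsUpper a → ¬IsUpper b → ¬IsUpper b' → z a b = z a b' := by
    intro a b b' ha hb hb'
    by_cases hbb : b = b'
    · rw [hbb]
    have hab : a ≠ b := by rintro rfl; exact hb ha
    have hab' : a ≠ b' := by rintro rfl; exact hb' ha
    have e₁ := hz a b ha hb b' hab'.symm (Ne.symm hbb)
    have e₂ := hz a b' ha hb' b hab.symm hbb
    rw [H.opp₃_comm_right hab hab'.symm (Ne.symm hbb), e₂] at e₁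
    exact (mul_right_cancel₀ (hD.ω_ne_zero _ (hm.opp₃_mem ha b' b)) e₁).symm
  have hz₂ : ∀ a a' b, IsUpper a → IsUpper a' → ¬IsUpper b → z a b = z a' b := by
    intro a a' b ha ha' hb
    by_cases haa : a = a'
    · rw [haa]
    have hab : a ≠ b := by rintro rfl; exact hb ha
    have hab' : a' ≠ b := by rintro rfl; exact hb ha'
    have e₁ := hz a b ha hb a' (Ne.symm haa) hab'
    have e₂ := hz a' b ha' hb a haa hab
    have e₃ : H.opp₃ a b a' = H.opp₃ a' b a := by
      rw [H.opp₃_comm_right hab (Ne.symm haa) hab', H.opp₃_comm_left haa,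
        H.opp₃_comm_right (Ne.symm haa) hab'.symm hab.symm]
    rw [e₃, e₂] at e₁
    exact (mul_right_cancel₀ (hD.ω_ne_zero _ (hm.opp₃_mem ha' b a)) e₁).symm
  have h3 : IsUpper 3 := by simp [isUpper_iff]
  have h0 : ¬IsUpper 0 := by simp [isUpper_iff]
  have hall : ∀ a b d, IsUpper a → ¬IsUpper b → d ≠ a → d ≠ b →
      c (H.opp₃ a b d) = z 3 0 * D.ω (H.opp₃ a b d) := by
    intro a b d ha hb hda hdb
    rw [hz a b ha hb d hda hdb, hz₂ a 3 b ha h3 hb, hz₁ 3 b 0 h3 hb h0]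
  intro t ht
  by_cases ht' : t ∈ A'.cells 3
  · exact hβ t ht ht'
  have hold : t ∈ ({H.t1234, H.t1235, H.t1236} : Finset (X.Cell 3)) := by
    by_contra h
    exact ht' ((hm.tetrahedra.mem_iff t).2 (Or.inl ⟨ht, h⟩))
  obtain ⟨a, b, ha, hb, hab, rfl⟩ := exists_of_mem_old_tet hold
  -- Three faces of a removed tetrahedron lie on the boundary of the cluster, where `y` vanishes.
  -- The fourth is the inner face 123, where `y` vanishes by closedness. So `c` is a multiple of `ω`
  -- on this tetrahedron, and `β` kills `ω`.
  set y := c - z 3 0 • D.ω with hy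
  have hy0 : coboundary X 2 y (H.opp₂ a b) = 0 := by
    rw [hy, map_sub, map_smul, Pi.sub_apply, Pi.smul_apply, hc _ ht, hD.ω_closed _ ht, smul_zero,
      sub_zero]
  have hyl : ∀ d, d ≠ a → d ≠ b → ¬IsUpper d → y (H.opp₃ a b d) = 0 := by
    intro d hda hdb hd
    rw [H.opp₃_comm_right hab hda hdb, hy, Pi.sub_apply, Pi.smul_apply, smul_eq_mul,
      hall a d b ha hd hab.symm hdb.symm, sub_self]
  obtain ⟨e, hea, heb, heu⟩ : ∃ e, e ≠ a ∧ e ≠ b ∧ ∀ d, d ≠ a → d ≠ b → IsUpper d → d = e := by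
    clear * - ha hb hab
    unfold IsUpper at *
    revert a b
    decide
  have hye : y (H.opp₃ a b e) = 0 := by
    rw [coboundary_apply, Finset.sum_eq_single (H.idx₂ a b e)] at hy0
    · exact (mul_eq_zero.1 hy0).resolve_left (pow_ne_zero _ (by norm_num))
    · intro j _ hj
      obtain ⟨d, hda, hdb, rfl⟩ := H.exists_idx₂ hab j
      rw [← opp₃_eq, hyl d hda hdb fun hd => hj (by rw [heu d hda hdb hd]), mul_zero]
    · simp
  have hyt : onTet (H.opp₂ a b) y = 0 := by
    ext j
    obtain ⟨d, hda, hdb, rfl⟩ := H.exists_idx₂ hab j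
    change y (H.opp₃ a b d) = 0
    by_cases hd : IsUpper d
    · rw [heu d hda hdb hd]; exact hye
    · exact hyl d hda hdb hd
  rw [hy, map_sub, map_smul, sub_eq_zero] at hyt
  rw [hyt, map_smul, hD.β_ω ht, smul_zero]

end Hexateron

/-! ### Minors of an acyclic complex -/

section Minors

variable {D : WeightData X} {A : Subcomplex X} {hD : D.IsAdmissible A}

theorem IsAcyclic.mulVec_f₂ (hac : IsAcyclic D A hD) (z : cocycles A) :
    (f₃ D A).mulVec (f₂ D A z) = 0 := by
  classical
  exact (hac.exact₂₃ _).2 ⟨z, rfl⟩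

theorem IsAcyclic.vecMul_f₂ (hac : IsAcyclic D A hD) (z : cocycles A) :
    (f₃ D A).vecMul (f₂ D A z) = 0 := by
  have h1 : (f₃ D A).transpose = -f₃ D A := by
    ext t t'
    exact hD.f₃_skew t' t
  rw [← Matrix.mulVec_transpose, h1, Matrix.neg_mulVec, hac.mulVec_f₂, neg_zero]

theorem IsAcyclic.exists_f₂_eq (hac : IsAcyclic D A hD) (w : A.cells 3 → ℂ)
    (hw : (f₃ D A).mulVec w = 0) : ∃ z, f₂ D A z = w := by
  classical
  exact (hac.exact₂₃ _).1 hw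

theorem f₁_one (hD : D.IsAdmissible A) : f₁ D A hD 1 = omegaCocycle D A hD := by
  simp [f₁]

theorem IsAcyclic.f₂_omegaCocycle (hac : IsAcyclic D A hD) : f₂ D A (omegaCocycle D A hD) = 0 :=
  (hac.exact₁₂ _).2 ⟨1, f₁_one hD⟩

theorem IsAcyclic.omegaCocycle_ne_zero (hac : IsAcyclic D A hD) : omegaCocycle D A hD ≠ 0 := by
  rw [← f₁_one hD, ← map_zero (f₁ D A hD)]
  exact hac.injective.ne one_ne_zero

theorem IsAcyclic.exists_eq_smul (hac : IsAcyclic D A hD) {z : cocycles A} (hz : f₂ D A z = 0) :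
    ∃ a : ℂ, z = a • omegaCocycle D A hD := by
  obtain ⟨a, ha⟩ := (hac.exact₁₂ _).1 hz
  exact ⟨a, by rw [← ha]; simp [f₁]⟩

theorem IsAcyclic.exists_dual (hac : IsAcyclic D A hD) :
    ∃ φ : cocycles A →ₗ[ℂ] ℂ, φ (omegaCocycle D A hD) = 1 :=
  hac.surjective 1

variable {h : ℕ} {b : CocycleBasis A h}

open Classical in
/-- The determinant obtained from the second minor by adjoining a linear form that is `1` on `ω`. -/
def MinorChoice.borderedMinor (m : MinorChoice b) (D : WeightData X) (φ : cocycles A →ₗ[ℂ] ℂ) : ℂ :=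
  (borderedMatrix (f₂ D A) φ b.basis m.i₀ m.rows).det

theorem MinorChoice.borderedMinor_mul_minor₁ (m : MinorChoice b) (hac : IsAcyclic D A hD)
    {φ : cocycles A →ₗ[ℂ] ℂ} (hφ : φ (omegaCocycle D A hD) = 1) :
    m.borderedMinor D φ * m.minor₁ hD = m.minor₂ D := by
  classical
  rw [MinorChoice.minor₁, f₁_one hD, MinorChoice.minor₂, MinorChoice.borderedMinor]
  convert det_borderedMatrix (f₂ D A) φ b.basis m.i₀ m.rows (omegaCocycle D A hD) hφ
    hac.f₂_omegaCocycle

/-- Cancelling the first minor leaves an expression in which `f₁` enters only through the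
normalisation of `φ`. -/
theorem MinorChoice.sqrtTorsion_eq (m : MinorChoice b) (hac : IsAcyclic D A hD)
    {φ : cocycles A →ₗ[ℂ] ℂ} (hφ : φ (omegaCocycle D A hD) = 1) (h₁ : m.minor₁ hD ≠ 0) :
    m.sqrtTorsion hD = m.pf₃ D / m.borderedMinor D φ := by
  rw [MinorChoice.sqrtTorsion, ← m.borderedMinor_mul_minor₁ hac hφ, mul_comm (m.minor₁ hD),
    mul_div_mul_right _ _ h₁]

/-- Every choice uses one row fewer than the dimension of the cocycle space. -/
theorem MinorChoice.n_eq (m m' : MinorChoice b) : m.n = m'.n := by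
  classical
  have key : ∀ m : MinorChoice b, m.n * 2 + Fintype.card {i : b.B ⊕ Fin h // i ≠ m.i₀} =
      Fintype.card (A.cells 3) := by
    intro m
    have h1 := Fintype.card_congr m.rest
    have h2 := Fintype.card_subtype_compl fun t => t ∈ Set.range m.rows
    have h3 : Fintype.card {t // t ∈ Set.range m.rows} =
        Fintype.card {i : b.B ⊕ Fin h // i ≠ m.i₀} :=
      (Fintype.card_congr (Equiv.ofInjective _ m.rows.injective)).symm
    have h4 := Fintype.card_subtype_le fun t => t ∈ Set.range m.rows
    simp only [Fintype.card_prod, Fintype.card_fin] at h1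
    omega
  have h1 := key m
  have h2 := key m'
  have h3 : Fintype.card {i : b.B ⊕ Fin h // i ≠ m.i₀} =
      Fintype.card {i : b.B ⊕ Fin h // i ≠ m'.i₀} := by
    rw [Fintype.card_subtype_compl, Fintype.card_subtype_compl]
    simp
  omega

/-- The square of `√τ` does not depend on the choice of nonzero minors. -/
theorem MinorChoice.sqrtTorsion_sq_eq (hac : IsAcyclic D A hD) (m m' : MinorChoice b)
    (h₁ : m.minor₁ hD ≠ 0) (h₂ : m.minor₂ D ≠ 0) (h₁' : m'.minor₁ hD ≠ 0)
    (h₂' : m'.minor₂ D ≠ 0) : m.sqrtTorsion hD ^ 2 = m'.sqrtTorsion hD ^ 2 := by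
  classical
  obtain ⟨φ, hφ⟩ := hac.exists_dual
  have hN := m.borderedMinor_mul_minor₁ hac hφ
  have hN' := m'.borderedMinor_mul_minor₁ hac hφ
  rw [m.sqrtTorsion_eq hac hφ h₁, m'.sqrtTorsion_eq hac hφ h₁']
  have hn := m.n_eq m'
  have hne : m.borderedMinor D φ ≠ 0 := fun h0 => h₂ (by rw [← hN, h0, zero_mul])
  have hne' : m'.borderedMinor D φ ≠ 0 := fun h0 => h₂' (by rw [← hN', h0, zero_mul])
  clear hN hN' h₁ h₂ h₁' h₂'
  obtain ⟨i, R, n, S⟩ := m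
  obtain ⟨i', R', n', S'⟩ := m'
  dsimp only at hn
  subst hn
  unfold MinorChoice.borderedMinor at *
  have h := pfaffian_mul_det_sq_eq (f₂ D A) φ b.basis (f₃ D A) hac.mulVec_f₂ hac.vecMul_f₂ i i' R R'
    S S' (by convert hne)
  rw [div_pow, div_pow, div_eq_div_iff (pow_ne_zero _ hne) (pow_ne_zero _ hne'), ← mul_pow,
    ← mul_pow]
  unfold MinorChoice.pf₃
  convert h.symm

theorem IsAcyclic.exists_pfaffian (hac : IsAcyclic D A hD) {i₀ : b.B ⊕ Fin h}
    (hi₀ : b.basis.repr (omegaCocycle D A hD) i₀ ≠ 0)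
    (R : {i : b.B ⊕ Fin h // i ≠ i₀} ↪ A.cells 3) [DecidableEq (b.B ⊕ Fin h)]
    (hdet : Matrix.det (Matrix.of fun i j : {i : b.B ⊕ Fin h // i ≠ i₀} =>
      f₂ D A (b.basis j.1) (R i)) ≠ 0) :
    (∃ n, Nonempty (Fin n × Fin 2 ≃ {t : A.cells 3 // t ∉ Set.range R})) ∧
      ∀ n (S : Fin n × Fin 2 ≃ {t : A.cells 3 // t ∉ Set.range R}),
        pfaffian ((f₃ D A).submatrix (fun s => (S s).1) fun s => (S s).1) ≠ 0 := by
  classical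
  have h := exists_pfaffian_ne_zero
    ((f₃ D A).submatrix (fun t : {t // t ∉ Set.range R} => t.1) fun t => t.1)
    (fun t t' => hD.f₃_skew t.1 t'.1)
    (mulVec_submatrix_injective (f₂ D A) b.basis (f₃ D A) hac.vecMul_f₂ hac.exists_f₂_eq
      (omegaCocycle D A hD) hac.f₂_omegaCocycle i₀ hi₀ R (by convert hdet))
  exact h

theorem IsAcyclic.exists_repr_ne_zero (hac : IsAcyclic D A hD) (b : CocycleBasis A h) :
    ∃ i, b.basis.repr (omegaCocycle D A hD) i ≠ 0 := by
  by_contra! h0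
  exact hac.omegaCocycle_ne_zero (b.basis.repr.map_eq_zero_iff.1 (Finsupp.ext h0))

end Minors

theorem exists_equiv_compl_range {T ι : Type*} (R : ι → T) {t₁ t₂ t₃ : T} {k : ℕ} {l : Fin k → T}
    (hl : Function.Injective l) (h12 : t₁ ≠ t₂) (h13 : t₁ ≠ t₃) (h23 : t₂ ≠ t₃)
    (h₁ : ∀ j, l j ≠ t₁) (h₂ : ∀ j, l j ≠ t₂) (h₃ : ∀ j, l j ≠ t₃)
    (hR : ∀ t, t ∉ Set.range R ↔ t = t₁ ∨ t = t₂ ∨ t = t₃ ∨ t ∈ Set.range l) :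
    ∃ e : Fin (k + 1 + 1 + 1) ≃ {t // t ∉ Set.range R},
      ∀ j, (e j).1 = (Fin.cons t₁ (Fin.cons t₂ (Fin.cons t₃ l)) : Fin (k + 1 + 1 + 1) → T) j := by
  set l' : Fin (k + 1 + 1 + 1) → T := Fin.cons t₁ (Fin.cons t₂ (Fin.cons t₃ l)) with hl'
  have hrange : ∀ t, t ∈ Set.range l' ↔ t ∉ Set.range R := by
    intro t
    rw [hR, hl', Fin.range_cons, Fin.range_cons, Fin.range_cons]
    simp
  have hinj : Function.Injective l' := by
    rw [hl', Fin.cons_injective_iff, Fin.cons_injective_iff, Fin.cons_injective_iff,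
      Fin.range_cons, Fin.range_cons]
    refine ⟨?_, ?_, ?_, hl⟩ <;>
      simp [h12, h13, h23, h₁, h₂, h₃]
  refine ⟨(Equiv.ofInjective l' hinj).trans (Equiv.subtypeEquivRight hrange), fun j => rfl⟩

theorem coeff_berezin_weights_eq (D : WeightData X) (A : Subcomplex X) {u₁ u₂ u₃ : X.Cell 4}
    {t₁ t₂ t₃ : X.Cell 3} (ht₁ : t₁ ∈ A.cells 3) (ht₂ : t₂ ∈ A.cells 3) (ht₃ : t₃ ∈ A.cells 3)
    (h12 : t₁ ≠ t₂) (h13 : t₁ ≠ t₃) (h23 : t₂ ≠ t₃)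
    {P : Finset (X.Cell 4)} [DecidableEq (X.Cell 4)]
    (hA : A.cells 4 = insert u₁ (insert u₂ (insert u₃ P)))
    (h₁ : u₁ ∉ insert u₂ (insert u₃ P)) (h₂ : u₂ ∉ insert u₃ P) (h₃ : u₃ ∉ P)
    (hP : ∀ u ∈ P, ∀ i, X.face u i ≠ t₁ ∧ X.face u i ≠ t₂ ∧ X.face u i ≠ t₃)
    {ι : Type*} (R : ι → A.cells 3) {k : ℕ} {l : Fin k → X.Cell 3} (hl : Function.Injective l)
    (hlA : ∀ j, l j ∈ A.cells 3) (hlt : ∀ j, l j ≠ t₁ ∧ l j ≠ t₂ ∧ l j ≠ t₃)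
    (hR : ∀ t ∈ A.cells 3, (∀ i, (R i).1 ≠ t) ↔ t = t₁ ∨ t = t₂ ∨ t = t₃ ∨ t ∈ Set.range l) :
    Nonempty (Fin (k + 1 + 1 + 1) ≃ {t : A.cells 3 // t ∉ Set.range R}) ∧
    ∀ n, k + 1 + 1 + 1 = n * 2 → ∃ S : Fin n × Fin 2 ≃ {t : A.cells 3 // t ∉ Set.range R},
      coeff l (berezin t₃ (berezin t₂ (berezin t₁
        (D.weight u₁ * D.weight u₂ * D.weight u₃))) * IsNilpotent.exp (∑ u ∈ P, D.exponent u)) =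
      (-1) ^ (k + 1 + 1 + 1).choose 2 * (2 ^ n *
        pfaffian ((f₃ D A).submatrix (fun s => (S s).1) fun s => (S s).1)) := by
  obtain ⟨e, he⟩ := exists_equiv_compl_range R (t₁ := ⟨t₁, ht₁⟩) (t₂ := ⟨t₂, ht₂⟩)
    (t₃ := ⟨t₃, ht₃⟩) (l := fun j => (⟨l j, hlA j⟩ : A.cells 3))
    (fun i j hij => hl (congrArg Subtype.val hij)) (by simpa using h12) (by simpa using h13)
    (by simpa using h23) (fun j => by simpa using (hlt j).1) (fun j => by simpa using (hlt j).2.1)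
    (fun j => by simpa using (hlt j).2.2) (fun t => by
      have := hR t.1 t.2
      simp only [Set.mem_range, not_exists, Subtype.ext_iff]
      exact this)
  refine ⟨⟨e⟩, fun n hk => ⟨finProdFinEquiv.trans ((finCongr hk.symm).trans e), ?_⟩⟩
  have := coeff_berezin_weights D A (t₁ := ⟨t₁, ht₁⟩) (t₂ := ⟨t₂, ht₂⟩) (t₃ := ⟨t₃, ht₃⟩)
    hA h₁ h₂ h₃ hP (fun j => (⟨l j, hlA j⟩ : A.cells 3)) hk
  simp only [Equiv.trans_apply, he]
  exact this

/-! ### Invariance under the move -/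

theorem borderedMatrix_mul_toMatrix {T I Z : Type*} [AddCommGroup Z] [Module ℂ Z] [Fintype I]
    (g : Z →ₗ[ℂ] (T → ℂ)) (φ : Z →ₗ[ℂ] ℂ) (e : Module.Basis I ℂ Z) (e' : I → Z)
    (i₀ : I) (R : {i : I // i ≠ i₀} → T) :
    borderedMatrix g φ e i₀ R * e.toMatrix e' = borderedMatrix g φ e' i₀ R := by
  ext i j
  have hsum : ∑ k, e.repr (e' j) k • e k = e' j := e.sum_repr _
  rw [Matrix.mul_apply]
  by_cases hi : i = i₀
  · simp only [borderedMatrix, Matrix.of_apply, dif_pos hi, Module.Basis.toMatrix_apply]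
    have h1 := congrArg φ hsum
    simp only [map_sum, map_smul, smul_eq_mul] at h1
    rw [← h1]
    exact Finset.sum_congr rfl fun _ _ => mul_comm _ _
  · simp only [borderedMatrix, Matrix.of_apply, dif_neg hi, Module.Basis.toMatrix_apply]
    have h1 := congrFun (congrArg g hsum) (R ⟨i, hi⟩)
    simp only [map_sum, map_smul, Finset.sum_apply, Pi.smul_apply, smul_eq_mul] at h1
    rw [← h1]
    exact Finset.sum_congr rfl fun _ _ => mul_comm _ _

theorem det_submatrix_equiv_sq {I J : Type*} [Fintype I] [DecidableEq I] [Fintype J]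
    [DecidableEq J] (M : Matrix I I ℂ) (σ τ : J ≃ I) : (M.submatrix σ τ).det ^ 2 = M.det ^ 2 := by
  have h1 : M.submatrix σ τ = (M.submatrix ((τ.symm.trans σ)) id).submatrix τ τ := by
    ext i j
    simp
  rw [h1, Matrix.det_submatrix_equiv_self, Matrix.det_permute, mul_pow]
  rcases Int.units_eq_one_or (Equiv.Perm.sign (τ.symm.trans σ)) with h | h <;> simp [h]

namespace Hexateron

variable {H : Hexateron X} {A A' : Subcomplex X} {D : WeightData X}

theorem f₂_apply (z : cocycles A) (t : A.cells 3) :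
    f₂ D A z t = D.β t.1 (onTet t.1 (z : X.Cell 2 → ℂ)) := rfl

/-- By `β_eq_zero` the common rows of `f₂` still have only the multiples of `ω` in their kernel.
Dropping a column `i₀` where `ω` has a nonzero coordinate removes these as well, so some minor on
common rows is nonzero. -/
theorem IsMove33.exists_rows (hm : H.IsMove33 A A') (hA : IsClosedOriented A D.o)
    {hD : D.IsAdmissible A} (hac : IsAcyclic D A hD) {h : ℕ} (b : CocycleBasis A h)
    [DecidableEq (b.B ⊕ Fin h)] :
    ∃ (i₀ : b.B ⊕ Fin h) (R : {i : b.B ⊕ Fin h // i ≠ i₀} ↪ A.cells 3),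
      b.basis.repr (omegaCocycle D A hD) i₀ ≠ 0 ∧ (∀ i, (R i).1 ∈ A'.cells 3) ∧
      Matrix.det (Matrix.of fun i j : {i : b.B ⊕ Fin h // i ≠ i₀} =>
        f₂ D A (b.basis j.1) (R i)) ≠ 0 := by
  classical
  obtain ⟨i₀, hi₀⟩ := hac.exists_repr_ne_zero b
  let M : Matrix {t : A.cells 3 // t.1 ∈ A'.cells 3} {i : b.B ⊕ Fin h // i ≠ i₀} ℂ :=
    Matrix.of fun t j => f₂ D A (b.basis j.1) t.1
  have hM : ∀ w, M.mulVec w = 0 → w = 0 := by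
    intro w hw
    set z : cocycles A := ∑ j, w j • b.basis j.1 with hz
    have hz0 : ∀ t ∈ A.cells 3, D.β t (onTet t (z : X.Cell 2 → ℂ)) = 0 := by
      refine hm.β_eq_zero hA hD z.2.2 fun t ht ht' => ?_
      have h1 := congrFun hw ⟨⟨t, ht⟩, ht'⟩
      rw [← f₂_apply z ⟨t, ht⟩, hz, map_sum, Finset.sum_apply]
      simpa [M, Matrix.mulVec, dotProduct, mul_comm] using h1
    obtain ⟨a, ha⟩ := hac.exists_eq_smul (z := z) (funext fun t => hz0 t.1 t.2)
    have hrepr : ∀ i, b.basis.repr z i = if hi : i ≠ i₀ then w ⟨i, hi⟩ else 0 := by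
      intro i
      rw [hz, map_sum, Finsupp.finsetSum_apply]
      simp only [map_smul, Module.Basis.repr_self, Finsupp.smul_apply, smul_eq_mul]
      split_ifs with hi
      · rw [Finset.sum_eq_single ⟨i, hi⟩]
        · simp
        · intro j _ hj
          rw [Finsupp.single_eq_of_ne, mul_zero]
          exact fun h' => hj (Subtype.ext h'.symm)
        · simp
      · refine Finset.sum_eq_zero fun j _ => ?_
        rw [Finsupp.single_eq_of_ne, mul_zero]
        exact fun h' => hi (h' ▸ j.2)
    have h0 := hrepr i₀
    rw [dif_neg (not_not.2 rfl), ha, map_smul, Finsupp.smul_apply, smul_eq_mul, mul_eq_zero] at h0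
    rw [h0.resolve_right hi₀, zero_smul] at ha
    ext j
    have := hrepr j.1
    rw [ha, dif_pos j.2] at this
    simpa using this.symm
  obtain ⟨R, hR⟩ := exists_minor_ne_zero M hM
  exact ⟨i₀, R.trans (Function.Embedding.subtype _), hi₀, fun i => (R i).2, hR⟩

theorem IsMove33.cocycleEquiv_omegaCocycle (hm : H.IsMove33 A A') (hD : D.IsAdmissible A)
    (hD' : D.IsAdmissible A') :
    hm.cocycleEquiv (omegaCocycle D A hD) = omegaCocycle D A' hD' :=
  hm.cocycleEquiv_restrictJoint ⟨D.ω, hD.ω_closed, hD'.ω_closed⟩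

theorem IsMove33.f₂_cocycleEquiv (hm : H.IsMove33 A A') (z : cocycles A) {t : X.Cell 3}
    (ht : t ∈ A.cells 3) (ht' : t ∈ A'.cells 3) :
    f₂ D A' (hm.cocycleEquiv z) ⟨t, ht'⟩ = f₂ D A z ⟨t, ht⟩ := by
  rw [f₂_apply, f₂_apply]
  congr 1
  ext i
  exact hm.cocycleEquiv_apply z (A.face_mem t ht i) (A'.face_mem t ht' i)

/-- Rows in the common part of the two triangulations give the same minors up to a sign. -/
theorem IsMove33.exists_transported_rows (hm : H.IsMove33 A A')
    {hD' : D.IsAdmissible A'} (hac' : IsAcyclic D A' hD') {h : ℕ} (b : CocycleBasis A h)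
    (b' : CocycleBasis A' h) (hb : SameCohomologyBasis b b') [DecidableEq (b.B ⊕ Fin h)]
    [DecidableEq (b'.B ⊕ Fin h)] {i₀ : b.B ⊕ Fin h}
    (R : {i : b.B ⊕ Fin h // i ≠ i₀} ↪ A.cells 3) (hR : ∀ i, (R i).1 ∈ A'.cells 3)
    (φ : cocycles A →ₗ[ℂ] ℂ) :
    ∃ (i₀' : b'.B ⊕ Fin h) (R' : {i : b'.B ⊕ Fin h // i ≠ i₀'} ↪ A'.cells 3),
      b'.basis.repr (omegaCocycle D A' hD') i₀' ≠ 0 ∧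
      (∀ t, (∀ i, (R' i).1 ≠ t) ↔ ∀ i, (R i).1 ≠ t) ∧
      (borderedMatrix (f₂ D A') (φ ∘ₗ hm.cocycleEquiv.symm.toLinearMap) b'.basis i₀' R').det ^ 2 =
        (borderedMatrix (f₂ D A) φ b.basis i₀ R).det ^ 2 := by
  obtain ⟨i₀', hi₀'⟩ := hac'.exists_repr_ne_zero b'
  have hcard : Fintype.card b'.B = Fintype.card b.B := by
    have h1 := Module.finrank_eq_card_basis b.basis
    have h2 := Module.finrank_eq_card_basis b'.basis
    rw [← hm.cocycleEquiv.finrank_eq, h1] at h2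
    simpa using h2.symm
  let σ : b'.B ≃ b.B := Fintype.equivOfCardEq hcard
  let τ : b'.B ⊕ Fin h ≃ b.B ⊕ Fin h := σ.sumCongr (Equiv.refl _)
  -- Columns are matched by `τ`, which respects the two kinds of basis cocycles, while rows must
  -- send `i₀'` to `i₀`. Relabelling rows and columns differently only costs a sign.
  let τ' : b'.B ⊕ Fin h ≃ b.B ⊕ Fin h := τ.trans (Equiv.swap (τ i₀') i₀)
  have hτ' : τ' i₀' = i₀ := Equiv.swap_apply_left _ _
  have hne : ∀ i : {i : b'.B ⊕ Fin h // i ≠ i₀'}, τ' i.1 ≠ i₀ := fun i hi =>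
    i.2 (τ'.injective (hi.trans hτ'.symm))
  let R' : {i : b'.B ⊕ Fin h // i ≠ i₀'} ↪ A'.cells 3 :=
    ⟨fun i => ⟨(R ⟨τ' i.1, hne i⟩).1, hR _⟩, fun i j hij => by
      have h1 : (R ⟨τ' i.1, hne i⟩).1 = (R ⟨τ' j.1, hne j⟩).1 :=
        congrArg (fun t : A'.cells 3 => t.1) hij
      have h2 := R.injective (Subtype.ext h1)
      exact Subtype.ext (τ'.injective (congrArg Subtype.val h2))⟩
  refine ⟨i₀', R', hi₀', fun t => ⟨fun ht i => ?_, fun ht i => ht _⟩, ?_⟩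
  · have h1 : τ'.symm i.1 ≠ i₀' := fun h' =>
      i.2 (((Equiv.apply_symm_apply τ' _).symm.trans (congrArg τ' h')).trans hτ')
    have h2 : (R' ⟨τ'.symm i.1, h1⟩).1 = (R i).1 :=
      congrArg (fun i => (R i).1) (Subtype.ext (τ'.apply_symm_apply i.1))
    rw [← h2]
    exact ht _
  · set e' := (b'.basis.map hm.cocycleEquiv.symm).reindex τ with he'
    have h1 : borderedMatrix (f₂ D A') (φ ∘ₗ hm.cocycleEquiv.symm.toLinearMap) b'.basis i₀' R' =
        (borderedMatrix (f₂ D A) φ e' i₀ R).submatrix τ' τ := by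
      ext i j
      have hej : e' (τ j) = hm.cocycleEquiv.symm (b'.basis j) := by
        rw [he', Module.Basis.reindex_apply, Equiv.symm_apply_apply, Module.Basis.map_apply]
      by_cases hi : i = i₀'
      · have hi' : τ' i = i₀ := by rw [hi, hτ']
        simp only [borderedMatrix, Matrix.of_apply, Matrix.submatrix_apply, dif_pos hi,
          dif_pos hi', hej]
        rfl
      · have hi' : τ' i ≠ i₀ := hne ⟨i, hi⟩
        simp only [borderedMatrix, Matrix.of_apply, Matrix.submatrix_apply, dif_neg hi,
          dif_neg hi', hej]
        rw [← hm.f₂_cocycleEquiv _ (R ⟨τ' i, hi'⟩).2 (hR _), LinearEquiv.apply_symm_apply]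
        rfl
    rw [h1, det_submatrix_equiv_sq, ← borderedMatrix_mul_toMatrix (f₂ D A) φ b.basis e' i₀ R,
      Matrix.det_mul, mul_pow, hm.det_toMatrix_sq b b' hb σ, mul_one]

theorem t_distinct (H : Hexateron X) :
    H.t1234 ≠ H.t1235 ∧ H.t1234 ≠ H.t1236 ∧ H.t1235 ≠ H.t1236 := by
  refine ⟨fun h => ?_, fun h => ?_, fun h => ?_⟩
  · have := H.eq_or_eq_of_opp₂_eq (by decide) (by decide) h
    revert this; decide
  · rw [t1234, H.opp₂_comm (by decide)] at h
    have := H.eq_or_eq_of_opp₂_eq (by decide) (by decide) h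
    revert this; decide
  · rw [t1235, H.opp₂_comm (by decide)] at h
    have := H.eq_or_eq_of_opp₂_eq (by decide) (by decide) h
    revert this; decide

theorem IsMove33.face_ne (hm : H.IsMove33 A A') {o : X.Cell 4 → ℤˣ} (hA : IsClosedOriented A o)
    {u : X.Cell 4} (hu : u ∈ A.cells 4) (hu' : u ∈ A'.cells 4) {a b : Fin 6} (ha : IsUpper a)
    (hb : IsUpper b) (hab : a ≠ b) (i : Fin 5) : X.face u i ≠ H.opp₂ a b := by
  classical
  intro hi
  have key : ∀ a, IsUpper a → u ≠ H.opp₁ a := by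
    rintro a ha rfl
    rcases (hm.pentachora.mem_iff _).1 hu' with h | h
    · exact h.2 (by convert mem_old_pent (H := H) ha)
    · exact Finset.disjoint_left.1 hm.pentachora.2.1 h hu
  rcases hm.incidences hA ha hb hab hu hi with h | h
  · exact key a ha h
  · exact key b hb h

end Hexateron

theorem IsReplacement.disjoint_old {C : Type*} {a b old new : Finset C}
    (h : IsReplacement a b old new) : Disjoint old b :=
  h.symm.2.1

theorem IsReplacement.eq_union {C : Type*} [DecidableEq C] {a b old new : Finset C}
    (h : IsReplacement a b old new) : a = old ∪ (a ∩ b) := by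
  ext x
  have h1 := @h.1 x
  have h2 := h.mem_iff x
  simp only [Finset.mem_union, Finset.mem_inter]
  tauto

open Classical in
theorem coeff_berezin_weights_of_isReplacement (D : WeightData X) {A A' : Subcomplex X}
    {u₁ u₂ u₃ : X.Cell 4} {t₁ t₂ t₃ : X.Cell 3} {newTet : Finset (X.Cell 3)}
    {newPent : Finset (X.Cell 4)}
    (ht : IsReplacement (A.cells 3) (A'.cells 3) {t₁, t₂, t₃} newTet)
    (hu : IsReplacement (A.cells 4) (A'.cells 4) {u₁, u₂, u₃} newPent)
    (t12 : t₁ ≠ t₂) (t13 : t₁ ≠ t₃) (t23 : t₂ ≠ t₃)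
    (u12 : u₁ ≠ u₂) (u13 : u₁ ≠ u₃) (u23 : u₂ ≠ u₃)
    (hface : ∀ u ∈ A.cells 4, u ∈ A'.cells 4 → ∀ i,
      X.face u i ≠ t₁ ∧ X.face u i ≠ t₂ ∧ X.face u i ≠ t₃)
    {ι : Type*} (R : ι → A.cells 3) (hR : ∀ i, (R i).1 ∈ A'.cells 3) {k : ℕ}
    {l : Fin k → X.Cell 3} (hl : Function.Injective l)
    (hlr : ∀ t, t ∈ Set.range l ↔ t ∈ A.cells 3 ∧ t ∈ A'.cells 3 ∧ ∀ i, (R i).1 ≠ t) :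
    Nonempty (Fin (k + 1 + 1 + 1) ≃ {t : A.cells 3 // t ∉ Set.range R}) ∧
    ∀ n, k + 1 + 1 + 1 = n * 2 → ∃ S : Fin n × Fin 2 ≃ {t : A.cells 3 // t ∉ Set.range R},
      coeff l (berezin t₃ (berezin t₂ (berezin t₁ (D.weight u₁ * D.weight u₂ * D.weight u₃))) *
        IsNilpotent.exp (∑ u ∈ A.cells 4 ∩ A'.cells 4, D.exponent u)) =
      (-1) ^ (k + 1 + 1 + 1).choose 2 * (2 ^ n *
        pfaffian ((f₃ D A).submatrix (fun s => (S s).1) fun s => (S s).1)) := by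
  have hold : ∀ t ∈ ({t₁, t₂, t₃} : Finset (X.Cell 3)), t ∈ A.cells 3 ∧ t ∉ A'.cells 3 :=
    fun t h => ⟨ht.1 h, Finset.disjoint_left.1 ht.disjoint_old h⟩
  have holdu : ∀ u ∈ ({u₁, u₂, u₃} : Finset (X.Cell 4)), u ∉ A'.cells 4 :=
    fun t h => Finset.disjoint_left.1 hu.disjoint_old h
  simp only [Finset.mem_insert, Finset.mem_singleton, forall_eq_or_imp, forall_eq] at hold holdu
  obtain ⟨⟨a₁, a₁'⟩, ⟨a₂, a₂'⟩, ⟨a₃, a₃'⟩⟩ := hold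
  have hlj := fun j => (hlr (l j)).1 ⟨j, rfl⟩
  have hA := hu.eq_union
  rw [Finset.insert_union, Finset.insert_union, Finset.singleton_union] at hA
  refine coeff_berezin_weights_eq D A a₁ a₂ a₃ t12 t13 t23 hA ?_ ?_ ?_ ?_ R hl
    (fun j => (hlj j).1) ?_ ?_
  · simp [u12, u13, holdu.1]
  · simp [u23, holdu.2.1]
  · simp [holdu.2.2]
  · intro u h i
    rw [Finset.mem_inter] at h
    exact hface u h.1 h.2 i
  · intro j
    have h := (hlj j).2.1
    refine ⟨?_, ?_, ?_⟩ <;> rintro he <;> rw [he] at h <;> contradiction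
  · intro t hA
    rw [hlr]
    constructor
    · intro h
      by_cases h' : t ∈ A'.cells 3
      · exact Or.inr (Or.inr (Or.inr ⟨hA, h', h⟩))
      · have h1 : t ∈ ({t₁, t₂, t₃} : Finset (X.Cell 3)) := by
          by_contra h2
          exact h' ((ht.mem_iff t).2 (Or.inl ⟨hA, h2⟩))
        simp only [Finset.mem_insert, Finset.mem_singleton] at h1
        tauto
    · rintro (rfl | rfl | rfl | h) i
      · exact fun he => a₁' (he ▸ hR i)
      · exact fun he => a₂' (he ▸ hR i)
      · exact fun he => a₃' (he ▸ hR i)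
      · exact h.2.2 i

namespace Hexateron

variable {H : Hexateron X} {A A' : Subcomplex X} {D : WeightData X}

theorem flip_t1234 : H.flip.t1234 = H.t3456 := H.opp₂_comm (a := 1) (b := 0) (by decide)

theorem flip_t1235 : H.flip.t1235 = H.t2456 := H.opp₂_comm (a := 2) (b := 0) (by decide)

theorem flip_t1236 : H.flip.t1236 = H.t1456 := H.opp₂_comm (a := 2) (b := 1) (by decide)

theorem IsMove33.face_ne_old (hm : H.IsMove33 A A') {o : X.Cell 4 → ℤˣ}
    (hA : IsClosedOriented A o) {u : X.Cell 4} (hu : u ∈ A.cells 4) (hu' : u ∈ A'.cells 4)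
    (i : Fin 5) : X.face u i ≠ H.t1234 ∧ X.face u i ≠ H.t1235 ∧ X.face u i ≠ H.t1236 :=
  have h3 : IsUpper 3 := by simp [isUpper_iff]
  have h4 : IsUpper 4 := by simp [isUpper_iff]
  have h5 : IsUpper 5 := by simp [isUpper_iff]
  ⟨hm.face_ne hA hu hu' h4 h5 (by decide) i, hm.face_ne hA hu hu' h3 h5 (by decide) i,
    hm.face_ne hA hu hu' h3 h4 (by decide) i⟩

/-- The relation of the move, restricted to the Grassmann variables that are left out of the minors,
is a relation between Pfaffians. -/
theorem IsMove33.exists_pfaffian_sq_eq (hm : H.IsMove33 A A') (hA : IsClosedOriented A D.o)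
    (hA' : IsClosedOriented A' D.o) (hrel : H.lhs33 D = H.rhs33 D ∨ H.lhs33 D = -H.rhs33 D)
    {ι ι' : Type*} (R : ι → A.cells 3) (R' : ι' → A'.cells 3) (hR : ∀ i, (R i).1 ∈ A'.cells 3)
    (hR' : ∀ i, (R' i).1 ∈ A.cells 3) (hRR' : ∀ t, (∀ i, (R' i).1 ≠ t) ↔ ∀ i, (R i).1 ≠ t) {n : ℕ}
    (S₀ : Fin n × Fin 2 ≃ {t : A.cells 3 // t ∉ Set.range R}) :
    ∃ (S : Fin n × Fin 2 ≃ {t : A.cells 3 // t ∉ Set.range R})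
      (S' : Fin n × Fin 2 ≃ {t : A'.cells 3 // t ∉ Set.range R'}),
      ((D.η H.p12345 * D.η H.p12346 * D.η H.p12356 / D.q H.s123) *
        pfaffian ((f₃ D A).submatrix (fun s => (S s).1) fun s => (S s).1)) ^ 2 =
      ((D.η H.p12456 * D.η H.p13456 * D.η H.p23456 / D.q H.s456) *
        pfaffian ((f₃ D A').submatrix (fun s => (S' s).1) fun s => (S' s).1)) ^ 2 := by
  classical
  -- The common tetrahedra not used as rows. The same list serves both triangulations, so the two
  -- sides of the relation are tested by the same functional `coeff l`.
  set C : Finset (X.Cell 3) :=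
    (A.cells 3).filter fun t => t ∈ A'.cells 3 ∧ ∀ i, (R i).1 ≠ t with hC
  set l : Fin C.card → X.Cell 3 := fun j => (C.equivFin.symm j).1 with hl
  have hlinj : Function.Injective l := Subtype.val_injective.comp C.equivFin.symm.injective
  have hlr : ∀ t, t ∈ Set.range l ↔ t ∈ A.cells 3 ∧ t ∈ A'.cells 3 ∧ ∀ i, (R i).1 ≠ t := by
    intro t
    rw [show (t ∈ A.cells 3 ∧ t ∈ A'.cells 3 ∧ ∀ i, (R i).1 ≠ t) ↔ t ∈ C by simp [hC]]
    constructor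
    · rintro ⟨j, rfl⟩
      exact (C.equivFin.symm j).2
    · intro ht
      exact ⟨C.equivFin ⟨t, ht⟩, by simp [hl]⟩
  obtain ⟨d12, d13, d23⟩ := H.t_distinct
  obtain ⟨e12, e13, e23⟩ := H.flip.t_distinct
  rw [flip_t1234, flip_t1235] at e12
  rw [flip_t1234, flip_t1236] at e13
  rw [flip_t1235, flip_t1236] at e23
  obtain ⟨⟨E⟩, hS⟩ := coeff_berezin_weights_of_isReplacement D hm.tetrahedra hm.pentachora
    d12 d13 d23 (H.opp₁_injective.ne (by decide)) (H.opp₁_injective.ne (by decide))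
    (H.opp₁_injective.ne (by decide)) (fun u hu hu' i => hm.face_ne_old hA hu hu' i) R hR hlinj hlr
  obtain ⟨-, hS'⟩ := coeff_berezin_weights_of_isReplacement D hm.tetrahedra.symm
    hm.pentachora.symm e23.symm e13.symm e12.symm (H.opp₁_injective.ne (by decide))
    (H.opp₁_injective.ne (by decide)) (H.opp₁_injective.ne (by decide))
    (fun u hu hu' i => by
      have := hm.flip.face_ne_old hA' hu hu' i
      rw [flip_t1234, flip_t1235, flip_t1236] at this
      tauto) R' hR' hlinj (fun t => by rw [hlr, hRR']; tauto)
  have hk : C.card + 1 + 1 + 1 = n * 2 := by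
    have := Fintype.card_congr (E.trans S₀.symm)
    simpa using this
  obtain ⟨S, hS⟩ := hS n hk
  obtain ⟨S', hS'⟩ := hS' n hk
  rw [Finset.inter_comm] at hS'
  set κ := D.η H.p12345 * D.η H.p12346 * D.η H.p12356 / D.q H.s123 with hκ
  set κ' := D.η H.p12456 * D.η H.p13456 * D.η H.p23456 / D.q H.s456 with hκ'
  set pf := pfaffian ((f₃ D A).submatrix (fun s => (S s).1) fun s => (S s).1) with hpfd
  set pf' := pfaffian ((f₃ D A').submatrix (fun s => (S' s).1) fun s => (S' s).1) with hpfd'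
  set E₀ := IsNilpotent.exp (∑ u ∈ A.cells 4 ∩ A'.cells 4, D.exponent u) with hE
  -- The same nonzero constant occurs on both sides, because equally many variables are integrated.
  set c : ℂ := (-1) ^ (C.card + 1 + 1 + 1).choose 2 * 2 ^ n with hc
  have hc0 : c ≠ 0 := mul_ne_zero (pow_ne_zero _ (by norm_num)) (pow_ne_zero _ two_ne_zero)
  have hlhs : coeff l (H.lhs33 D * E₀) = κ * (c * pf) := by
    rw [lhs33, smul_mul_assoc, map_smul, hS, smul_eq_mul, hc, mul_assoc (_ ^ _)]
  have hrhs : coeff l (H.rhs33 D * E₀) = κ' * (c * pf') := by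
    rw [rhs33, smul_mul_assoc, map_smul, hS', smul_eq_mul, hc, mul_assoc (_ ^ _)]
  have hsq : (κ * pf) ^ 2 = (κ' * pf') ^ 2 := by
    have h1 : (κ * (c * pf)) ^ 2 = (κ' * (c * pf')) ^ 2 := by
      rcases hrel with h | h
      · rw [← hlhs, ← hrhs, h]
      · rw [← hlhs, ← hrhs, h, neg_mul, map_neg, neg_sq]
    refine mul_left_cancel₀ (pow_ne_zero 2 hc0) ?_
    linear_combination h1
  exact ⟨S, S', hsq⟩

open Classical in
/-- There are nonzero minors for both triangulations that lead to the same value of the invariant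
up to a sign. -/
theorem IsMove33.exists_minorChoice (hm : H.IsMove33 A A') (hA : IsClosedOriented A D.o)
    (hA' : IsClosedOriented A' D.o) {hD : D.IsAdmissible A} {hD' : D.IsAdmissible A'}
    (hac : IsAcyclic D A hD) (hac' : IsAcyclic D A' hD') {h : ℕ} (b : CocycleBasis A h)
    (b' : CocycleBasis A' h) (hb : SameCohomologyBasis b b')
    (hrel : H.lhs33 D = H.rhs33 D ∨ H.lhs33 D = -H.rhs33 D) :
    ∃ (m : MinorChoice b) (m' : MinorChoice b'),
      (m.minor₁ hD ≠ 0 ∧ m.minor₂ D ≠ 0 ∧ m.pf₃ D ≠ 0) ∧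
      (m'.minor₁ hD' ≠ 0 ∧ m'.minor₂ D ≠ 0 ∧ m'.pf₃ D ≠ 0) ∧
      ((D.η H.p12345 * D.η H.p12346 * D.η H.p12356 / D.q H.s123) * m.sqrtTorsion hD) ^ 2 =
      ((D.η H.p12456 * D.η H.p13456 * D.η H.p23456 / D.q H.s456) * m'.sqrtTorsion hD') ^ 2 := by
  obtain ⟨i₀, R, hi₀, hR, hdet⟩ := hm.exists_rows hA hac b
  obtain ⟨φ, hφ⟩ := hac.exists_dual
  obtain ⟨i₀', R', hi₀', hRR', hN⟩ := hm.exists_transported_rows hac' b b' hb R hR φ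
  have hR' : ∀ i, (R' i).1 ∈ A.cells 3 := by
    intro i
    by_contra hi
    exact (hRR' (R' i).1).2 (fun j hj => hi (hj ▸ (R j).2)) i rfl
  -- Transporting `φ` keeps its value 1 on `ω` and makes the bordered matrices of both
  -- triangulations comparable.
  set φ' := φ ∘ₗ hm.cocycleEquiv.symm.toLinearMap with hφ'
  have hφ'1 : φ' (omegaCocycle D A' hD') = 1 := by
    rw [← hφ, hφ', ← hm.cocycleEquiv_omegaCocycle hD hD']
    simp
  have hd := det_borderedMatrix (f₂ D A) φ b.basis i₀ R _ hφ hac.f₂_omegaCocycle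
  have hd' := det_borderedMatrix (f₂ D A') φ' b'.basis i₀' R' _ hφ'1 hac'.f₂_omegaCocycle
  have hN0 : (borderedMatrix (f₂ D A) φ b.basis i₀ R).det ≠ 0 := fun h0 =>
    hdet (by rw [← hd, h0, zero_mul])
  have hN0' : (borderedMatrix (f₂ D A') φ' b'.basis i₀' R').det ≠ 0 := fun h0 => by
    rw [h0, zero_pow two_ne_zero, eq_comm] at hN
    exact hN0 (pow_eq_zero_iff two_ne_zero |>.1 hN)
  have hdet' := mul_ne_zero hN0' hi₀'
  rw [hd'] at hdet'
  obtain ⟨⟨n, ⟨S₀⟩⟩, hpf⟩ := hac.exists_pfaffian hi₀ R hdet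
  obtain ⟨-, hpf'⟩ := hac'.exists_pfaffian hi₀' R' hdet'
  obtain ⟨S, S', hsq⟩ := hm.exists_pfaffian_sq_eq hA hA' hrel R R' hR hR' hRR' S₀
  let m : MinorChoice b := ⟨i₀, R, n, S⟩
  let m' : MinorChoice b' := ⟨i₀', R', n, S'⟩
  have hm₁ : m.minor₁ hD ≠ 0 := by rw [MinorChoice.minor₁, f₁_one]; exact hi₀
  have hm₁' : m'.minor₁ hD' ≠ 0 := by rw [MinorChoice.minor₁, f₁_one]; exact hi₀'
  refine ⟨m, m', ⟨hm₁, ?_, hpf n S⟩, ⟨hm₁', ?_, hpf' n S'⟩, ?_⟩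
  · unfold MinorChoice.minor₂
    convert hdet
  · unfold MinorChoice.minor₂
    convert hdet'
  · rw [m.sqrtTorsion_eq hac hφ hm₁, m'.sqrtTorsion_eq hac' hφ'1 hm₁']
    have e₁ : m.borderedMinor D φ = (borderedMatrix (f₂ D A) φ b.basis i₀ R).det := by
      unfold MinorChoice.borderedMinor
      congr!
    have e₂ : m'.borderedMinor D φ' = (borderedMatrix (f₂ D A') φ' b'.basis i₀' R').det := by
      unfold MinorChoice.borderedMinor
      congr!
    rw [e₁, e₂, ← mul_div_assoc, ← mul_div_assoc, div_pow, div_pow, hN]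
    exact congrArg (· / _) hsq

end Hexateron

end ExoticTorsion
end

theorem theorem4p1 {X : ExoticTorsion.DeltaComplex} (H : ExoticTorsion.Hexateron X)
    (A A' : ExoticTorsion.Subcomplex X) (hmove : H.IsMove33 A A')
    (D : ExoticTorsion.WeightData X)
    (hA : ExoticTorsion.IsClosedOriented A D.o) (hA' : ExoticTorsion.IsClosedOriented A' D.o)
    (hD : D.IsAdmissible A) (hD' : D.IsAdmissible A')
    (hacyclic : ExoticTorsion.IsAcyclic D A hD) (hacyclic' : ExoticTorsion.IsAcyclic D A' hD')
    (h : ℕ) (b : ExoticTorsion.CocycleBasis A h) (b' : ExoticTorsion.CocycleBasis A' h)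
    (hbasis : ExoticTorsion.SameCohomologyBasis b b')
    (relation33 : H.lhs33 D = H.rhs33 D ∨ H.lhs33 D = -H.rhs33 D) :
    (∃ x, ExoticTorsion.IsValueOfI hD b x) ∧ (∃ y, ExoticTorsion.IsValueOfI hD' b' y) ∧
      ∀ x y, ExoticTorsion.IsValueOfI hD b x → ExoticTorsion.IsValueOfI hD' b' y →
        x = y ∨ x = -y := by
  classical
  obtain ⟨m, m', ⟨hm₁, hm₂, hm₃⟩, ⟨hm₁', hm₂', hm₃'⟩, hsq⟩ :=
    hmove.exists_minorChoice hA hA' hacyclic hacyclic' b b' hbasis relation33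
  refine ⟨⟨_, m, hm₁, hm₂, hm₃, rfl⟩, ⟨_, m', hm₁', hm₂', hm₃', rfl⟩, ?_⟩
  rintro _ _ ⟨p, hp₁, hp₂, -, rfl⟩ ⟨p', hp₁', hp₂', -, rfl⟩
  -- After squaring, the arbitrary minors `p`, `p'` may be replaced by the matched pair `m`, `m'`.
  rw [← sq_eq_sq_iff_eq_or_eq_neg, mul_pow _ (p.sqrtTorsion hD), mul_pow _ (p'.sqrtTorsion hD'),
    p.sqrtTorsion_sq_eq hacyclic m hp₁ hp₂ hm₁ hm₂,
    p'.sqrtTorsion_sq_eq hacyclic' m' hp₁' hp₂' hm₁' hm₂', ← mul_pow, ← mul_pow]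
  have e₁ : ∏ s ∈ A.cells 2, (D.q s)⁻¹ =
      (D.q H.s123)⁻¹ * ∏ s ∈ A.cells 2 ∩ A'.cells 2, (D.q s)⁻¹ := by
    conv_lhs => rw [hmove.faces.eq_union]
    rw [Finset.prod_union
      (hmove.faces.disjoint_old.mono_right Finset.inter_subset_right), Finset.prod_singleton]
  have e₂ : ∏ s ∈ A'.cells 2, (D.q s)⁻¹ =
      (D.q H.s456)⁻¹ * ∏ s ∈ A.cells 2 ∩ A'.cells 2, (D.q s)⁻¹ := by
    conv_lhs => rw [hmove.faces.symm.eq_union]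
    rw [Finset.prod_union
      (hmove.faces.symm.disjoint_old.mono_right Finset.inter_subset_right),
      Finset.prod_singleton, Finset.inter_comm]
  have hne : ∀ a b : Fin 6, a ≠ b → H.opp₁ a ≠ H.opp₁ b := fun _ _ => H.opp₁_injective.ne
  have e₃ : ∏ u ∈ A.cells 4, D.η u = D.η H.p12345 * (D.η H.p12346 * D.η H.p12356) *
      ∏ u ∈ A.cells 4 ∩ A'.cells 4, D.η u := by
    conv_lhs => rw [hmove.pentachora.eq_union]
    rw [Finset.prod_union
      (hmove.pentachora.disjoint_old.mono_right Finset.inter_subset_right),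
      Finset.prod_insert, Finset.prod_pair (show H.p12346 ≠ H.p12356 from hne 4 3 (by decide))]
    simpa using ⟨hne 5 4 (by decide), hne 5 3 (by decide)⟩
  have e₄ : ∏ u ∈ A'.cells 4, D.η u = D.η H.p12456 * (D.η H.p13456 * D.η H.p23456) *
      ∏ u ∈ A.cells 4 ∩ A'.cells 4, D.η u := by
    conv_lhs => rw [hmove.pentachora.symm.eq_union]
    rw [Finset.prod_union
      (hmove.pentachora.symm.disjoint_old.mono_right Finset.inter_subset_right),
      Finset.prod_insert, Finset.prod_pair (show H.p13456 ≠ H.p23456 from hne 1 0 (by decide)),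
      Finset.inter_comm]
    simpa using ⟨hne 2 1 (by decide), hne 2 0 (by decide)⟩
  rw [e₁, e₂, e₃, e₄]
  linear_combination (∏ s ∈ A.cells 2 ∩ A'.cells 2, (D.q s)⁻¹) ^ 2 *
    (∏ u ∈ A.cells 4 ∩ A'.cells 4, D.η u) ^ 2 * hsq
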